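/- **Conventions.** For a set $\mathfrak C$ of colors, a *profile* is a finite (possibly empty) tuple $\underline c=(c_1,\dots,c_n)$ in $\mathfrak C$, and $\underline c\sigma=(c_{\sigma(1)},\dots,c_{\sigma(n)})$ for $\sigma\in\Sigma_n$. $\mathbf{Op}_{\mathfrak C}(\mathbf{Set})$ is the category of symmetric $\mathfrak C$-colored operads $\mathcal O$ in sets: sets $\mathcal O\binom{t}{\underline c}$, right permutation actions $\mathcal O(\sigma):\mathcal O\binom{t}{\underline c}\to\mathcal O\binom{t}{\underline c\sigma}$, units $\mathbb 1\in\mathcal O\binom tt$ and compositions $\gamma$, with the usual equivariance, associativity and unit axioms. $\mathbf{Op}(\mathbf{Set})$ is the category of pairs $(\mathfrak C,\mathcal O)$, with morphisms $(f,\phi):(\mathfrak C,\mathcal O)\to(\mathfrak D,\mathcal P)$ given by a map $f:\mathfrak C\to\mathfrak D$ and a morphism $\phi:\mathcal O\to f^*\mathcal P$ in $\mathbf{Op}_{\mathfrak C}(\mathbf{Set})$, where $(f^*\mathcal P)\binom{t}{\underline c}=\mathcal P\binom{f(t)}{f(\underline c)}$. For a family of sets $X\binom{t}{\underline c}$ without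 permutation actions (a non-symmetric sequence), $F(X^{\mathsf{sym}})$ is the free $\mathfrak C$-colored operad on the free symmetrization $X^{\mathsf{sym}}$ of $X$; morphisms $F(X^{\mathsf{sym}})\to\mathcal P$ correspond bijectively to families of maps $X\binom{t}{\underline c}\to\mathcal P\binom{t}{\underline c}$, and they are denoted alike. **The operads.** Let $\mathbf C$ be a small category with set of objects $\mathbf C_0$. The $\mathbf C_0$-colored operad $\mathcal O_{\mathbf C}$ has $\mathcal O_{\mathbf C}\binom{t}{\underline c}=\Sigma_n\times\prod_{i=1}^n\mathbf C(c_i,t)$, action $\mathcal O_{\mathbf C}(\sigma')(\sigma,\underline f)=(\sigma\sigma',\underline f\sigma')$, unit $(e,\mathrm{id}_t)$ and composition $$\gamma\Big((\sigma,\underline f)\otimes\bigotimes_{i=1}^m(\sigma_i,\underline g_i)\Big)=\Big(\sigma\langle k_{\sigma^{-1}(1)},\dots,k_{\sigma^{-1}(m)}\rangle\,(\sigma_1\oplus\dots\oplus\sigma_m),\,(f_1\underline g_1,\dots,f_m\underline g_m)\Big),$$ where $k_i$ is the length of $\underline g_i$, $f_i\underline g_i$ is $\underline g_i$ with each entry composed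 with $f_i$, $\oplus$ is the block sum, and $\sigma\langle k_{\sigma^{-1}(1)},\dots,k_{\sigma^{-1}(m)}\rangle$ is the block permutation that moves the $i$-th block (of length $k_i$) to the $\sigma(i)$-th place. An *orthogonal category* $\overline{\mathbf C}=(\mathbf C,\perp)$ is a small category with a symmetric relation $\perp$ on pairs of morphisms with common target such that $f_1\perp f_2$ implies $gf_1h_1\perp gf_2h_2$ for all composable $g,h_1,h_2$; *orthogonal functors* are functors that preserve $\perp$. These form the category $\mathbf{OrthCat}$. The operad $\mathcal O_{\overline{\mathbf C}}$ is the object-wise quotient of $\mathcal O_{\mathbf C}$ by the relation: $(\sigma,\underline f)\sim_\perp(\sigma',\underline f')$ iff $\underline f=\underline f'$ and $\sigma\sigma'^{-1}=\tau_1\cdots\tau_N:\underline f\sigma^{-1}\to\underline f\sigma'^{-1}$ is a product ($N\ge 0$) of transpositions of adjacent orthogonal pairs, that is, each $\tau_k$ transposes two neighbouring entries of $\underline f\sigma^{-1}\tau_1\cdots\tau_{k-1}$ that are orthogonal. Let $p_{\overline{\mathbf C}}:\mathcal O_{\mathbf C}\to\mathcal O_{\overline{\mathbf C}}$ be the projection.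 **Generators and relations.** The generators $G_{\mathbf C}$ are $1_t\in G_{\mathbf C}\binom t\emptyset$ and $\mu_t\in G_{\mathbf C}\binom t{(t,t)}$ for $t\in\mathbf C_0$, and $f\in G_{\mathbf C}\binom tc$ for each morphism $f:c\to t$ of $\mathbf C$. The relations $R_{\mathbf C}=R_{\mathrm{Fun}}\sqcup R_{\mathrm{Mon}}\sqcup R_{\mathrm{FM}}$, and the maps $r_{\mathbf C,1},r_{\mathbf C,2}:R_{\mathbf C}\to F(G_{\mathbf C}^{\mathsf{sym}})$ that give their left- and right-hand sides, are: * functoriality: $\gamma(f\otimes g)=fg$ for all composable $f,g$, and $\mathbb 1=\mathrm{id}_t$ for all $t$; * monoid: $\gamma(\mu_t\otimes1_t\otimes\mathbb 1)=\mathbb 1$, $\ \gamma(\mu_t\otimes\mathbb 1\otimes1_t)=\mathbb 1$, $\ \gamma(\mu_t\otimes\mu_t\otimes\mathbb 1)=\gamma(\mu_t\otimes\mathbb 1\otimes\mu_t)$ for all $t$; * compatibility: $\gamma(f\otimes1_c)=1_t$, $\ \gamma(f\otimes\mu_c)=\gamma(\mu_t\otimes f\otimes f)$ for all $f:c\to t$.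 For $\overline{\mathbf C}$ put $R_{\overline{\mathbf C}}=R_{\mathbf C}\sqcup R_\perp$, with the additional $\perp$-commutativity relations * $\gamma(\mu_t\otimes f_1\otimes f_2)=F(G_{\mathbf C}^{\mathsf{sym}})(\tau)\,\gamma(\mu_t\otimes f_2\otimes f_1)$ for all $f_1:c_1\to t$, $f_2:c_2\to t$ with $f_1\perp f_2$, where $\tau\in\Sigma_2$ is the transposition, and corresponding maps $r_{\overline{\mathbf C},1},r_{\overline{\mathbf C},2}$. Let $q_{\mathbf C}:F(G_{\mathbf C}^{\mathsf{sym}})\to\mathcal O_{\mathbf C}$ be given by $1_t\mapsto(e,*)$, $f\mapsto(e,f)$, $\mu_t\mapsto(e,(\mathrm{id}_t,\mathrm{id}_t))$, and let $s_{\perp,1},s_{\perp,2}:F(R_\perp^{\mathsf{sym}})\to\mathcal O_{\mathbf C}$ be given by $(f_1,f_2)\mapsto(e,(f_1,f_2))$ and $(f_1,f_2)\mapsto(\tau,(f_1,f_2))$. **Theorem.** 1. For every small category $\mathbf C$, $$F(R_{\mathbf C}^{\mathsf{sym}})\underset{r_{\mathbf C,2}}{\overset{r_{\mathbf C,1}}{\rightrightarrows}}F(G_{\mathbf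 C}^{\mathsf{sym}})\xrightarrow{\,q_{\mathbf C}\,}\mathcal O_{\mathbf C}$$ is a coequalizer in $\mathbf{Op}_{\mathbf C_0}(\mathbf{Set})$. 2. For every orthogonal category $\overline{\mathbf C}=(\mathbf C,\perp)$, $$F(R_{\overline{\mathbf C}}^{\mathsf{sym}})\underset{r_{\overline{\mathbf C},2}}{\overset{r_{\overline{\mathbf C},1}}{\rightrightarrows}}F(G_{\mathbf C}^{\mathsf{sym}})\xrightarrow{\,p_{\overline{\mathbf C}}\,q_{\mathbf C}\,}\mathcal O_{\overline{\mathbf C}}\qquad\text{and}\qquad F(R_\perp^{\mathsf{sym}})\underset{s_{\perp,2}}{\overset{s_{\perp,1}}{\rightrightarrows}}\mathcal O_{\mathbf C}\xrightarrow{\,p_{\overline{\mathbf C}}\,}\mathcal O_{\overline{\mathbf C}}$$ are coequalizers in $\mathbf{Op}_{\mathbf C_0}(\mathbf{Set})$. 3. The coequalizer in 1 is natural in $\mathbf C\in\mathbf{Cat}$, and the first coequalizer in 2 is natural in $\overline{\mathbf C}\in\mathbf{OrthCat}$. That is, the assignments $\mathbf C\mapsto F(R_{\mathbf C}^{\mathsf{sym}}),\,F(G_{\mathbf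 C}^{\mathsf{sym}}),\,\mathcal O_{\mathbf C}$ and $\overline{\mathbf C}\mapsto F(R_{\overline{\mathbf C}}^{\mathsf{sym}}),\,F(G_{\mathbf C}^{\mathsf{sym}}),\,\mathcal O_{\overline{\mathbf C}}$ extend, by application of (orthogonal) functors to all objects and morphisms of $\mathbf C$, to functors $\mathbf{Cat}\to\mathbf{Op}(\mathbf{Set})$ and $\mathbf{OrthCat}\to\mathbf{Op}(\mathbf{Set})$, and the morphisms $r_{\mathbf C,1},r_{\mathbf C,2},q_{\mathbf C}$, respectively $r_{\overline{\mathbf C},1},r_{\overline{\mathbf C},2},p_{\overline{\mathbf C}}\,q_{\mathbf C}$, are the components of natural transformations between these functors. -/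

import Mathlib

open CategoryTheory

universe u

namespace ColOp

/-- A profile `(c₁, …, cₙ)` of colors: a finite tuple, possibly empty. -/
@[ext]
structure Profile (C : Type u) where
  n : ℕ
  color : Fin n → C

namespace Profile

variable {C : Type u}

/-- A morphism `σ : c ⟶ d` in the groupoid of profiles is a permutation `σ` with `d = c σ`, where
`c σ = (c_{σ(1)}, …, c_{σ(n)})`. Covariant functors on profiles therefore carry right permutation
actions. -/
@[ext]
structure Hom (c d : Profile C) where
  equiv : Fin d.n ≃ Fin c.n
  color_eq : ∀ i, d.color i = c.color (equiv i)

instance : Category (Profile C) where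
  Hom := Hom
  id c := ⟨Equiv.refl _, fun _ => rfl⟩
  comp f g := ⟨g.equiv.trans f.equiv, fun i => (g.color_eq i).trans (f.color_eq _)⟩

/-- The constant profile `(t, …, t)` of length `n`; `pow t 0` is the empty profile. -/
abbrev pow (t : C) (n : ℕ) : Profile C := ⟨n, fun _ => t⟩

/-- The profile `(t)` of length one. -/
abbrev single (t : C) : Profile C := pow t 1

/-- The positions of a concatenation: pairs (block, position in the block) in lexicographic order. -/
def concatEquiv {m : ℕ} (b : Fin m → Profile C) : (Σ i, Fin (b i).n) ≃ Fin (∑ i, (b i).n) :=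
  finSigmaFinEquiv

/-- The concatenation `(b₁, …, bₘ)` of profiles. -/
abbrev concat {m : ℕ} (b : Fin m → Profile C) : Profile C where
  n := ∑ i, (b i).n
  color j := (b ((concatEquiv b).symm j).1).color ((concatEquiv b).symm j).2

/-- The permuted profile `a σ = (a_{σ(1)}, …, a_{σ(n)})`. -/
abbrev perm (a : Profile C) (σ : Equiv.Perm (Fin a.n)) : Profile C :=
  ⟨a.n, fun i => a.color (σ i)⟩

/-- `σ` as a morphism of profiles `a ⟶ a σ`. -/
def permHom (a : Profile C) (σ : Equiv.Perm (Fin a.n)) : a ⟶ a.perm σ :=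
  Hom.mk σ fun _ => rfl

/-- The block permutation `σ⟨k_{σ(1)}, …, k_{σ(m)}⟩`: position `j` of block `i` of the permuted
concatenation goes to position `j` of block `σ i`. -/
def blockPerm {m : ℕ} (k : Fin m → ℕ) (σ : Equiv.Perm (Fin m)) :
    Fin (∑ i, k (σ i)) ≃ Fin (∑ i, k i) :=
  finSigmaFinEquiv.symm.trans
    ((Equiv.sigmaCongrLeft (β := fun i => Fin (k i)) σ).trans finSigmaFinEquiv)

/-- The sum (block diagonal) of permutations, which acts on block `i` by `e i`. -/
def blockSum {m : ℕ} {k l : Fin m → ℕ} (e : ∀ i, Fin (k i) ≃ Fin (l i)) :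
    Fin (∑ i, k i) ≃ Fin (∑ i, l i) :=
  finSigmaFinEquiv.symm.trans ((Equiv.sigmaCongrRight e).trans finSigmaFinEquiv)

theorem concat_color {m : ℕ} (b : Fin m → Profile C) (p : Σ i, Fin (b i).n) :
    (concat b).color (concatEquiv b p) = (b p.1).color p.2 :=
  congrArg (fun q : Σ i, Fin (b i).n => (b q.1).color q.2) (Equiv.symm_apply_apply _ p)

theorem blockPerm_mk {m : ℕ} (k : Fin m → ℕ) (σ : Equiv.Perm (Fin m)) (p : Σ i, Fin (k (σ i))) :
    blockPerm k σ (finSigmaFinEquiv p) = finSigmaFinEquiv ⟨σ p.1, p.2⟩ := by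
  simp only [blockPerm, Equiv.trans_apply, Equiv.symm_apply_apply]
  rfl

theorem blockSum_mk {m : ℕ} {k l : Fin m → ℕ} (e : ∀ i, Fin (k i) ≃ Fin (l i))
    (p : Σ i, Fin (k i)) :
    blockSum e (finSigmaFinEquiv p) = finSigmaFinEquiv ⟨p.1, e p.1 p.2⟩ := by
  simp only [blockSum, Equiv.trans_apply, Equiv.symm_apply_apply]
  rfl

/-- The block permutation as a morphism of profiles `(b₁, …, bₘ) ⟶ (b_{σ(1)}, …, b_{σ(m)})`. -/
def blockPermHom {m : ℕ} (b : Fin m → Profile C) (σ : Equiv.Perm (Fin m)) :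
    concat b ⟶ concat (fun i => b (σ i)) :=
  Hom.mk (blockPerm (fun i => (b i).n) σ) fun i => by
    obtain ⟨p, rfl⟩ := (concatEquiv fun i => b (σ i)).surjective i
    exact (concat_color _ p).trans (((congrArg (concat b).color
      (blockPerm_mk (fun i => (b i).n) σ p)).trans (concat_color b ⟨σ p.1, p.2⟩)).symm)

/-- The sum of permutations as a morphism of profiles `(b₁, …, bₘ) ⟶ (b₁ σ₁, …, bₘ σₘ)`. -/
def blockSumHom {m : ℕ} {b b' : Fin m → Profile C} (f : ∀ i, b i ⟶ b' i) :
    concat b ⟶ concat b' :=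
  Hom.mk (blockSum fun i => (f i).equiv) fun i => by
    obtain ⟨p, rfl⟩ := (concatEquiv b').surjective i
    refine (concat_color _ p).trans (((f p.1).color_eq p.2).trans ?_)
    exact ((congrArg (concat b).color
      (blockSum_mk (fun i => (f i).equiv) p)).trans (concat_color b ⟨p.1, (f p.1).equiv p.2⟩)).symm

theorem blockPermHom_equiv {m : ℕ} (b : Fin m → Profile C) (σ : Equiv.Perm (Fin m))
    (p : Σ i, Fin (b (σ i)).n) :
    (blockPermHom b σ).equiv (concatEquiv _ p) = concatEquiv b ⟨σ p.1, p.2⟩ :=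
  blockPerm_mk (fun i => (b i).n) σ p

theorem blockSumHom_equiv {m : ℕ} {b b' : Fin m → Profile C} (f : ∀ i, b i ⟶ b' i)
    (p : Σ i, Fin (b' i).n) :
    (blockSumHom f).equiv (concatEquiv _ p) = concatEquiv b ⟨p.1, (f p.1).equiv p.2⟩ :=
  blockSum_mk (fun i => (f i).equiv) p

theorem finSigma_lt_of_lt {m : ℕ} {k : Fin m → ℕ} (p q : Σ i, Fin (k i)) (h : p.1 < q.1) :
    finSigmaFinEquiv p < finSigmaFinEquiv q := by
  rw [Fin.lt_def, finSigmaFinEquiv_apply, finSigmaFinEquiv_apply]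
  let g : ℕ → ℕ := fun i => if hi : i < m then k ⟨i, hi⟩ else 0
  have hg : ∀ r : Fin m, ∑ i : Fin r, k (Fin.castLE r.2.le i) = ∑ i ∈ Finset.range r, g i := by
    intro r
    rw [← Fin.sum_univ_eq_sum_range]
    refine Finset.sum_congr rfl fun i _ => ?_
    have : (i : ℕ) < m := i.2.trans r.2
    simp [g, this, Fin.castLE]
  rw [hg, hg]
  have h1 : ∑ i ∈ Finset.range (p.1 + 1), g i ≤ ∑ i ∈ Finset.range q.1, g i :=
    Finset.sum_le_sum_of_subset (Finset.range_mono h)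
  have h2 : g p.1 = k p.1 := by simp [g]
  have h3 := p.2.2
  rw [Finset.sum_range_succ] at h1
  omega

theorem finSigma_lt_same {m : ℕ} {k : Fin m → ℕ} (i : Fin m) (a b : Fin (k i)) :
    finSigmaFinEquiv (⟨i, a⟩ : Σ i, Fin (k i)) < finSigmaFinEquiv ⟨i, b⟩ ↔ a < b := by
  rw [Fin.lt_def, finSigmaFinEquiv_apply, finSigmaFinEquiv_apply, Fin.lt_def]
  simp

theorem finSigma_lt {m : ℕ} {k : Fin m → ℕ} (p q : Σ i, Fin (k i)) :
    finSigmaFinEquiv p < finSigmaFinEquiv q ↔ Sigma.Lex (· < ·) (fun _ => (· < ·)) p q := by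
  rw [Sigma.lex_iff]
  obtain ⟨i, a⟩ := p
  obtain ⟨j, b⟩ := q
  rcases lt_trichotomy i j with h | rfl | h
  · exact ⟨fun _ => Or.inl h, fun _ => finSigma_lt_of_lt _ _ h⟩
  · rw [finSigma_lt_same]
    simp
  · have h' := finSigma_lt_of_lt (k := k) ⟨j, b⟩ ⟨i, a⟩ h
    refine ⟨fun h2 => absurd h2 h'.asymm, ?_⟩
    rintro (h2 | ⟨h2, -⟩)
    · exact absurd h2 h.asymm
    · exact absurd h2 h.ne'

theorem concat_lt {m : ℕ} (b : Fin m → Profile C) (p q : Σ i, Fin (b i).n) :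
    concatEquiv b p < concatEquiv b q ↔ Sigma.Lex (· < ·) (fun _ => (· < ·)) p q :=
  finSigma_lt (k := fun i => (b i).n) p q

theorem val_eq_of_lt {A : Type} {m n : ℕ} (e : A ≃ Fin m) (e' : A ≃ Fin n)
    (h : ∀ a b, e a < e b ↔ e' a < e' b) (a : A) : (e a : ℕ) = e' a := by
  let o : Fin m ≃o Fin n := StrictMono.orderIsoOfSurjective (e.symm.trans e')
    (fun x y hxy => by simpa [h] using (h (e.symm x) (e.symm y)).1 (by simpa using hxy))
    (Equiv.surjective _)
  have := Fin.coe_orderIso_apply o (e a)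
  rw [← this]; simp [o]

theorem eqToHom_val {c d : Profile C} (h : c = d) (i : Fin d.n) :
    ((eqToHom h).equiv i : ℕ) = i := by subst h; rfl

theorem n_eq {c d : Profile C} (σ : c ⟶ d) : c.n = d.n :=
  (Fin.equiv_iff_eq.1 ⟨σ.equiv⟩).symm

theorem hom_ext {c d : Profile C} {f g : c ⟶ d}
    (h : ∀ i, (f.equiv i : ℕ) = g.equiv i) : f = g :=
  Hom.ext (Equiv.ext fun i => Fin.ext (h i))

theorem eq_of_hom {c d : Profile C} (f : c ⟶ d) (h : ∀ i, (f.equiv i : ℕ) = i) : c = d := by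
  obtain ⟨e, he⟩ := f
  obtain ⟨n, c⟩ := c
  obtain ⟨m, d⟩ := d
  obtain rfl : n = m := (Fin.equiv_iff_eq.1 ⟨e⟩).symm
  have : e = Equiv.refl _ := Equiv.ext fun i => Fin.ext (h i)
  subst this
  congr 1
  funext i
  exact (he i).symm

theorem concat_concat_val {m : ℕ} {b : Fin m → Profile C}
    (c : ∀ i, Fin (b i).n → Profile C) (p : Fin (concat b).n)
    (l : Fin (c ((concatEquiv b).symm p).1 ((concatEquiv b).symm p).2).n) :
    (concatEquiv (fun p : Fin (concat b).n =>
        c ((concatEquiv b).symm p).1 ((concatEquiv b).symm p).2) ⟨p, l⟩ : ℕ) =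
      concatEquiv (fun i => concat (c i)) ⟨((concatEquiv b).symm p).1,
        concatEquiv (c _) ⟨((concatEquiv b).symm p).2, l⟩⟩ := by
  let E : (Σ p : Fin (concat b).n,
        Fin (c ((concatEquiv b).symm p).1 ((concatEquiv b).symm p).2).n) ≃
      (Σ i, Σ j, Fin (c i j).n) :=
    (Equiv.sigmaCongrLeft (β := fun s : (Σ i, Fin (b i).n) => Fin (c s.1 s.2).n)
      (concatEquiv b).symm).trans (Equiv.sigmaAssoc fun i j => Fin (c i j).n)
  let E' : (Σ i, Σ j, Fin (c i j).n) ≃ Fin (concat fun i => concat (c i)).n :=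
    (Equiv.sigmaCongrRight fun i => concatEquiv (c i)).trans
      (concatEquiv fun i => concat (c i))
  refine val_eq_of_lt (concatEquiv _) (E.trans E') ?_ ⟨p, l⟩
  clear p l
  have key : ∀ q q', Sigma.Lex (· < ·) (fun _ => (· < ·)) q q' → E' (E q) < E' (E q') := by
    rintro ⟨p, l⟩ ⟨p', l'⟩ h
    refine (concat_lt (fun i => concat (c i)) ⟨((concatEquiv b).symm p).1,
        concatEquiv (c _) ⟨((concatEquiv b).symm p).2, l⟩⟩ ⟨((concatEquiv b).symm p').1,
        concatEquiv (c _) ⟨((concatEquiv b).symm p').2, l'⟩⟩).2 ?_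
    cases h with
    | left _ _ h =>
      have h' := h
      rw [← (concatEquiv b).apply_symm_apply p, ← (concatEquiv b).apply_symm_apply p',
        concat_lt] at h'
      clear h
      generalize (concatEquiv b).symm p = s at *
      generalize (concatEquiv b).symm p' = s' at *
      cases h' with
      | left _ _ h => exact .left _ _ h
      | right _ _ h => exact .right _ _ ((concat_lt _ _ _).2 (.left _ _ h))
    | right _ _ h => exact .right _ _ ((concat_lt _ _ _).2 (.right _ _ h))
  intro q q'
  rw [concat_lt, Equiv.trans_apply, Equiv.trans_apply]
  refine ⟨key q q', fun h => ?_⟩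
  rcases lt_trichotomy (concatEquiv _ q) (concatEquiv _ q') with h' | h' | h'
  · exact (concat_lt _ _ _).1 h'
  · rw [(concatEquiv _).injective h'] at h
    exact absurd h (lt_irrefl _)
  · exact absurd h (key _ _ ((concat_lt _ _ _).1 h')).asymm

theorem exists_concat_concat {m : ℕ} {b : Fin m → Profile C} (c : ∀ i, Fin (b i).n → Profile C)
    (q : Fin (concat fun i => concat (c i)).n) :
    ∃ (p : Fin (concat b).n)
      (l : Fin (c ((concatEquiv b).symm p).1 ((concatEquiv b).symm p).2).n),
      q = concatEquiv (fun i => concat (c i)) ⟨((concatEquiv b).symm p).1,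
        concatEquiv (c _) ⟨((concatEquiv b).symm p).2, l⟩⟩ := by
  obtain ⟨⟨i, q⟩, rfl⟩ := (concatEquiv _).surjective q
  obtain ⟨⟨j, l⟩, rfl⟩ := (concatEquiv _).surjective q
  obtain ⟨p, hp⟩ : ∃ p, (concatEquiv b).symm p = ⟨i, j⟩ := (concatEquiv b).symm.surjective _
  obtain ⟨rfl, hp⟩ := Sigma.mk.inj_iff.1 hp
  obtain rfl := eq_of_heq hp
  exact ⟨p, l, rfl⟩

theorem concat_concat {m : ℕ} {b : Fin m → Profile C} (c : ∀ i, Fin (b i).n → Profile C) :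
    concat (fun p : Fin (concat b).n =>
      c ((concatEquiv b).symm p).1 ((concatEquiv b).symm p).2) =
      concat (fun i => concat (c i)) := by
  have hs : (concat fun i => concat (c i)).n = (concat (fun p : Fin (concat b).n =>
      c ((concatEquiv b).symm p).1 ((concatEquiv b).symm p).2)).n := by
    refine Fin.equiv_iff_eq.1 ⟨(concatEquiv _).symm.trans (Equiv.trans ?_ (concatEquiv _))⟩
    exact ((Equiv.sigmaCongrLeft (β := fun s : (Σ i, Fin (b i).n) => Fin (c s.1 s.2).n)
      (concatEquiv b).symm).trans ((Equiv.sigmaAssoc fun i j => Fin (c i j).n).trans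
        (Equiv.sigmaCongrRight fun i => concatEquiv (c i)))).symm
  refine eq_of_hom (Hom.mk (finCongr hs) fun q => ?_) fun q => rfl
  obtain ⟨p, l, hq⟩ := exists_concat_concat c q
  have : finCongr hs q = concatEquiv _ ⟨p, l⟩ :=
    Fin.ext (by rw [concat_concat_val, ← hq]; rfl)
  rw [this, hq, concat_color, concat_color, concat_color]

theorem concat_one (b : Profile C) : concat (fun _ : Fin 1 => b) = b := by
  refine eq_of_hom (Hom.mk ((Equiv.uniqueSigma fun _ : Fin 1 => Fin b.n).symm.trans
    finSigmaFinEquiv) fun i => ?_) fun i => ?_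
  · exact (concat_color (fun _ : Fin 1 => b) ⟨0, i⟩).symm
  · exact finSigmaFinEquiv_one (n := fun _ => b.n) ⟨0, i⟩

theorem concat_single_val {n : ℕ} (c : Fin n → C) (i : Fin n) :
    (finSigmaFinEquiv (⟨i, (0 : Fin 1)⟩ : Σ i, Fin (single (c i)).n) : ℕ) = i :=
  val_eq_of_lt ((Equiv.sigmaUnique (Fin n) (fun _ => Fin 1)).symm.trans finSigmaFinEquiv)
    (Equiv.refl _) (fun i j => by
      rw [Equiv.trans_apply, Equiv.trans_apply, finSigma_lt, Sigma.lex_iff]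
      simp) i

theorem concat_single {n : ℕ} (c : Fin n → C) : concat (fun i => single (c i)) = ⟨n, c⟩ := by
  refine eq_of_hom (Hom.mk ((Equiv.sigmaUnique (Fin n) (fun _ => Fin 1)).symm.trans
    finSigmaFinEquiv) fun i => ?_) fun i => ?_
  · exact (concat_color (fun i => single (c i)) ⟨i, (0 : Fin 1)⟩).symm
  · exact concat_single_val c i

end Profile
/-- Non-symmetric sequences: families of sets `X(t; c)`, for a color `t` and a profile `c`. -/
abbrev NonSymSeq (C : Type u) := C → Profile C → Type u

/-- Symmetric sequences: families `X(t; -)` of functors on the groupoid of profiles. -/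
abbrev SymSeq (C : Type u) := C → (Profile C ⥤ Type u)

open Profile

/-- A `C`-colored (symmetric) operad in sets, in terms of its components: a symmetric sequence `seq`,
operadic units, operadic compositions
`γ : O(t; a) × ∏ᵢ O(aᵢ; bᵢ) → O(t; (b₁, …, bₘ))`, which satisfy the two equivariance axioms,
associativity and the two unit axioms. The `eqToHom`s only identify equal profiles. -/
structure Operad (C : Type u) where
  seq : SymSeq C
  unit (t : C) : (seq t).obj (single t)
  comp {t : C} {a : Profile C} {b : Fin a.n → Profile C} (x : (seq t).obj a)
    (y : ∀ i, (seq (a.color i)).obj (b i)) : (seq t).obj (concat b)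
  comp_perm {t : C} {a : Profile C} {b : Fin a.n → Profile C} (x : (seq t).obj a)
    (y : ∀ i, (seq (a.color i)).obj (b i)) (σ : Equiv.Perm (Fin a.n)) :
    comp ((seq t).map (a.permHom σ) x) (fun i => y (σ i)) =
      (seq t).map (blockPermHom b σ) (comp x y)
  comp_map {t : C} {a : Profile C} {b b' : Fin a.n → Profile C} (x : (seq t).obj a)
    (y : ∀ i, (seq (a.color i)).obj (b i)) (σ : ∀ i, b i ⟶ b' i) :
    comp x (fun i => (seq (a.color i)).map (σ i) (y i)) =
      (seq t).map (blockSumHom σ) (comp x y)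
  assoc {t : C} {a : Profile C} {b : Fin a.n → Profile C}
    {c : ∀ i, Fin (b i).n → Profile C} (x : (seq t).obj a)
    (y : ∀ i, (seq (a.color i)).obj (b i))
    (z : ∀ i j, (seq ((b i).color j)).obj (c i j)) :
    (seq t).map (eqToHom (concat_concat c)) (comp (comp x y)
      fun p => z ((concatEquiv b).symm p).1 ((concatEquiv b).symm p).2) =
      comp x fun i => comp (y i) (z i)
  unit_comp {t : C} {a : Profile C} (x : (seq t).obj a) :
    (seq t).map (eqToHom (concat_one a)) (comp (unit t) fun _ => x) = x
  comp_unit {t : C} {a : Profile C} (x : (seq t).obj a) :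
    (seq t).map (eqToHom (concat_single a.color)) (comp x fun i => unit (a.color i)) = x

namespace Operad

variable {C : Type u}

/-- Morphisms of `C`-colored operads: morphisms of symmetric sequences that preserve units and
compositions. -/
@[ext]
structure Hom (P Q : Operad C) where
  toHom : P.seq ⟶ Q.seq
  map_unit (t : C) : (toHom t).app _ (P.unit t) = Q.unit t
  map_comp {t : C} {a : Profile C} {b : Fin a.n → Profile C} (x : (P.seq t).obj a)
    (y : ∀ i, (P.seq (a.color i)).obj (b i)) :
    (toHom t).app _ (P.comp x y) =
      Q.comp ((toHom t).app _ x) fun i => (toHom (a.color i)).app _ (y i)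

instance : Category (Operad C) where
  Hom := Hom
  id P := ⟨𝟙 P.seq, fun _ => rfl, fun _ _ => rfl⟩
  comp f g := ⟨f.toHom ≫ g.toHom, fun t => by simp [f.map_unit, g.map_unit],
    fun x y => by simp [f.map_comp, g.map_comp]⟩

theorem hom_ext {P Q : Operad C} {f g : P ⟶ Q}
    (h : ∀ t c x, (f.toHom t).app c x = (g.toHom t).app c x) : f = g := by
  refine Hom.ext (funext fun t => ?_)
  ext c x
  exact h t c x

/-- The functor that forgets units and compositions. -/
def forget (C : Type u) : Operad C ⥤ SymSeq C where
  obj P := P.seq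
  map f := f.toHom

end Operad

section Sym
variable {C : Type u}

/-- The functor that forgets the permutation actions. -/
def forgetSym (C : Type u) : SymSeq C ⥤ NonSymSeq C where
  obj X t c := (X t).obj c
  map f t c := (f t).app c

/-- The free symmetrization of a non-symmetric sequence, i.e. the left Kan extension along the
inclusion of the discrete category of profiles. -/
def symObj (X : NonSymSeq C) : SymSeq C := fun t =>
  { obj := fun c => Σ d : Profile C, (d ⟶ c) × X t d
    map := fun σ => ↾fun x => ⟨x.1, x.2.1 ≫ σ, x.2.2⟩
    map_id := fun c => ConcreteCategory.hom_ext _ _ fun x =>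
      congrArg (fun σ => (⟨x.1, σ, x.2.2⟩ : Σ d : Profile C, (d ⟶ c) × X t d))
        (Category.comp_id x.2.1)
    map_comp := fun {_ _ e} f g => ConcreteCategory.hom_ext _ _ fun x =>
      congrArg (fun σ => (⟨x.1, σ, x.2.2⟩ : Σ d : Profile C, (d ⟶ e) × X t d))
        (Category.assoc x.2.1 f g).symm }

def symHomEquiv (X : NonSymSeq C) (Y : SymSeq C) :
    (symObj X ⟶ Y) ≃ (X ⟶ (forgetSym C).obj Y) where
  toFun f t c := ↾fun x => (f t).app c ⟨c, 𝟙 c, x⟩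
  invFun g t :=
    { app := fun c => ↾fun x => (Y t).map x.2.1 (g t x.1 x.2.2)
      naturality := fun c d f => ConcreteCategory.hom_ext _ _ fun x =>
        Functor.map_comp_apply (Y t) x.2.1 f (g t x.1 x.2.2) }
  left_inv f := by
    funext t
    refine NatTrans.ext (funext fun c => ConcreteCategory.hom_ext _ _ fun x => ?_)
    obtain ⟨d, σ, x⟩ := x
    refine (ConcreteCategory.congr_hom ((f t).naturality σ) ⟨d, 𝟙 d, x⟩).symm.trans ?_
    exact congrArg (fun τ => (f t).app c ⟨d, τ, x⟩) (Category.id_comp σ)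
  right_inv g := by
    funext t c
    exact ConcreteCategory.hom_ext _ _ fun x => Functor.map_id_apply (Y t) c (g t c x)

/-- Free symmetrization; it is left adjoint to `forgetSym` by `symAdj`. -/
def sym (C : Type u) : NonSymSeq C ⥤ SymSeq C :=
  Adjunction.leftAdjointOfEquiv (F_obj := symObj) symHomEquiv fun X Y Y' g h => by
    rfl

def symAdj (C : Type u) : sym C ⊣ forgetSym C :=
  Adjunction.adjunctionOfEquivLeft _ _

end Sym
section Free
variable {C : Type u}

/-- Formal operadic expressions in the elements of `X`. -/
inductive FreeTerm (X : SymSeq C) : C → Profile C → Type u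
  | gen {t : C} {c : Profile C} (x : (X t).obj c) : FreeTerm X t c
  | unit (t : C) : FreeTerm X t (single t)
  | comp {t : C} {a : Profile C} {b : Fin a.n → Profile C} (x : FreeTerm X t a)
      (y : ∀ i, FreeTerm X (a.color i) (b i)) : FreeTerm X t (concat b)
  | act {t : C} {c d : Profile C} (σ : c ⟶ d) (x : FreeTerm X t c) : FreeTerm X t d

/-- The congruence on formal expressions generated by the permutation action of `X` and the axioms
of an operad. -/
inductive FreeRel (X : SymSeq C) : ∀ {t : C} {c : Profile C},
    FreeTerm X t c → FreeTerm X t c → Prop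
  | refl {t : C} {c : Profile C} (x : FreeTerm X t c) : FreeRel X x x
  | symm {t : C} {c : Profile C} {x y : FreeTerm X t c} : FreeRel X x y → FreeRel X y x
  | trans {t : C} {c : Profile C} {x y z : FreeTerm X t c} :
      FreeRel X x y → FreeRel X y z → FreeRel X x z
  | comp_congr {t : C} {a : Profile C} {b : Fin a.n → Profile C} {x x' : FreeTerm X t a}
      {y y' : ∀ i, FreeTerm X (a.color i) (b i)} :
      FreeRel X x x' → (∀ i, FreeRel X (y i) (y' i)) → FreeRel X (.comp x y) (.comp x' y')
  | act_congr {t : C} {c d : Profile C} (σ : c ⟶ d) {x x' : FreeTerm X t c} :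
      FreeRel X x x' → FreeRel X (.act σ x) (.act σ x')
  | act_gen {t : C} {c d : Profile C} (σ : c ⟶ d) (x : (X t).obj c) :
      FreeRel X (.act σ (.gen x)) (.gen ((X t).map σ x))
  | act_id {t : C} {c : Profile C} (x : FreeTerm X t c) : FreeRel X (.act (𝟙 c) x) x
  | act_act {t : C} {c d e : Profile C} (σ : c ⟶ d) (τ : d ⟶ e) (x : FreeTerm X t c) :
      FreeRel X (.act (σ ≫ τ) x) (.act τ (.act σ x))
  | comp_perm {t : C} {a : Profile C} {b : Fin a.n → Profile C} (x : FreeTerm X t a)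
      (y : ∀ i, FreeTerm X (a.color i) (b i)) (σ : Equiv.Perm (Fin a.n)) :
      FreeRel X (.comp (.act (a.permHom σ) x) fun i => y (σ i))
        (.act (blockPermHom b σ) (.comp x y))
  | comp_map {t : C} {a : Profile C} {b b' : Fin a.n → Profile C} (x : FreeTerm X t a)
      (y : ∀ i, FreeTerm X (a.color i) (b i)) (σ : ∀ i, b i ⟶ b' i) :
      FreeRel X (.comp x fun i => .act (σ i) (y i)) (.act (blockSumHom σ) (.comp x y))
  | assoc {t : C} {a : Profile C} {b : Fin a.n → Profile C} {c : ∀ i, Fin (b i).n → Profile C}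
      (x : FreeTerm X t a) (y : ∀ i, FreeTerm X (a.color i) (b i))
      (z : ∀ i j, FreeTerm X ((b i).color j) (c i j)) :
      FreeRel X (.act (eqToHom (concat_concat c)) (.comp (.comp x y)
          fun p => z ((concatEquiv b).symm p).1 ((concatEquiv b).symm p).2))
        (.comp x fun i => .comp (y i) (z i))
  | unit_comp {t : C} {a : Profile C} (x : FreeTerm X t a) :
      FreeRel X (.act (eqToHom (concat_one a)) (.comp (.unit t) fun _ => x)) x
  | comp_unit {t : C} {a : Profile C} (x : FreeTerm X t a) :
      FreeRel X (.act (eqToHom (concat_single a.color)) (.comp x fun i => .unit (a.color i))) x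

instance freeSetoid (X : SymSeq C) (t : C) (c : Profile C) : Setoid (FreeTerm X t c) where
  r := FreeRel X
  iseqv := ⟨.refl, .symm, .trans⟩

theorem freeSound {X : SymSeq C} {t : C} {c : Profile C} {x y : FreeTerm X t c}
    (h : FreeRel X x y) : (⟦x⟧ : Quotient (freeSetoid X t c)) = ⟦y⟧ :=
  Quotient.sound h

/-- Composition in the free operad, by choice of representatives; see `freeComp_mk`. -/
noncomputable def freeComp {X : SymSeq C} {t : C} {a : Profile C} {b : Fin a.n → Profile C}
    (x : Quotient (freeSetoid X t a)) (y : ∀ i, Quotient (freeSetoid X (a.color i) (b i))) :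
    Quotient (freeSetoid X t (concat b)) :=
  ⟦.comp x.out fun i => (y i).out⟧

theorem freeComp_mk {X : SymSeq C} {t : C} {a : Profile C} {b : Fin a.n → Profile C}
    (x : FreeTerm X t a) (y : ∀ i, FreeTerm X (a.color i) (b i)) :
    freeComp (⟦x⟧ : Quotient (freeSetoid X t a)) (fun i => ⟦y i⟧) = ⟦.comp x y⟧ :=
  freeSound (.comp_congr (Quotient.mk_out x) fun i => Quotient.mk_out (y i))

theorem exists_rep_family {ι : Type} {A : ι → Type u} {s : ∀ i, Setoid (A i)}
    (y : ∀ i, Quotient (s i)) : ∃ y' : ∀ i, A i, y = fun i => ⟦y' i⟧ :=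
  ⟨fun i => (y i).out, funext fun i => (Quotient.out_eq (y i)).symm⟩

def freeSeq (X : SymSeq C) : SymSeq C := fun t =>
  { obj := fun c => Quotient (freeSetoid X t c)
    map := fun σ => ↾Quotient.map (FreeTerm.act σ) fun _ _ h => .act_congr σ h
    map_id := fun c => ConcreteCategory.hom_ext _ _ fun x => by
      obtain ⟨x, rfl⟩ := Quotient.exists_rep x
      exact freeSound (.act_id x)
    map_comp := fun f g => ConcreteCategory.hom_ext _ _ fun x => by
      obtain ⟨x, rfl⟩ := Quotient.exists_rep x
      exact freeSound (.act_act f g x) }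

/-- The free operad: formal expressions modulo the axioms. -/
noncomputable def freeObj (X : SymSeq C) : Operad C where
  seq := freeSeq X
  unit t := (⟦.unit t⟧ : Quotient (freeSetoid X t _))
  comp x y := freeComp x y
  comp_perm {t a b} x y σ := by
    obtain ⟨x, rfl⟩ := Quotient.exists_rep x
    obtain ⟨y, rfl⟩ := exists_rep_family y
    refine (freeComp_mk (.act (a.permHom σ) x) fun i => y (σ i)).trans
      (Eq.trans ?_ (congrArg ((freeSeq X t).map _) (freeComp_mk x y)).symm)
    exact freeSound (.comp_perm x y σ)
  comp_map {t a b b'} x y σ := by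
    obtain ⟨x, rfl⟩ := Quotient.exists_rep x
    obtain ⟨y, rfl⟩ := exists_rep_family y
    refine (freeComp_mk x fun i => .act (σ i) (y i)).trans
      (Eq.trans ?_ (congrArg ((freeSeq X t).map _) (freeComp_mk x y)).symm)
    exact freeSound (.comp_map x y σ)
  assoc {t a b c} x y z := by
    obtain ⟨x, rfl⟩ := Quotient.exists_rep x
    obtain ⟨y, rfl⟩ := exists_rep_family y
    obtain ⟨z, rfl⟩ : ∃ z' : ∀ i j, FreeTerm X ((b i).color j) (c i j),
        z = fun i j => ⟦z' i j⟧ :=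
      ⟨fun i j => (z i j).out, funext fun i => funext fun j => (Quotient.out_eq (z i j)).symm⟩
    rw [freeComp_mk x y]
    refine (congrArg ((freeSeq X t).map _) (freeComp_mk (.comp x y) fun p =>
      z ((concatEquiv b).symm p).1 ((concatEquiv b).symm p).2)).trans ?_
    refine (freeSound (.assoc x y z)).trans (Eq.trans (freeComp_mk x _).symm ?_)
    exact congrArg (freeComp _) (funext fun i => (freeComp_mk (y i) (z i)).symm)
  unit_comp {t a} x := by
    obtain ⟨x, rfl⟩ := Quotient.exists_rep x
    refine (congrArg ((freeSeq X t).map _) (freeComp_mk (.unit t) fun _ => x)).trans ?_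
    exact freeSound (.unit_comp x)
  comp_unit {t a} x := by
    obtain ⟨x, rfl⟩ := Quotient.exists_rep x
    refine (congrArg ((freeSeq X t).map _) (freeComp_mk x fun i => .unit (a.color i))).trans ?_
    exact freeSound (.comp_unit x)

def freeEval {X : SymSeq C} {P : Operad C} (φ : X ⟶ P.seq) :
    ∀ {t : C} {c : Profile C}, FreeTerm X t c → (P.seq t).obj c
  | _, _, .gen (t := t) x => (φ t).app _ x
  | _, _, .unit t => P.unit t
  | _, _, .comp x y => P.comp (freeEval φ x) fun i => freeEval φ (y i)
  | _, _, .act (t := t) σ x => (P.seq t).map σ (freeEval φ x)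

theorem freeEval_rel {X : SymSeq C} {P : Operad C} (φ : X ⟶ P.seq) {t : C} {c : Profile C}
    {x y : FreeTerm X t c} (h : FreeRel X x y) : freeEval φ x = freeEval φ y := by
  induction h with
  | refl => rfl
  | symm _ ih => exact ih.symm
  | trans _ _ ih ih' => exact ih.trans ih'
  | comp_congr _ _ ih ih' => simp only [freeEval, ih, ih']
  | act_congr _ _ ih => simp only [freeEval, ih]
  | act_gen σ x => exact (ConcreteCategory.congr_hom ((φ _).naturality σ) x).symm
  | act_id x => exact Functor.map_id_apply _ _ _
  | act_act σ τ x => exact Functor.map_comp_apply _ _ _ _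
  | comp_perm x y σ => exact P.comp_perm (freeEval φ x) (fun i => freeEval φ (y i)) σ
  | comp_map x y σ => exact P.comp_map (freeEval φ x) (fun i => freeEval φ (y i)) σ
  | assoc x y z =>
    exact P.assoc (freeEval φ x) (fun i => freeEval φ (y i)) (fun i j => freeEval φ (z i j))
  | unit_comp x => exact P.unit_comp (freeEval φ x)
  | comp_unit x => exact P.comp_unit (freeEval φ x)

def freeLift {X : SymSeq C} {P : Operad C} (φ : X ⟶ P.seq) : freeObj X ⟶ P :=
  Operad.Hom.mk
    (fun t =>
      { app := fun c => ↾Quotient.lift (freeEval φ) fun _ _ h => freeEval_rel φ h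
        naturality := fun _ _ σ => ConcreteCategory.hom_ext _ _ fun x => by
          obtain ⟨x, rfl⟩ := Quotient.exists_rep x
          rfl })
    (fun t => rfl)
    (fun {t a b} x y => by
      obtain ⟨x, rfl⟩ := Quotient.exists_rep x
      obtain ⟨y, rfl⟩ := exists_rep_family y
      exact congrArg (Quotient.lift (freeEval φ) fun _ _ h => freeEval_rel φ h)
        (freeComp_mk x y))

def freeGen (X : SymSeq C) : X ⟶ (freeObj X).seq := fun t =>
  { app := fun c => ↾fun x => (⟦.gen x⟧ : Quotient (freeSetoid X t c))
    naturality := fun _ _ σ => ConcreteCategory.hom_ext _ _ fun x =>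
      (freeSound (.act_gen σ x)).symm }

theorem freeLift_unique {X : SymSeq C} {P : Operad C} (f : freeObj X ⟶ P) :
    freeLift (freeGen X ≫ f.toHom) = f := by
  refine Operad.hom_ext fun t c x => ?_
  obtain ⟨x, rfl⟩ := Quotient.exists_rep x
  induction x with
  | gen x => rfl
  | unit t => exact (f.map_unit t).symm
  | comp x y ih ih' =>
    refine Eq.trans ?_ (congrArg ((f.toHom _).app _) (freeComp_mk x y))
    refine Eq.trans ?_ (f.map_comp (b := _) _ _).symm
    refine Eq.trans ?_ (congrArg₂ (P.comp) ih (funext ih'))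
    rfl
  | act σ x ih =>
    refine Eq.trans ?_ (ConcreteCategory.congr_hom ((f.toHom _).naturality σ)
      (⟦x⟧ : Quotient (freeSetoid X _ _))).symm
    exact congrArg ((P.seq _).map σ) ih

noncomputable def freeHomEquiv (X : SymSeq C) (P : Operad C) :
    (freeObj X ⟶ P) ≃ (X ⟶ (Operad.forget C).obj P) where
  toFun f := freeGen X ≫ f.toHom
  invFun φ := freeLift φ
  left_inv f := freeLift_unique f
  right_inv _ := rfl

/-- The free operad functor; it is left adjoint to `Operad.forget` by `freeOperadAdj`. -/
noncomputable def freeOperad (C : Type u) : SymSeq C ⥤ Operad C :=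
  Adjunction.leftAdjointOfEquiv (F_obj := freeObj) freeHomEquiv fun _ _ _ _ _ => rfl

noncomputable def freeOperadAdj (C : Type u) : freeOperad C ⊣ Operad.forget C :=
  Adjunction.adjunctionOfEquivLeft _ _

/-- The adjunction for `X ↦ F(X^sym)`. -/
noncomputable def freeAdj (C : Type u) :
    sym C ⋙ freeOperad C ⊣ Operad.forget C ⋙ forgetSym C :=
  (symAdj C).comp (freeOperadAdj C)

end Free
section OC
variable {C : Type u} [SmallCategory C]

/-- The set `O_C(t; c) = Σₙ × ∏ᵢ C(cᵢ, t)` of pairs `(σ, f)`. -/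
@[ext]
structure OpElt (t : C) (c : Profile C) : Type u where
  perm : Equiv.Perm (Fin c.n)
  mor (i : Fin c.n) : c.color i ⟶ t

namespace OpElt

/-- The action `O_C(σ') (σ, f) = (σ σ', f σ')`. -/
def act {t : C} {c d : Profile C} (σ : c ⟶ d) (x : OpElt t c) : OpElt t d where
  perm := σ.equiv.trans (x.perm.trans (finCongr (Profile.n_eq σ)))
  mor i := eqToHom (σ.color_eq i) ≫ x.mor (σ.equiv i)

/-- The operadic unit `(e, id_t)`. -/
def unit (t : C) : OpElt t (single t) where
  perm := Equiv.refl _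
  mor _ := 𝟙 t

/-- The operadic composition
`γ((σ, f), (τ₁, g₁), …, (τₘ, gₘ)) = (σ⟨k_{σ⁻¹(1)}, …⟩ (τ₁ ⊕ ⋯ ⊕ τₘ), (f₁ g₁, …, fₘ gₘ))`,
where `kᵢ` is the length of `gᵢ` and `fᵢ gᵢ` is composition with each entry of `gᵢ`. The block
permutation `σ⟨k_{σ⁻¹(1)}, …⟩` moves block `i` as a whole to place `σ i`; it is the inverse of
`blockPerm k σ⁻¹`. -/
def comp {t : C} {a : Profile C} {b : Fin a.n → Profile C} (x : OpElt t a)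
    (y : ∀ i, OpElt (a.color i) (b i)) : OpElt t (concat b) where
  perm := (blockSum fun i => (y i).perm).trans
    ((blockPerm (fun i => (b i).n) x.perm.symm).symm.trans
      (finCongr (Equiv.sum_comp x.perm.symm fun i => (b i).n)))
  mor p := (y ((concatEquiv b).symm p).1).mor ((concatEquiv b).symm p).2 ≫
    x.mor ((concatEquiv b).symm p).1

/-- The morphism `fᵢ` of `(σ, f)`, together with its source. -/
def arrow {t : C} {c : Profile C} (x : OpElt t c) (i : Fin c.n) : Σ s : C, (s ⟶ t) :=
  ⟨c.color i, x.mor i⟩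

theorem ext_lt {t : C} {c : Profile C} {x y : OpElt t c}
    (h : ∀ i j, x.perm i < x.perm j ↔ y.perm i < y.perm j)
    (h' : ∀ i, x.arrow i = y.arrow i) : x = y := by
  refine OpElt.ext (Equiv.ext fun i => Fin.ext (val_eq_of_lt _ _ h i)) (funext fun i => ?_)
  exact eq_of_heq (Sigma.mk.inj_iff.1 (h' i)).2

theorem act_lt {t : C} {c d : Profile C} (σ : c ⟶ d) (x : OpElt t c) (i j : Fin d.n) :
    (act σ x).perm i < (act σ x).perm j ↔ x.perm (σ.equiv i) < x.perm (σ.equiv j) :=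
  Iff.rfl

theorem act_arrow {t : C} {c d : Profile C} (σ : c ⟶ d) (x : OpElt t c) (i : Fin d.n) :
    (act σ x).arrow i = x.arrow (σ.equiv i) := by
  have : ∀ {s s' : C} (h : s = s') (f : s' ⟶ t),
      (⟨s, eqToHom h ≫ f⟩ : Σ s : C, (s ⟶ t)) = ⟨s', f⟩ := by
    rintro s _ rfl f; simp
  exact this _ _

theorem comp_arrow {t : C} {a : Profile C} {b : Fin a.n → Profile C} (x : OpElt t a)
    (y : ∀ i, OpElt (a.color i) (b i)) (p : Σ i, Fin (b i).n) :
    (comp x y).arrow (concatEquiv b p) = ⟨(b p.1).color p.2, (y p.1).mor p.2 ≫ x.mor p.1⟩ :=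
  congrArg (fun q : Σ i, Fin (b i).n =>
    (⟨(b q.1).color q.2, (y q.1).mor q.2 ≫ x.mor q.1⟩ : Σ s : C, (s ⟶ t)))
    ((concatEquiv b).symm_apply_apply p)

theorem comp_lt {t : C} {a : Profile C} {b : Fin a.n → Profile C} (x : OpElt t a)
    (y : ∀ i, OpElt (a.color i) (b i)) (i : Fin a.n) (j : Fin (b i).n) (i' : Fin a.n)
    (j' : Fin (b i').n) :
    (comp x y).perm (concatEquiv b ⟨i, j⟩) < (comp x y).perm (concatEquiv b ⟨i', j'⟩) ↔
      x.perm i < x.perm i' ∨ ∃ h : i = i', (y i').perm (h ▸ j) < (y i').perm j' := by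
  have key : ∀ (i : Fin a.n) (j : Fin (b i).n), ∃ (l : Fin a.n) (k : Fin (b (x.perm.symm l)).n),
      (⟨i, (y i).perm j⟩ : Σ i, Fin (b i).n) = ⟨x.perm.symm l, k⟩ ∧
      ((comp x y).perm (concatEquiv b ⟨i, j⟩) : ℕ) =
        finSigmaFinEquiv (n := fun i => (b (x.perm.symm i)).n) ⟨l, k⟩ := by
    intro i j
    obtain ⟨⟨l, k⟩, hr⟩ := (finSigmaFinEquiv (n := fun i => (b (x.perm.symm i)).n)).surjective
      ((blockPerm (fun i => (b i).n) x.perm.symm).symm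
        (blockSum (fun i => (y i).perm) (concatEquiv b ⟨i, j⟩)))
    refine ⟨l, k, ?_, congrArg Fin.val hr.symm⟩
    rw [Equiv.eq_symm_apply, blockPerm_mk] at hr
    exact finSigmaFinEquiv.injective ((blockSum_mk (fun i => (y i).perm) ⟨i, j⟩).symm.trans hr.symm)
  obtain ⟨l, k, hr, hv⟩ := key i j
  obtain ⟨l', k', hr', hv'⟩ := key i' j'
  rw [Fin.lt_def, hv, hv', ← Fin.lt_def, finSigma_lt, Sigma.lex_iff]
  clear hv hv'
  obtain ⟨rfl, hr⟩ := Sigma.mk.inj_iff.1 hr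
  obtain ⟨rfl, hr'⟩ := Sigma.mk.inj_iff.1 hr'
  obtain rfl := eq_of_heq hr
  obtain rfl := eq_of_heq hr'
  simp only [Equiv.apply_symm_apply]
  refine or_congr Iff.rfl ⟨?_, ?_⟩
  · rintro ⟨rfl, h'⟩
    exact ⟨rfl, h'⟩
  · rintro ⟨h, h'⟩
    obtain rfl := x.perm.symm.injective h
    exact ⟨rfl, h'⟩

theorem comp_mor {t : C} {a : Profile C} {b : Fin a.n → Profile C} (x : OpElt t a)
    (y : ∀ i, OpElt (a.color i) (b i)) (p : Fin (concat b).n) :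
    (comp x y).mor p = (y ((concatEquiv b).symm p).1).mor ((concatEquiv b).symm p).2 ≫
      x.mor ((concatEquiv b).symm p).1 :=
  rfl

theorem comp_ext {t : C} {m : ℕ} {b : Fin m → Profile C} {x y : OpElt t (concat b)}
    (h : ∀ p q, x.perm (concatEquiv b p) < x.perm (concatEquiv b q) ↔
      y.perm (concatEquiv b p) < y.perm (concatEquiv b q))
    (h' : ∀ p, x.arrow (concatEquiv b p) = y.arrow (concatEquiv b p)) : x = y :=
  ext_lt (fun i j => by
    obtain ⟨p, rfl⟩ := (concatEquiv b).surjective i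
    obtain ⟨q, rfl⟩ := (concatEquiv b).surjective j
    exact h p q) fun i => by
    obtain ⟨p, rfl⟩ := (concatEquiv b).surjective i
    exact h' p

theorem act_comp_perm {t : C} {a : Profile C} {b : Fin a.n → Profile C} (x : OpElt t a)
    (y : ∀ i, OpElt (a.color i) (b i)) (σ : Equiv.Perm (Fin a.n)) :
    comp (act (a.permHom σ) x) (fun i => y (σ i)) = act (blockPermHom b σ) (comp x y) := by
  refine comp_ext (fun ⟨i, j⟩ ⟨i', j'⟩ => ?_) fun p => ?_
  · rw [act_lt, blockPermHom_equiv, blockPermHom_equiv, comp_lt, comp_lt]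
    refine or_congr Iff.rfl ⟨?_, ?_⟩
    · rintro ⟨rfl, h⟩
      exact ⟨rfl, h⟩
    · rintro ⟨h, h'⟩
      obtain rfl := σ.injective h
      exact ⟨rfl, h'⟩
  · rw [act_arrow, blockPermHom_equiv, comp_arrow, comp_arrow]
    exact congrArg (fun g => (⟨_, (y (σ p.1)).mor p.2 ≫ g⟩ : Σ s : C, (s ⟶ t)))
      (Category.id_comp (x.mor (σ p.1)))

theorem act_comp_map {t : C} {a : Profile C} {b b' : Fin a.n → Profile C} (x : OpElt t a)
    (y : ∀ i, OpElt (a.color i) (b i)) (σ : ∀ i, b i ⟶ b' i) :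
    comp x (fun i => act (σ i) (y i)) = act (blockSumHom σ) (comp x y) := by
  refine comp_ext (fun ⟨i, j⟩ ⟨i', j'⟩ => ?_) fun p => ?_
  · rw [act_lt, blockSumHom_equiv, blockSumHom_equiv, comp_lt, comp_lt]
    refine or_congr Iff.rfl ⟨?_, ?_⟩
    · rintro ⟨rfl, h⟩
      exact ⟨rfl, h⟩
    · rintro ⟨h, h'⟩
      change i = i' at h
      subst h
      exact ⟨rfl, h'⟩
  · rw [act_arrow, blockSumHom_equiv, comp_arrow, comp_arrow]
    exact congrArg (fun g : Σ s : C, (s ⟶ a.color p.1) =>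
      (⟨g.1, g.2 ≫ x.mor p.1⟩ : Σ s : C, (s ⟶ t))) (act_arrow (σ p.1) (y p.1) p.2)

theorem act_assoc {t : C} {a : Profile C} {b : Fin a.n → Profile C}
    {c : ∀ i, Fin (b i).n → Profile C} (x : OpElt t a) (y : ∀ i, OpElt (a.color i) (b i))
    (z : ∀ i j, OpElt ((b i).color j) (c i j)) :
    act (eqToHom (concat_concat c)) (comp (comp x y)
      fun p => z ((concatEquiv b).symm p).1 ((concatEquiv b).symm p).2) =
      comp x fun i => comp (y i) (z i) := by
  have hE : ∀ (p : Fin (concat b).n)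
      (l : Fin (c ((concatEquiv b).symm p).1 ((concatEquiv b).symm p).2).n),
      Profile.Hom.equiv (eqToHom (concat_concat c))
        (concatEquiv (fun i => concat (c i)) ⟨((concatEquiv b).symm p).1,
          concatEquiv (c _) ⟨((concatEquiv b).symm p).2, l⟩⟩) =
      concatEquiv (fun p : Fin (concat b).n =>
        c ((concatEquiv b).symm p).1 ((concatEquiv b).symm p).2) ⟨p, l⟩ := fun p l =>
    Fin.ext ((eqToHom_val _ _).trans (concat_concat_val c p l).symm)
  refine ext_lt (fun r r' => ?_) fun r => ?_
  · obtain ⟨p, l, rfl⟩ := exists_concat_concat c r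
    obtain ⟨p', l', rfl⟩ := exists_concat_concat c r'
    have hlt : (comp x y).perm p < (comp x y).perm p' ↔
        (comp x y).perm (concatEquiv b ⟨((concatEquiv b).symm p).1, ((concatEquiv b).symm p).2⟩) <
        (comp x y).perm
          (concatEquiv b ⟨((concatEquiv b).symm p').1, ((concatEquiv b).symm p').2⟩) := by
      rw [Sigma.eta, Sigma.eta, Equiv.apply_symm_apply, Equiv.apply_symm_apply]
    have hz : (∃ h : p = p', (z ((concatEquiv b).symm p').1 ((concatEquiv b).symm p').2).perm
          (h ▸ l) < (z ((concatEquiv b).symm p').1 ((concatEquiv b).symm p').2).perm l') ↔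
        ∃ h : (concatEquiv b).symm p = (concatEquiv b).symm p',
          (z ((concatEquiv b).symm p').1 ((concatEquiv b).symm p').2).perm
          (Eq.rec (motive := fun s _ => Fin (c s.1 s.2).n) l h) <
          (z ((concatEquiv b).symm p').1 ((concatEquiv b).symm p').2).perm l' := by
      constructor
      · rintro ⟨rfl, h⟩
        exact ⟨rfl, h⟩
      · rintro ⟨h, h'⟩
        obtain rfl := (concatEquiv b).symm.injective h
        exact ⟨rfl, h'⟩
    rw [act_lt, hE, hE, comp_lt, comp_lt, hlt, comp_lt, hz]
    clear hz hlt hE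
    generalize (concatEquiv b).symm p = s at *
    generalize (concatEquiv b).symm p' = s' at *
    clear p p'
    obtain ⟨i, j⟩ := s
    obtain ⟨i', j'⟩ := s'
    dsimp only at l l' ⊢
    rw [or_assoc]
    refine or_congr Iff.rfl ?_
    by_cases hi : i = i'
    · subst hi
      simp only [exists_prop_of_true]
      refine Iff.trans (or_congr Iff.rfl ?_) (comp_lt (y i) (z i) j l j' l').symm
      constructor
      · rintro ⟨h, h'⟩
        obtain rfl := eq_of_heq (Sigma.mk.inj_iff.1 h).2
        exact ⟨rfl, h'⟩
      · rintro ⟨rfl, h'⟩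
        exact ⟨rfl, h'⟩
    · constructor
      · rintro (⟨h, -⟩ | ⟨h, -⟩)
        · exact absurd h hi
        · exact absurd (Sigma.mk.inj_iff.1 h).1 hi
      · rintro ⟨h, -⟩
        exact absurd h hi
  · obtain ⟨p, l, rfl⟩ := exists_concat_concat c r
    rw [act_arrow, hE, comp_arrow, comp_arrow]
    refine Eq.trans ?_ (congrArg (fun g : Σ s : C, (s ⟶ a.color ((concatEquiv b).symm p).1) =>
      (⟨g.1, g.2 ≫ x.mor ((concatEquiv b).symm p).1⟩ : Σ s : C, (s ⟶ t)))
        (comp_arrow (y _) (z _) ⟨((concatEquiv b).symm p).2, l⟩)).symm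
    exact congrArg (Sigma.mk _) (Category.assoc _ _ _).symm

theorem act_unit_comp {t : C} {a : Profile C} (x : OpElt t a) :
    act (eqToHom (concat_one a)) (comp (unit t) fun _ => x) = x := by
  have hE : ∀ i, Profile.Hom.equiv (eqToHom (concat_one a)) i =
      concatEquiv (fun _ : Fin 1 => a) ⟨0, i⟩ := fun i =>
    Fin.ext ((eqToHom_val _ _).trans (finSigmaFinEquiv_one (n := fun _ => a.n) ⟨0, i⟩).symm)
  refine ext_lt (fun i j => ?_) fun i => ?_
  · have h := comp_lt (a := single t) (b := fun _ => a) (unit t) (fun _ => x)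
      (0 : Fin 1) i (0 : Fin 1) j
    rw [act_lt, hE, hE, h]
    simp
  · rw [act_arrow, hE]
    refine (comp_arrow (a := single t) (b := fun _ => a) (unit t) (fun _ => x) ⟨(0 : Fin 1), i⟩).trans ?_
    exact congrArg (Sigma.mk _) (Category.comp_id _)

theorem act_comp_unit {t : C} {a : Profile C} (x : OpElt t a) :
    act (eqToHom (concat_single a.color)) (comp x fun i => unit (a.color i)) = x := by
  have hE : ∀ i, Profile.Hom.equiv (eqToHom (concat_single a.color)) i =
      concatEquiv (fun i => single (a.color i)) ⟨i, (0 : Fin 1)⟩ := fun i =>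
    Fin.ext ((eqToHom_val _ _).trans (concat_single_val a.color i).symm)
  refine ext_lt (fun i j => ?_) fun i => ?_
  · rw [act_lt, hE, hE]
    refine (comp_lt x (fun i => unit (a.color i)) i (0 : Fin 1) j (0 : Fin 1)).trans ?_
    refine ⟨?_, Or.inl⟩
    rintro (h | ⟨rfl, h⟩)
    · exact h
    · exact absurd h (lt_irrefl _)
  · rw [act_arrow, hE]
    refine (comp_arrow x (fun i => unit (a.color i)) ⟨i, (0 : Fin 1)⟩).trans ?_
    exact congrArg (Sigma.mk _) (Category.id_comp _)

theorem act_id {t : C} {c : Profile C} (x : OpElt t c) : act (𝟙 c) x = x :=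
  ext_lt (fun i j => act_lt _ _ i j) fun i => act_arrow _ _ i

theorem act_act {t : C} {c d e : Profile C} (f : c ⟶ d) (g : d ⟶ e) (x : OpElt t c) :
    act (f ≫ g) x = act g (act f x) :=
  ext_lt (fun _ _ => Iff.rfl) fun i =>
    (act_arrow (f ≫ g) x i).trans ((act_arrow g (act f x) i).trans (act_arrow f x _)).symm

end OpElt

/-- The colored operad `O_C` of a small category `C`. -/
def OC (C : Type u) [SmallCategory C] : Operad C where
  seq t :=
    { obj := fun c => OpElt t c
      map := fun σ => ↾OpElt.act σ
      map_id := fun _ => ConcreteCategory.hom_ext _ _ OpElt.act_id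
      map_comp := fun f g => ConcreteCategory.hom_ext _ _ (OpElt.act_act f g) }
  unit t := OpElt.unit t
  comp x y := OpElt.comp x y
  comp_perm x y σ := OpElt.act_comp_perm x y σ
  comp_map x y σ := OpElt.act_comp_map x y σ
  assoc x y z := OpElt.act_assoc x y z
  unit_comp x := OpElt.act_unit_comp x
  comp_unit x := OpElt.act_comp_unit x

end OC
section Orth

/-- An orthogonality relation on the pairs of morphisms of `C` with common target: symmetric and
stable under post- and precomposition. -/
structure Orthogonality (C : Type u) [SmallCategory C] where
  rel {c₁ c₂ t : C} (f₁ : c₁ ⟶ t) (f₂ : c₂ ⟶ t) : Prop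
  symm {c₁ c₂ t : C} {f₁ : c₁ ⟶ t} {f₂ : c₂ ⟶ t} : rel f₁ f₂ → rel f₂ f₁
  postcomp {c₁ c₂ t s : C} {f₁ : c₁ ⟶ t} {f₂ : c₂ ⟶ t} (g : t ⟶ s) :
    rel f₁ f₂ → rel (f₁ ≫ g) (f₂ ≫ g)
  precomp {c₁ c₂ t b₁ b₂ : C} {f₁ : c₁ ⟶ t} {f₂ : c₂ ⟶ t} (h₁ : b₁ ⟶ c₁) (h₂ : b₂ ⟶ c₂) :
    rel f₁ f₂ → rel (h₁ ≫ f₁) (h₂ ≫ f₂)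

variable {C : Type u} [SmallCategory C] (O : Orthogonality C)

namespace OpElt

/-- `ρ' = ρ τ` for the transposition `τ` of two adjacent entries of `(f_{ρ(1)}, …, f_{ρ(n)})` that
are orthogonal. -/
def AdjStep {t : C} {c : Profile C} (f : ∀ i, c.color i ⟶ t) (ρ ρ' : Equiv.Perm (Fin c.n)) :
    Prop :=
  ∃ p q : Fin c.n, (p : ℕ) + 1 = q ∧ O.rel (f (ρ p)) (f (ρ q)) ∧ ρ' = ρ * Equiv.swap p q

/-- The relation `(σ, f) ~ (σ', f')`: it means `f = f'` and that there is a factorization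
`σ σ'⁻¹ = τ₁ ⋯ τ_N : f σ⁻¹ → f σ'⁻¹` into transpositions of adjacent orthogonal pairs, i.e. a chain
`σ⁻¹, σ⁻¹ τ₁, …, σ⁻¹ τ₁ ⋯ τ_N = σ'⁻¹` of such steps. -/
def PerpRel {t : C} {c : Profile C} (x y : OpElt t c) : Prop :=
  x.mor = y.mor ∧ Relation.ReflTransGen (AdjStep O x.mor) x.perm⁻¹ y.perm⁻¹

/-- All pairs that `σ` and `σ'` put in different orders are orthogonal; this characterizes the
relation by `perpRel_iff`. -/
def InvOrth {t : C} {c : Profile C} (f : ∀ i, c.color i ⟶ t) (σ σ' : Equiv.Perm (Fin c.n)) :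
    Prop :=
  ∀ i j, σ i < σ j → σ' j < σ' i → O.rel (f i) (f j)

theorem swap_lt {n : ℕ} {p q : Fin n} (h : (p : ℕ) + 1 = q) {i j : Fin n} (hij : i < j)
    (hs : Equiv.swap p q j < Equiv.swap p q i) : i = p ∧ j = q := by
  rw [Fin.lt_def] at hij hs
  by_cases h1 : i = p <;> by_cases h2 : i = q <;> by_cases h3 : j = p <;> by_cases h4 : j = q <;>
    simp_all [Equiv.swap_apply_def, Fin.ext_iff] <;> omega

theorem InvOrth.trans {t : C} {c : Profile C} {f : ∀ i, c.color i ⟶ t}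
    {σ σ' σ'' : Equiv.Perm (Fin c.n)} (h : InvOrth O f σ σ') (h' : InvOrth O f σ' σ'') :
    InvOrth O f σ σ'' := by
  intro i j hij hji
  rcases lt_trichotomy (σ' i) (σ' j) with h1 | h1 | h1
  · exact h' i j h1 hji
  · rw [σ'.injective h1] at hij
    exact absurd hij (lt_irrefl _)
  · exact h i j hij h1

theorem InvOrth.of_adjStep {t : C} {c : Profile C} {f : ∀ i, c.color i ⟶ t}
    {ρ ρ' : Equiv.Perm (Fin c.n)} (h : AdjStep O f ρ ρ') : InvOrth O f ρ⁻¹ ρ'⁻¹ := by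
  obtain ⟨p, q, hpq, ho, rfl⟩ := h
  intro i j hij hji
  simp only [mul_inv_rev, Equiv.swap_inv, Equiv.Perm.mul_apply] at hji
  obtain ⟨h1, h2⟩ := swap_lt hpq hij hji
  rw [Equiv.Perm.inv_eq_iff_eq] at h1 h2
  rw [h1, h2]
  exact ho

theorem exists_adj_of_ne {n : ℕ} (e : Equiv.Perm (Fin n)) (h : e ≠ 1) :
    ∃ p q : Fin n, (p : ℕ) + 1 = q ∧ e q < e p := by
  by_contra hc
  push Not at hc
  refine h (Equiv.ext fun i => ?_)
  cases n with
  | zero => exact i.elim0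
  | succ n =>
    have hm : StrictMono e := Fin.strictMono_iff_lt_succ.2 fun i =>
      lt_of_le_of_ne (hc _ _ (by simp)) fun h => (Fin.castSucc_lt_succ (i := i)).ne (e.injective h)
    exact Fin.ext (Fin.coe_orderIso_apply (hm.orderIsoOfSurjective e e.surjective) i)

theorem InvOrth.reflTransGen {t : C} {c : Profile C} {f : ∀ i, c.color i ⟶ t} :
    ∀ (N : ℕ) (σ σ' : Equiv.Perm (Fin c.n)),
      (Finset.univ.filter fun p : Fin c.n × Fin c.n => σ p.1 < σ p.2 ∧ σ' p.2 < σ' p.1).card = N →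
      InvOrth O f σ σ' → Relation.ReflTransGen (AdjStep O f) σ⁻¹ σ'⁻¹ := by
  intro N
  induction N using Nat.strong_induction_on with
  | _ N ih =>
    intro σ σ' hN h
    by_cases he : σ' * σ⁻¹ = 1
    · rw [mul_inv_eq_one.1 he]
    obtain ⟨p, q, hpq, hlt⟩ := exists_adj_of_ne _ he
    simp only [Equiv.Perm.mul_apply] at hlt
    have hpq' : p < q := by rw [Fin.lt_def]; omega
    have hstep : AdjStep O f σ⁻¹ (Equiv.swap p q * σ)⁻¹ := by
      refine ⟨p, q, hpq, h _ _ (by simpa using hpq') hlt, ?_⟩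
      rw [mul_inv_rev, Equiv.swap_inv]
    have hmono : ∀ i j, (Equiv.swap p q * σ) i < (Equiv.swap p q * σ) j → σ' j < σ' i →
        σ i < σ j := by
      intro i j h1 h2
      by_contra h3
      rcases lt_or_eq_of_le (not_lt.1 h3) with h3 | h3
      · obtain ⟨h4, h5⟩ := swap_lt hpq h3 h1
        rw [← h4, ← h5] at hlt
        simp only [Equiv.Perm.inv_def, Equiv.symm_apply_apply] at hlt
        exact absurd h2 hlt.asymm
      · rw [σ.injective h3] at h2
        exact absurd h2 (lt_irrefl _)
    refine Relation.ReflTransGen.head hstep (ih _ ?_ _ σ' rfl ?_)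
    · rw [← hN]
      refine Finset.card_lt_card ((Finset.ssubset_iff_of_subset ?_).2
        ⟨(σ⁻¹ p, σ⁻¹ q), ?_, ?_⟩)
      · intro r hr
        simp only [Finset.mem_filter, Finset.mem_univ, true_and] at hr ⊢
        exact ⟨hmono _ _ hr.1 hr.2, hr.2⟩
      · simp only [Finset.mem_filter, Finset.mem_univ, true_and]
        exact ⟨by simpa using hpq', hlt⟩
      · simp only [Finset.mem_filter, Finset.mem_univ, true_and, not_and]
        intro h1
        simp only [Equiv.Perm.mul_apply, Equiv.Perm.inv_def, Equiv.apply_symm_apply, Equiv.swap_apply_left,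
          Equiv.swap_apply_right] at h1
        exact absurd h1 hpq'.asymm
    · intro i j h1 h2
      exact h i j (hmono i j h1 h2) h2

theorem perpRel_iff {t : C} {c : Profile C} {x y : OpElt t c} :
    PerpRel O x y ↔ x.mor = y.mor ∧ ∀ i j, x.perm i < x.perm j → y.perm j < y.perm i →
      O.rel (x.mor i) (x.mor j) := by
  refine and_congr_right fun _ => ⟨fun h => ?_, fun h => InvOrth.reflTransGen O _ _ _ rfl h⟩
  have : ∀ ρ ρ', Relation.ReflTransGen (AdjStep O x.mor) ρ ρ' → InvOrth O x.mor ρ⁻¹ ρ'⁻¹ := by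
    intro ρ ρ' h
    induction h with
    | refl => exact fun i j h1 h2 => absurd h1 h2.asymm
    | tail _ h ih => exact ih.trans O (InvOrth.of_adjStep O h)
  have h2 := this _ _ h
  rw [inv_inv, inv_inv] at h2
  exact h2

theorem perpRel_equivalence (t : C) (c : Profile C) :
    Equivalence (PerpRel O : OpElt t c → OpElt t c → Prop) where
  refl x := ⟨rfl, .refl⟩
  symm {x y} h := by
    rw [perpRel_iff] at h ⊢
    refine ⟨h.1.symm, fun i j h1 h2 => ?_⟩
    rw [← h.1]
    exact O.symm (h.2 j i h2 h1)
  trans {x y z} h h' := by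
    obtain ⟨h1, h2⟩ := h
    obtain ⟨h3, h4⟩ := h'
    exact ⟨h1.trans h3, h2.trans (by rw [h1]; exact h4)⟩

def OrthArrow {t : C} (p q : Σ s : C, (s ⟶ t)) : Prop := O.rel p.2 q.2

theorem perpRel_of {t : C} {c : Profile C} {x y : OpElt t c}
    (h : ∀ i, x.arrow i = y.arrow i)
    (h' : ∀ i j, x.perm i < x.perm j → y.perm j < y.perm i → OrthArrow O (x.arrow i) (x.arrow j)) :
    PerpRel O x y :=
  (perpRel_iff O).2 ⟨funext fun i => eq_of_heq (Sigma.mk.inj_iff.1 (h i)).2, h'⟩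

theorem PerpRel.arrow {t : C} {c : Profile C} {x y : OpElt t c} (h : PerpRel O x y) (i : Fin c.n) :
    x.arrow i = y.arrow i :=
  congrArg (Sigma.mk _) (congrFun h.1 i)

theorem PerpRel.act {t : C} {c d : Profile C} (σ : c ⟶ d) {x y : OpElt t c} (h : PerpRel O x y) :
    PerpRel O (act σ x) (act σ y) := by
  refine perpRel_of O (fun i => ?_) fun i j => ?_
  · rw [act_arrow, act_arrow, h.arrow]
  · rw [act_lt, act_lt, act_arrow, act_arrow]
    exact ((perpRel_iff O).1 h).2 _ _

theorem PerpRel.comp {t : C} {a : Profile C} {b : Fin a.n → Profile C} {x x' : OpElt t a}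
    {y y' : ∀ i, OpElt (a.color i) (b i)} (h : PerpRel O x x') (h' : ∀ i, PerpRel O (y i) (y' i)) :
    PerpRel O (comp x y) (comp x' y') := by
  refine perpRel_of O (fun p => ?_) fun p q => ?_
  · obtain ⟨p, rfl⟩ := (concatEquiv b).surjective p
    rw [comp_arrow, comp_arrow, h.1, (h' p.1).1]
  · obtain ⟨⟨i, j⟩, rfl⟩ := (concatEquiv b).surjective p
    obtain ⟨⟨i', j'⟩, rfl⟩ := (concatEquiv b).surjective q
    rw [comp_lt, comp_lt, comp_arrow, comp_arrow]
    intro h1 h2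
    by_cases hi : i = i'
    · subst hi
      simp only [lt_irrefl, exists_prop_of_true, false_or] at h1 h2
      exact O.postcomp _ (((perpRel_iff O).1 (h' i)).2 _ _ h1 h2)
    · have h1 := h1.resolve_right fun h => hi h.1
      have h2 := h2.resolve_right fun h => hi h.1.symm
      exact O.precomp _ _ (((perpRel_iff O).1 h).2 _ _ h1 h2)

end OpElt

def perpSetoid (t : C) (c : Profile C) : Setoid (OpElt t c) where
  r := OpElt.PerpRel O
  iseqv := OpElt.perpRel_equivalence O t c

/-- Composition of classes, by choice of representatives; see `perpComp_mk`. -/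
noncomputable def perpComp {t : C} {a : Profile C} {b : Fin a.n → Profile C}
    (x : Quotient (perpSetoid O t a)) (y : ∀ i, Quotient (perpSetoid O (a.color i) (b i))) :
    Quotient (perpSetoid O t (concat b)) :=
  Quotient.mk (perpSetoid O _ _) (OpElt.comp x.out fun i => (y i).out)

theorem perpComp_mk {t : C} {a : Profile C} {b : Fin a.n → Profile C}
    (x : OpElt t a) (y : ∀ i, OpElt (a.color i) (b i)) :
    perpComp O (Quotient.mk (perpSetoid O _ _) x) (fun i => Quotient.mk (perpSetoid O _ _) (y i)) = Quotient.mk (perpSetoid O _ _) (OpElt.comp x y) :=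
  Quotient.sound (OpElt.PerpRel.comp O (Quotient.mk_out (s := perpSetoid O _ _) x)
    fun i => Quotient.mk_out (s := perpSetoid O _ _) (y i))

def perpSeq : SymSeq C := fun t =>
  { obj := fun c => Quotient (perpSetoid O t c)
    map := fun σ => ↾Quotient.map (sa := perpSetoid O t _) (sb := perpSetoid O t _) (OpElt.act σ) fun _ _ h => h.act O σ
    map_id := fun c => ConcreteCategory.hom_ext _ _ fun x => by
      obtain ⟨x, rfl⟩ := Quotient.exists_rep x
      exact congrArg (Quotient.mk (perpSetoid O _ _)) (OpElt.act_id x)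
    map_comp := fun f g => ConcreteCategory.hom_ext _ _ fun x => by
      obtain ⟨x, rfl⟩ := Quotient.exists_rep x
      exact congrArg (Quotient.mk (perpSetoid O _ _)) (OpElt.act_act f g x) }

/-- The colored operad of an orthogonal category `(C, ⊥)`: the object-wise quotient of `O_C` by the
relation `PerpRel`. -/
noncomputable def OCPerp : Operad C where
  seq := perpSeq O
  unit t := Quotient.mk (perpSetoid O t _) (OpElt.unit t)
  comp x y := perpComp O x y
  comp_perm {t a b} x y σ := by
    obtain ⟨x, rfl⟩ := Quotient.exists_rep x
    obtain ⟨y, rfl⟩ := exists_rep_family y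
    refine (perpComp_mk O (OpElt.act (a.permHom σ) x) fun i => y (σ i)).trans
      (Eq.trans ?_ (congrArg ((perpSeq O t).map _) (perpComp_mk O x y)).symm)
    exact congrArg (Quotient.mk (perpSetoid O _ _)) (OpElt.act_comp_perm x y σ)
  comp_map {t a b b'} x y σ := by
    obtain ⟨x, rfl⟩ := Quotient.exists_rep x
    obtain ⟨y, rfl⟩ := exists_rep_family y
    refine (perpComp_mk O x fun i => OpElt.act (σ i) (y i)).trans
      (Eq.trans ?_ (congrArg ((perpSeq O t).map _) (perpComp_mk O x y)).symm)
    exact congrArg (Quotient.mk (perpSetoid O _ _)) (OpElt.act_comp_map x y σ)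
  assoc {t a b c} x y z := by
    obtain ⟨x, rfl⟩ := Quotient.exists_rep x
    obtain ⟨y, rfl⟩ := exists_rep_family y
    obtain ⟨z, rfl⟩ : ∃ z' : ∀ i j, OpElt ((b i).color j) (c i j),
        z = fun i j => Quotient.mk (perpSetoid O _ _) (z' i j) :=
      ⟨fun i j => (z i j).out, funext fun i => funext fun j => (Quotient.out_eq (z i j)).symm⟩
    rw [perpComp_mk O x y]
    refine (congrArg ((perpSeq O t).map _) (perpComp_mk O (OpElt.comp x y) fun p =>
      z ((concatEquiv b).symm p).1 ((concatEquiv b).symm p).2)).trans ?_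
    refine (congrArg (Quotient.mk (perpSetoid O _ _)) (OpElt.act_assoc x y z)).trans
      (Eq.trans (perpComp_mk O x _).symm ?_)
    exact congrArg (perpComp O _) (funext fun i => (perpComp_mk O (y i) (z i)).symm)
  unit_comp {t a} x := by
    obtain ⟨x, rfl⟩ := Quotient.exists_rep x
    refine (congrArg ((perpSeq O t).map _) (perpComp_mk O (OpElt.unit t) fun _ => x)).trans ?_
    exact congrArg (Quotient.mk (perpSetoid O _ _)) (OpElt.act_unit_comp x)
  comp_unit {t a} x := by
    obtain ⟨x, rfl⟩ := Quotient.exists_rep x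
    refine (congrArg ((perpSeq O t).map _)
      (perpComp_mk O x fun i => OpElt.unit (a.color i))).trans ?_
    exact congrArg (Quotient.mk (perpSetoid O _ _)) (OpElt.act_comp_unit x)

/-- The projection `O_C ⟶ O_(C,⊥)`, `(σ, f) ↦ [σ, f]`. -/
def projPerp : OC C ⟶ OCPerp O :=
  Operad.Hom.mk
    (fun t =>
      { app := fun c => ↾fun x => Quotient.mk (perpSetoid O t c) x
        naturality := fun _ _ _ => rfl })
    (fun _ => rfl)
    (fun x y => (perpComp_mk O x y).symm)

end Orth
section Presentation

theorem Profile.concat_eq_pow {C : Type u} {m : ℕ} {b : Fin m → Profile C} {t : C} {n : ℕ}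
    (h : ∀ i j, (b i).color j = t) (hn : ∑ i, (b i).n = n) : concat b = pow t n := by
  subst hn
  refine congrArg (Profile.mk _) (funext fun j => ?_)
  exact h _ _

theorem Profile.pow_zero {C : Type u} (t c : C) : pow t 0 = pow c 0 :=
  congrArg (Profile.mk 0) (funext fun i => i.elim0)

/-- The transposition as a morphism of profiles `(c₂, c₁) ⟶ (c₁, c₂)`. -/
def Profile.swapHom {C : Type u} (c : Fin 2 → C) :
    (⟨2, fun i => c (Equiv.swap 0 1 i)⟩ : Profile C) ⟶ ⟨2, c⟩ :=
  Profile.Hom.mk (Equiv.swap 0 1) fun i => congrArg c (Equiv.swap_apply_self 0 1 i).symm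

/-- Composition `γ(x ⊗ y)` with an operation `x` of arity one. -/
def Operad.comp₁ {C : Type u} (P : Operad C) {t s : C} {b : Profile C}
    (x : (P.seq t).obj (single s)) (y : (P.seq s).obj b) : (P.seq t).obj b :=
  (P.seq t).map (eqToHom (concat_one b)) (P.comp x fun _ => y)

/-- Composition `γ(x ⊗ y₀ ⊗ y₁)` with an operation `x` with inputs `(s, s)`. -/
def Operad.comp₂ {C : Type u} (P : Operad C) {t s : C} {b : Fin 2 → Profile C} {d : Profile C}
    (h : concat b = d) (x : (P.seq t).obj (pow s 2)) (y₀ : (P.seq s).obj (b 0))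
    (y₁ : (P.seq s).obj (b 1)) : (P.seq t).obj d :=
  (P.seq t).map (eqToHom h) (P.comp x fun i : Fin 2 =>
    match i with
    | 0 => y₀
    | 1 => y₁)

variable (C : Type u) [SmallCategory C]

/-- The generators: units `1_t`, pushforwards `f` and products `μ_t`. -/
inductive Gen : C → Profile C → Type u
  | unit (t : C) : Gen t (pow t 0)
  | mor {c t : C} (f : c ⟶ t) : Gen t (single c)
  | mul (t : C) : Gen t (pow t 2)

/-- Index set of the functoriality relations: composable pairs `(f, g)` and objects. -/
inductive FunRel : C → Profile C → Type u
  | comp {c s t : C} (f : s ⟶ t) (g : c ⟶ s) : FunRel t (single c)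
  | id (t : C) : FunRel t (single t)

/-- Index set of the monoid relations: `l_t`, `r_t` and `a_t`. -/
inductive MonRel : C → Profile C → Type u
  | left (t : C) : MonRel t (single t)
  | right (t : C) : MonRel t (single t)
  | assoc (t : C) : MonRel t (pow t 3)

/-- Index set of the compatibility relations: one relation for the unit and one for the product,
for each morphism `f : c ⟶ t`. -/
inductive FMRel : C → Profile C → Type u
  | unit {c t : C} (f : c ⟶ t) : FMRel t (pow c 0)
  | mul {c t : C} (f : c ⟶ t) : FMRel t (pow c 2)

variable {C} in
/-- Index set of the `⊥`-commutativity relations: orthogonal pairs. -/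
inductive OrthRel (O : Orthogonality C) : C → Profile C → Type u
  | mk {t : C} (c : Fin 2 → C) (f : ∀ i, c i ⟶ t) (h : O.rel (f 0) (f 1)) : OrthRel O t ⟨2, c⟩

/-- All relations for `O_C`. -/
def Rel : NonSymSeq C := fun t c => FunRel C t c ⊕ MonRel C t c ⊕ FMRel C t c

variable {C} in
/-- All relations for `O_(C,⊥)`. -/
def RelPerp (O : Orthogonality C) : NonSymSeq C := fun t c => Rel C t c ⊕ OrthRel O t c

variable {C}

section Eval
variable (P : Operad C) (g : ∀ {t : C} {c : Profile C}, Gen C t c → (P.seq t).obj c)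

/-- Left-hand sides of the functoriality relations `γ(f ⊗ f') = f f'` and `𝟙 = id_t`, for an operad
`P` and an interpretation `g` of the generators in it. -/
def FunRel.lhs : ∀ {t : C} {c : Profile C}, FunRel C t c → (P.seq t).obj c
  | _, _, .comp f f' => P.comp₁ (g (.mor f)) (g (.mor f'))
  | _, _, .id t => P.unit t

def FunRel.rhs : ∀ {t : C} {c : Profile C}, FunRel C t c → (P.seq t).obj c
  | _, _, .comp f f' => g (.mor (f' ≫ f))
  | _, _, .id t => g (.mor (𝟙 t))

/-- Left-hand sides of the monoid relations `γ(μ ⊗ 1 ⊗ 𝟙) = 𝟙`, `γ(μ ⊗ 𝟙 ⊗ 1) = 𝟙` and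
`γ(μ ⊗ μ ⊗ 𝟙) = γ(μ ⊗ 𝟙 ⊗ μ)`. -/
def MonRel.lhs : ∀ {t : C} {c : Profile C}, MonRel C t c → (P.seq t).obj c
  | _, _, .left t => P.comp₂ (b := ![pow t 0, single t])
      (concat_eq_pow (Fin.forall_fin_two.2 ⟨fun _ => rfl, fun _ => rfl⟩) rfl)
      (g (.mul t)) (g (.unit t)) (P.unit t)
  | _, _, .right t => P.comp₂ (b := ![single t, pow t 0])
      (concat_eq_pow (Fin.forall_fin_two.2 ⟨fun _ => rfl, fun _ => rfl⟩) rfl)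
      (g (.mul t)) (P.unit t) (g (.unit t))
  | _, _, .assoc t => P.comp₂ (b := ![pow t 2, single t])
      (concat_eq_pow (Fin.forall_fin_two.2 ⟨fun _ => rfl, fun _ => rfl⟩) rfl)
      (g (.mul t)) (g (.mul t)) (P.unit t)

def MonRel.rhs : ∀ {t : C} {c : Profile C}, MonRel C t c → (P.seq t).obj c
  | _, _, .left t => P.unit t
  | _, _, .right t => P.unit t
  | _, _, .assoc t => P.comp₂ (b := ![single t, pow t 2])
      (concat_eq_pow (Fin.forall_fin_two.2 ⟨fun _ => rfl, fun _ => rfl⟩) rfl)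
      (g (.mul t)) (P.unit t) (g (.mul t))

/-- Left-hand sides of the compatibility relations `γ(f ⊗ 1_c) = 1_t` and
`γ(f ⊗ μ_c) = γ(μ_t ⊗ f ⊗ f)`. -/
def FMRel.lhs : ∀ {t : C} {c : Profile C}, FMRel C t c → (P.seq t).obj c
  | _, _, .unit (c := c) f => P.comp₁ (g (.mor f)) (g (.unit c))
  | _, _, .mul (c := c) f => P.comp₁ (g (.mor f)) (g (.mul c))

def FMRel.rhs : ∀ {t : C} {c : Profile C}, FMRel C t c → (P.seq t).obj c
  | _, _, .unit (c := c) (t := t) _ => (P.seq t).map (eqToHom (pow_zero t c)) (g (.unit t))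
  | _, _, .mul (c := c) (t := t) f => P.comp₂ (b := fun _ => single c)
      (concat_single fun _ => c) (g (.mul t)) (g (.mor f)) (g (.mor f))

variable {O : Orthogonality C}

/-- Left-hand sides of the relations `γ(μ ⊗ f₁ ⊗ f₂) = P(τ) (γ(μ ⊗ f₂ ⊗ f₁))`. -/
def OrthRel.lhs : ∀ {t : C} {c : Profile C}, OrthRel O t c → (P.seq t).obj c
  | _, _, .mk (t := t) c f _ => P.comp₂ (b := fun i => single (c i)) (concat_single c)
      (g (.mul t)) (g (.mor (f 0))) (g (.mor (f 1)))

def OrthRel.rhs : ∀ {t : C} {c : Profile C}, OrthRel O t c → (P.seq t).obj c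
  | _, _, .mk (t := t) c f _ => (P.seq t).map (swapHom c)
      (P.comp₂ (b := fun i => single (c (Equiv.swap 0 1 i)))
        (concat_single fun i => c (Equiv.swap 0 1 i))
        (g (.mul t)) (g (.mor (f 1))) (g (.mor (f 0))))

def Rel.lhs {t : C} {c : Profile C} : Rel C t c → (P.seq t).obj c
  | .inl r => r.lhs P g
  | .inr (.inl r) => r.lhs P g
  | .inr (.inr r) => r.lhs P g

def Rel.rhs {t : C} {c : Profile C} : Rel C t c → (P.seq t).obj c
  | .inl r => r.rhs P g
  | .inr (.inl r) => r.rhs P g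
  | .inr (.inr r) => r.rhs P g

def RelPerp.lhs {t : C} {c : Profile C} : RelPerp O t c → (P.seq t).obj c
  | .inl r => Rel.lhs P g r
  | .inr r => r.lhs P g

def RelPerp.rhs {t : C} {c : Profile C} : RelPerp O t c → (P.seq t).obj c
  | .inl r => Rel.rhs P g r
  | .inr r => r.rhs P g

end Eval

/-- `F(X^sym)` for a non-symmetric sequence `X`. -/
noncomputable abbrev freeOn {C : Type u} (X : NonSymSeq C) : Operad C :=
  (sym C ⋙ freeOperad C).obj X

/-- The canonical map `X ⟶ F(X^sym)`. -/
noncomputable def freeOn.ι {C : Type u} {X : NonSymSeq C} {t : C} {c : Profile C} (x : X t c) :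
    ((freeOn X).seq t).obj c :=
  (freeAdj C).unit.app X t c x

/-- The operad morphism `F(X^sym) ⟶ P` that corresponds to a map `X ⟶ P`. -/
noncomputable def freeOn.desc {C : Type u} {X : NonSymSeq C} (P : Operad C)
    (g : ∀ {t : C} {c : Profile C}, X t c → (P.seq t).obj c) : freeOn X ⟶ P :=
  ((freeAdj C).homEquiv X P).symm fun _ _ => ↾g

theorem freeOn.desc_ι {C : Type u} {X : NonSymSeq C} (P : Operad C)
    (g : ∀ {t : C} {c : Profile C}, X t c → (P.seq t).obj c) {t : C} {c : Profile C} (x : X t c) :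
    ((freeOn.desc P g).toHom t).app c (freeOn.ι x) = g x := by
  have h := ((freeAdj C).homEquiv X P).apply_symm_apply fun _ _ => ↾g
  rw [Adjunction.homEquiv_unit] at h
  exact ConcreteCategory.congr_hom (congrFun (congrFun h t) c) x

theorem freeOn.hom_ext {C : Type u} {X : NonSymSeq C} {P : Operad C} {f f' : freeOn X ⟶ P}
    (h : ∀ (t : C) (c : Profile C) (x : X t c),
      (f.toHom t).app c (freeOn.ι x) = (f'.toHom t).app c (freeOn.ι x)) : f = f' := by
  refine ((freeAdj C).homEquiv X P).injective ?_
  rw [Adjunction.homEquiv_unit, Adjunction.homEquiv_unit]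
  funext t c
  exact ConcreteCategory.hom_ext _ _ (h t c)

variable (C)

/-- The first of the parallel morphisms `F(R_C^sym) ⇉ F(G_C^sym)`. -/
noncomputable def r₁ : freeOn (Rel C) ⟶ freeOn (Gen C) := freeOn.desc _ (Rel.lhs _ freeOn.ι)

/-- The second of the parallel morphisms `F(R_C^sym) ⇉ F(G_C^sym)`. -/
noncomputable def r₂ : freeOn (Rel C) ⟶ freeOn (Gen C) := freeOn.desc _ (Rel.rhs _ freeOn.ι)

variable {C}

/-- The first of the parallel morphisms `F(R_(C,⊥)^sym) ⇉ F(G_C^sym)`. -/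
noncomputable def rPerp₁ (O : Orthogonality C) : freeOn (RelPerp O) ⟶ freeOn (Gen C) :=
  freeOn.desc _ (RelPerp.lhs _ freeOn.ι)

/-- The second of the parallel morphisms `F(R_(C,⊥)^sym) ⇉ F(G_C^sym)`. -/
noncomputable def rPerp₂ (O : Orthogonality C) : freeOn (RelPerp O) ⟶ freeOn (Gen C) :=
  freeOn.desc _ (RelPerp.rhs _ freeOn.ι)

/-- The map `1_t ↦ (e, *)`, `f ↦ (e, f)`, `μ_t ↦ (e, (id_t, id_t))`. -/
def Gen.toOC : ∀ {t : C} {c : Profile C}, Gen C t c → OpElt t c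
  | _, _, .unit _ => ⟨Equiv.refl _, fun i => i.elim0⟩
  | _, _, .mor f => ⟨Equiv.refl _, fun _ => f⟩
  | _, _, .mul t => ⟨Equiv.refl _, fun _ => 𝟙 t⟩

variable (C) in
/-- The morphism `F(G_C^sym) ⟶ O_C`. -/
noncomputable def q : freeOn (Gen C) ⟶ OC C := freeOn.desc (OC C) Gen.toOC

/-- `(f₁, f₂) ↦ (e, (f₁, f₂))`. -/
def OrthRel.s₁ {O : Orthogonality C} : ∀ {t : C} {c : Profile C}, OrthRel O t c → OpElt t c
  | _, _, .mk _ f _ => ⟨Equiv.refl _, f⟩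

/-- `(f₁, f₂) ↦ (τ, (f₁, f₂))`, where `τ` is the transposition. -/
def OrthRel.s₂ {O : Orthogonality C} : ∀ {t : C} {c : Profile C}, OrthRel O t c → OpElt t c
  | _, _, .mk _ f _ => ⟨Equiv.swap (0 : Fin 2) 1, f⟩

/-- The first of the parallel morphisms `F(R_⊥^sym) ⇉ O_C`. -/
noncomputable def sPerp₁ (O : Orthogonality C) : freeOn (OrthRel O) ⟶ OC C :=
  freeOn.desc (OC C) OrthRel.s₁

/-- The second of the parallel morphisms `F(R_⊥^sym) ⇉ O_C`. -/
noncomputable def sPerp₂ (O : Orthogonality C) : freeOn (OrthRel O) ⟶ OC C :=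
  freeOn.desc (OC C) OrthRel.s₂

end Presentation
section Naturality

/-- The profile `(f(c₁), …, f(cₙ))`. -/
abbrev Profile.map {C D : Type u} (f : C → D) (c : Profile C) : Profile D :=
  ⟨c.n, fun i => f (c.color i)⟩

def Profile.mapFunctor {C D : Type u} (f : C → D) : Profile C ⥤ Profile D where
  obj c := c.map f
  map σ := Profile.Hom.mk σ.equiv fun i => congrArg f (σ.color_eq i)

/-- The pullback `f^* P` of an operad along a map of colors: `(f^* P)(t; c) = P(f(t); f(c))`. -/
def Operad.pullback {C D : Type u} (f : C → D) (P : Operad D) : Operad C where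
  seq t := Profile.mapFunctor f ⋙ P.seq (f t)
  unit t := P.unit (f t)
  comp {t a b} x y := P.comp (a := a.map f) (b := fun i => (b i).map f) x y
  comp_perm {t a b} x y σ := P.comp_perm (a := a.map f) (b := fun i => (b i).map f) x y σ
  comp_map {t a b b'} x y σ :=
    P.comp_map (a := a.map f) (b := fun i => (b i).map f) (b' := fun i => (b' i).map f) x y
      fun i => (Profile.mapFunctor f).map (σ i)
  assoc {t a b c} x y z := by
    refine Eq.trans (congrArg (fun h => (P.seq (f t)).map h _) (eqToHom_map _ _)) ?_
    exact P.assoc (a := a.map f) (b := fun i => (b i).map f)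
      (c := fun i j => (c i j).map f) x y z
  unit_comp {t a} x := by
    refine Eq.trans (congrArg (fun h => (P.seq (f t)).map h _) (eqToHom_map _ _)) ?_
    exact P.unit_comp (a := a.map f) x
  comp_unit {t a} x := by
    refine Eq.trans (congrArg (fun h => (P.seq (f t)).map h _) (eqToHom_map _ _)) ?_
    exact P.comp_unit (a := a.map f) x

/-- Operads with varying colors: pairs of a set of colors and an operad. -/
structure ColoredOperad : Type (u + 1) where
  Color : Type u
  operad : Operad Color

namespace ColoredOperad

/-- Morphisms `(f, φ)`: a map `f` of colors and a morphism `φ : O ⟶ f^* P` of operads. -/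
structure Hom (P Q : ColoredOperad.{u}) where
  onColor : P.Color → Q.Color
  toOperad : P.operad ⟶ Q.operad.pullback onColor

/-- The composition `(g f, f^*(ψ) φ)`. -/
def comp {P Q R : ColoredOperad.{u}} (φ : Hom P Q) (ψ : Hom Q R) : Hom P R where
  onColor t := ψ.onColor (φ.onColor t)
  toOperad := Operad.Hom.mk
    (fun t =>
      { app := fun c => ↾fun x => (ψ.toOperad.toHom (φ.onColor t)).app
          (c.map φ.onColor) ((φ.toOperad.toHom t).app c x)
        naturality := fun c d σ => ConcreteCategory.hom_ext _ _ fun x =>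
          (congrArg _ (ConcreteCategory.congr_hom ((φ.toOperad.toHom t).naturality σ) x)).trans
            (ConcreteCategory.congr_hom ((ψ.toOperad.toHom (φ.onColor t)).naturality
              ((Profile.mapFunctor φ.onColor).map σ)) ((φ.toOperad.toHom t).app c x)) })
    (fun t => (congrArg _ (φ.toOperad.map_unit t)).trans (ψ.toOperad.map_unit (φ.onColor t)))
    (fun {t a b} x y => (congrArg _ (φ.toOperad.map_comp x y)).trans
      (ψ.toOperad.map_comp (a := a.map φ.onColor) (b := fun i => (b i).map φ.onColor) _ _))

instance : Category ColoredOperad.{u} where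
  Hom := Hom
  id P := ⟨id, Operad.Hom.mk (fun t =>
    { app := fun c => 𝟙 _
      naturality := fun _ _ _ => rfl }) (fun _ => rfl) (fun {_ _ _} _ _ => rfl)⟩
  comp := comp
  id_comp _ := rfl
  comp_id _ := rfl
  assoc _ _ _ := rfl

/-- The inclusion of the category of operads with a fixed set of colors. -/
def fibre (C : Type u) : Operad C ⥤ ColoredOperad.{u} where
  obj P := ⟨C, P⟩
  map {P Q} φ := Hom.mk id (Operad.Hom.mk (fun t =>
    { app := fun c => (φ.toHom t).app c
      naturality := fun _ _ σ => (φ.toHom t).naturality σ }) φ.map_unit fun {_ _ _} x y => φ.map_comp x y)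

end ColoredOperad

section Maps
variable {C D : Type u} [SmallCategory C] [SmallCategory D] (F : C ⥤ D)

def Gen.map : ∀ {t : C} {c : Profile C}, Gen C t c →
    Gen D (F.obj t) (c.map F.obj)
  | _, _, .unit t => .unit (F.obj t)
  | _, _, .mor f => .mor (F.map f)
  | _, _, .mul t => .mul (F.obj t)

def FunRel.map : ∀ {t : C} {c : Profile C}, FunRel C t c →
    FunRel D (F.obj t) (c.map F.obj)
  | _, _, .comp f g => .comp (F.map f) (F.map g)
  | _, _, .id t => .id (F.obj t)

def MonRel.map : ∀ {t : C} {c : Profile C}, MonRel C t c →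
    MonRel D (F.obj t) (c.map F.obj)
  | _, _, .left t => .left (F.obj t)
  | _, _, .right t => .right (F.obj t)
  | _, _, .assoc t => .assoc (F.obj t)

def FMRel.map : ∀ {t : C} {c : Profile C}, FMRel C t c →
    FMRel D (F.obj t) (c.map F.obj)
  | _, _, .unit f => .unit (F.map f)
  | _, _, .mul f => .mul (F.map f)

def Rel.map {t : C} {c : Profile C} :
    Rel C t c → Rel D (F.obj t) (c.map F.obj) :=
  Sum.map (FunRel.map F) (Sum.map (MonRel.map F) (FMRel.map F))

/-- `F` preserves the orthogonality relations. -/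
def Orthogonality.Preserves (O : Orthogonality C) (O' : Orthogonality D) : Prop :=
  ∀ {c₁ c₂ t : C} (f₁ : c₁ ⟶ t) (f₂ : c₂ ⟶ t), O.rel f₁ f₂ → O'.rel (F.map f₁) (F.map f₂)

variable {F} {O : Orthogonality C} {O' : Orthogonality D}

def OrthRel.map (hF : Orthogonality.Preserves F O O') : ∀ {t : C} {c : Profile C}, OrthRel O t c →
    OrthRel O' (F.obj t) (c.map F.obj)
  | _, _, .mk c f h => .mk (fun i => F.obj (c i)) (fun i => F.map (f i)) (hF _ _ h)

def RelPerp.map (hF : Orthogonality.Preserves F O O') {t : C} {c : Profile C} :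
    RelPerp O t c → RelPerp O' (F.obj t) (c.map F.obj) :=
  Sum.map (Rel.map F) (OrthRel.map hF)

variable (F) in
/-- `(σ, f) ↦ (σ, F(f))`. -/
def OpElt.map {t : C} {c : Profile C} (x : OpElt t c) :
    OpElt (F.obj t) (c.map F.obj) where
  perm := x.perm
  mor i := F.map (x.mor i)

theorem OpElt.map_act {t : C} {c d : Profile C} (σ : c ⟶ d) (x : OpElt t c) :
    OpElt.map F (OpElt.act σ x) = OpElt.act ((Profile.mapFunctor F.obj).map σ) (OpElt.map F x) :=
  OpElt.ext rfl (funext fun i => by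
    refine (F.map_comp _ _).trans ?_
    rw [eqToHom_map]
    rfl)

theorem OpElt.map_comp {t : C} {a : Profile C} {b : Fin a.n → Profile C} (x : OpElt t a)
    (y : ∀ i, OpElt (a.color i) (b i)) :
    OpElt.map F (OpElt.comp x y) =
      OpElt.comp (a := a.map F.obj) (b := fun i => (b i).map F.obj) (OpElt.map F x)
        (fun i => OpElt.map F (y i)) :=
  OpElt.ext rfl (funext fun i => F.map_comp _ _)

variable (F) in
def OC.map : OC C ⟶ (OC D).pullback F.obj :=
  Operad.Hom.mk
    (fun t =>
      { app := fun c => ↾OpElt.map F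
        naturality := fun _ _ σ => ConcreteCategory.hom_ext _ _ fun x => OpElt.map_act σ x })
    (fun t => OpElt.ext rfl (funext fun _ => F.map_id t))
    (fun x y => OpElt.map_comp x y)

theorem OpElt.PerpRel.map (hF : Orthogonality.Preserves F O O') {t : C} {c : Profile C}
    {x y : OpElt t c} (h : OpElt.PerpRel O x y) :
    OpElt.PerpRel O' (OpElt.map F x) (OpElt.map F y) := by
  rw [OpElt.perpRel_iff] at h ⊢
  exact ⟨funext fun i => congrArg F.map (congrFun h.1 i), fun i j h1 h2 => hF _ _ (h.2 i j h1 h2)⟩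

def OCPerp.map (hF : Orthogonality.Preserves F O O') : OCPerp O ⟶ (OCPerp O').pullback F.obj :=
  Operad.Hom.mk
    (fun t =>
      { app := fun c => ↾Quotient.map (sa := perpSetoid O t c)
          (sb := perpSetoid O' (F.obj t) (c.map F.obj))
          (OpElt.map F) fun _ _ h => OpElt.PerpRel.map hF h
        naturality := fun _ _ σ => ConcreteCategory.hom_ext _ _ fun x => by
          obtain ⟨x, rfl⟩ := Quotient.exists_rep x
          exact congrArg (Quotient.mk (perpSetoid O' _ _)) (OpElt.map_act σ x) })
    (fun t => congrArg (Quotient.mk (perpSetoid O' _ _)) ((OC.map F).map_unit t))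
    (fun {t a b} x y => by
      obtain ⟨x, rfl⟩ := Quotient.exists_rep x
      obtain ⟨y, rfl⟩ := exists_rep_family y
      refine (congrArg _ (perpComp_mk O x y)).trans ?_
      refine (congrArg (Quotient.mk (perpSetoid O' _ _)) (OpElt.map_comp x y)).trans ?_
      exact (perpComp_mk O' (OpElt.map F x) (fun i => OpElt.map F (y i))).symm)

end Maps

/-- The morphism between the free operads of non-symmetric sequences over different colors that
extends a map of the non-symmetric sequences. -/
noncomputable def freeMap {C D : Type u} (f : C → D) {X : NonSymSeq C} {Y : NonSymSeq D}
    (m : ∀ {t : C} {c : Profile C}, X t c → Y (f t) (c.map f)) :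
    ColoredOperad.mk C (freeOn X) ⟶ ColoredOperad.mk D (freeOn Y) :=
  ColoredOperad.Hom.mk f
    (freeOn.desc ((freeOn Y).pullback f) fun {_ _} x => freeOn.ι (X := Y) (m x))

theorem freeMap_id {C : Type u} {X : NonSymSeq C} (m : ∀ {t : C} {c : Profile C}, X t c → X t c)
    (h : ∀ {t : C} {c : Profile C} (x : X t c), m x = x) :
    freeMap (X := X) (Y := X) (fun t => t) m = 𝟙 (ColoredOperad.mk C (freeOn X)) :=
  congrArg (ColoredOperad.Hom.mk (P := ColoredOperad.mk C (freeOn X))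
    (Q := ColoredOperad.mk C (freeOn X)) fun t => t) <| freeOn.hom_ext fun t c x =>
      (freeOn.desc_ι _ _ x).trans (congrArg (freeOn.ι (X := X)) (h x))

theorem freeMap_comp {C D E : Type u} (f : C → D) (g : D → E) {X : NonSymSeq C}
    {Y : NonSymSeq D} {Z : NonSymSeq E} (m : ∀ {t : C} {c : Profile C}, X t c → Y (f t) (c.map f))
    (n : ∀ {t : D} {c : Profile D}, Y t c → Z (g t) (c.map g))
    (k : ∀ {t : C} {c : Profile C}, X t c → Z (g (f t)) (c.map fun s => g (f s)))
    (h : ∀ {t : C} {c : Profile C} (x : X t c), k x = n (m x)) :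
    freeMap (X := X) (Y := Z) (fun t => g (f t)) k =
      freeMap (X := X) (Y := Y) f m ≫ freeMap (X := Y) (Y := Z) g n :=
  congrArg (ColoredOperad.Hom.mk (P := ColoredOperad.mk C (freeOn X))
    (Q := ColoredOperad.mk E (freeOn Z)) fun t => g (f t)) <| freeOn.hom_ext fun t c x => by
      refine (freeOn.desc_ι _ _ x).trans ((congrArg (freeOn.ι (X := Z)) (h x)).trans ?_)
      symm
      refine (congrArg ((Operad.Hom.toHom (freeOn.desc (X := Y) ((freeOn Z).pullback g)
        fun {_ _} x => freeOn.ι (X := Z) (n x)) (f t)).app (c.map f))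
          (freeOn.desc_ι ((freeOn Y).pullback f)
            (fun {_ _} x => freeOn.ι (X := Y) (m x)) x)).trans ?_
      exact freeOn.desc_ι (X := Y) ((freeOn Z).pullback g)
        (fun {_ _} x => freeOn.ι (X := Z) (n x)) (m x)

/-- Orthogonal categories: small categories with an orthogonality relation. -/
structure OrthCat : Type (u + 1) where
  cat : Cat.{u, u}
  orth : Orthogonality cat

namespace OrthCat

/-- Orthogonal functors. -/
@[ext]
structure Hom (X Y : OrthCat.{u}) where
  hom : X.cat ⟶ Y.cat
  preserves : Orthogonality.Preserves hom.toFunctor X.orth Y.orth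

instance : Category OrthCat.{u} where
  Hom := Hom
  id X := ⟨𝟙 X.cat, fun _ _ h => h⟩
  comp F G := ⟨F.hom ≫ G.hom, fun _ _ h => G.preserves _ _ (F.preserves _ _ h)⟩

/-- The projection `(C, ⊥) ↦ C`. -/
def forget : OrthCat.{u} ⥤ Cat.{u, u} where
  obj X := X.cat
  map F := F.hom

end OrthCat

/-- The functor `C ↦ F(G_C^sym)`. -/
noncomputable def genFunctor : Cat.{u, u} ⥤ ColoredOperad.{u} where
  obj C := ⟨C, freeOn (Gen C)⟩
  map F := freeMap (X := Gen _) (Y := Gen _) F.toFunctor.obj (Gen.map F.toFunctor)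
  map_id C := freeMap_id (X := Gen C) (Gen.map (𝟭 C)) fun x => by cases x <;> rfl
  map_comp F G := freeMap_comp (X := Gen _) (Y := Gen _) (Z := Gen _) F.toFunctor.obj
    G.toFunctor.obj (Gen.map F.toFunctor) (Gen.map G.toFunctor)
    (Gen.map (F.toFunctor ⋙ G.toFunctor)) fun x => by cases x <;> rfl

/-- The functor `C ↦ F(R_C^sym)`. -/
noncomputable def relFunctor : Cat.{u, u} ⥤ ColoredOperad.{u} where
  obj C := ⟨C, freeOn (Rel C)⟩
  map F := freeMap (X := Rel _) (Y := Rel _) F.toFunctor.obj (Rel.map F.toFunctor)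
  map_id C := freeMap_id (X := Rel C) (Rel.map (𝟭 C)) fun x => by
    rcases x with x | x | x <;> cases x <;> rfl
  map_comp F G := freeMap_comp (X := Rel _) (Y := Rel _) (Z := Rel _) F.toFunctor.obj
    G.toFunctor.obj (Rel.map F.toFunctor) (Rel.map G.toFunctor)
    (Rel.map (F.toFunctor ⋙ G.toFunctor)) fun x => by
      rcases x with x | x | x <;> cases x <;> rfl

/-- The functor `C ↦ O_C`. -/
def opFunctor : Cat.{u, u} ⥤ ColoredOperad.{u} where
  obj C := ⟨C, OC C⟩
  map {C D} F := ColoredOperad.Hom.mk F.toFunctor.obj (OC.map F.toFunctor)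
  map_id C := rfl
  map_comp F G := rfl

/-- The functor `(C, ⊥) ↦ F(R_(C,⊥)^sym)`. -/
noncomputable def relPerpFunctor : OrthCat.{u} ⥤ ColoredOperad.{u} where
  obj X := ⟨X.cat, freeOn (RelPerp X.orth)⟩
  map {X Y} F := freeMap (X := RelPerp X.orth) (Y := RelPerp Y.orth) F.hom.toFunctor.obj
    (RelPerp.map F.preserves)
  map_id X := freeMap_id (X := RelPerp X.orth)
    (RelPerp.map (F := 𝟭 X.cat) (O := X.orth) (O' := X.orth) fun _ _ h => h) fun x => by
      rcases x with (x | x | x) | x <;> cases x <;> rfl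
  map_comp {X Y Z} F G := freeMap_comp (X := RelPerp X.orth) (Y := RelPerp Y.orth)
    (Z := RelPerp Z.orth) F.hom.toFunctor.obj G.hom.toFunctor.obj (RelPerp.map F.preserves)
    (RelPerp.map G.preserves) (RelPerp.map (F ≫ G).preserves) fun x => by
      rcases x with (x | x | x) | x <;> cases x <;> rfl

/-- The functor `(C, ⊥) ↦ O_(C,⊥)`. -/
noncomputable def opPerpFunctor : OrthCat.{u} ⥤ ColoredOperad.{u} where
  obj X := ⟨X.cat, OCPerp X.orth⟩
  map {X Y} F := ColoredOperad.Hom.mk F.hom.toFunctor.obj (OCPerp.map F.preserves)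
  map_id X := congrArg (ColoredOperad.Hom.mk (P := ⟨X.cat, OCPerp X.orth⟩)
    (Q := ⟨X.cat, OCPerp X.orth⟩) fun t => t) <| Operad.hom_ext fun t c x => by
      obtain ⟨x, rfl⟩ := Quotient.exists_rep x
      rfl
  map_comp {X Y Z} F G := congrArg (ColoredOperad.Hom.mk (P := ⟨X.cat, OCPerp X.orth⟩)
    (Q := ⟨Z.cat, OCPerp Z.orth⟩) fun t => G.hom.toFunctor.obj (F.hom.toFunctor.obj t)) <|
      Operad.hom_ext fun t c x => by
        obtain ⟨x, rfl⟩ := Quotient.exists_rep x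
        rfl

end Naturality

end ColOp

open ColOp

namespace ColOp

open Profile Operad

/-! ### Operations with unspecified inputs, and composition without transports. -/

section Elt

variable {C : Type u}

/-! Let `P` be an operad in which the generators are interpreted so that the relations of `C` hold.
For a color `t`, consider all operations of `P` with output `t` and any inputs. The monoid relations
make `(y, z) ↦ γ(μ_t ⊗ y ⊗ z)` an associative product on them with unit `1_t`. The compatibility
relations make `y ↦ γ(f ⊗ y)` a homomorphism between these monoids for each `f`, and functoriality
makes it send the operation of `g` to that of `fg`.

In `O_C` every element has a unique normal form: `(σ, f)` is the image under `σ` of the ordered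
element `(e, f σ⁻¹)`, and an ordered element `(e, (g₁, …, gₙ))` is the product of `g₁, …, gₙ`
(`OpElt.gen_induction`). So a morphism `O_C ⟶ P` that extends the interpretation must send `(σ, f)`
to the image under `σ` of the product of the entries of `f σ⁻¹`. This formula defines
`RelModel.eval`; as normal forms are unique, nothing has to be checked for it to be well defined.

It remains to see that `eval` preserves compositions. The outer operations for which it does so are
closed under permutations (equivariance) and under composition (associativity), hence only the
generators matter. There the inner operations may be taken to be ordered, and the claim says that
the product of a concatenation is the product of the products (`prod_append`) and that push-forward
preserves products (`push_prod`). This gives statement 1.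

For `O_(C,⊥)`, let `k` be a morphism out of `O_C` that identifies `(e, (f₁, f₂))` with `(τ, (f₁,
f₂))` for orthogonal pairs. The relation is generated by transpositions of adjacent orthogonal
entries. Up to a permutation, such a step replaces the middle block in a composition of `(e, (id,
id, id))` with three blocks, and there it is the given identification (`app_swap_eq`). So `k`
descends to the quotient. The remaining presentation combines the two: `q` carries the two sides of
a `⊥`-relation to exactly these two elements (`OrthRel.lhs_toOC`, `OrthRel.rhs_toOC`).

Naturality can be tested on the generators of the free operads. The two sides of a relation are
operadic expressions in the generators, so every morphism of operads that respects the generators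
respects them (`RelPerp.mapOp_lhs`, `RelPerp.mapOp_rhs`). -/

theorem Profile.concat_eq {m : ℕ} {b : Fin m → Profile C} {d : Profile C}
    (hn : ∑ i, (b i).n = d.n)
    (h : ∀ i j (k : Fin d.n), (k : ℕ) = concatEquiv b ⟨i, j⟩ → (b i).color j = d.color k) :
    concat b = d := by
  refine eq_of_hom (Profile.Hom.mk (finCongr hn.symm) fun k => ?_) fun _ => rfl
  obtain ⟨⟨i, j⟩, hp⟩ := (concatEquiv b).surjective (finCongr hn.symm k)
  rw [← hp, concat_color]
  exact (h i j k (congrArg Fin.val hp).symm).symm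

namespace Operad

variable (P : Operad C)

/-- Operations with output color `t` and arbitrary inputs. -/
abbrev Elt (t : C) : Type u := Σ c : Profile C, (P.seq t).obj c

variable {P}

/-- Pairing an operation with its profile absorbs every transport along an equality of profiles. In
`Elt` the associativity and unit axioms therefore become plain equations, and `elt_ext` leads back
to a fixed profile. -/
theorem elt_map_eqToHom {t : C} {c d : Profile C} (h : c = d) (x : (P.seq t).obj c) :
    (⟨d, (P.seq t).map (eqToHom h) x⟩ : P.Elt t) = ⟨c, x⟩ := by
  subst h
  exact congrArg (Sigma.mk c) (Functor.map_id_apply (P.seq t) c x)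

theorem elt_ext {t : C} {c : Profile C} {x y : (P.seq t).obj c}
    (h : (⟨c, x⟩ : P.Elt t) = ⟨c, y⟩) : x = y :=
  eq_of_heq (Sigma.mk.inj_iff.1 h).2

theorem map_eqToHom_injective {t : C} {c d : Profile C} (h : c = d) {x y : (P.seq t).obj c}
    (hxy : (P.seq t).map (eqToHom h) x = (P.seq t).map (eqToHom h) y) : x = y :=
  elt_ext ((elt_map_eqToHom h x).symm.trans ((congrArg (Sigma.mk d) hxy).trans
    (elt_map_eqToHom h y)))

/-- Composition of an operation with operations with arbitrary inputs. -/
def compElt {t : C} {a : Profile C} (x : (P.seq t).obj a) (y : ∀ i, P.Elt (a.color i)) :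
    P.Elt t :=
  ⟨concat fun i => (y i).1, P.comp x fun i => (y i).2⟩

/-- The families `y` and `y'` live over different index types. Comparing them at positions of equal
value, with the colors packed in, avoids casts. -/
theorem compElt_congr {t : C} {a a' : Profile C} {x : (P.seq t).obj a} {x' : (P.seq t).obj a'}
    (h : (⟨a, x⟩ : P.Elt t) = ⟨a', x'⟩) {y : ∀ i, P.Elt (a.color i)}
    {y' : ∀ i, P.Elt (a'.color i)}
    (hy : ∀ (i : Fin a.n) (i' : Fin a'.n), (i : ℕ) = i' →
      (⟨a.color i, y i⟩ : Σ s, P.Elt s) = ⟨a'.color i', y' i'⟩) :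
    compElt x y = compElt x' y' := by
  cases h
  exact congrArg (compElt x) (funext fun i => eq_of_heq (Sigma.mk.inj_iff.1 (hy i i rfl)).2)

theorem compElt_assoc {t : C} {a : Profile C} (x : (P.seq t).obj a) (y : ∀ i, P.Elt (a.color i))
    (z : ∀ i j, P.Elt ((y i).1.color j)) :
    compElt (P.comp x fun i => (y i).2) (fun p =>
      z ((concatEquiv fun i => (y i).1).symm p).1 ((concatEquiv fun i => (y i).1).symm p).2) =
      compElt x fun i => compElt (y i).2 (z i) :=
  (elt_map_eqToHom (concat_concat fun i j => (z i j).1) _).symm.trans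
    (congrArg (Sigma.mk _) (P.assoc x (fun i => (y i).2) fun i j => (z i j).2))

theorem compElt_unit {t : C} {a : Profile C} (x : (P.seq t).obj a) :
    compElt x (fun i => ⟨single (a.color i), P.unit (a.color i)⟩) = ⟨a, x⟩ :=
  (elt_map_eqToHom (concat_single a.color) _).symm.trans
    (congrArg (Sigma.mk _) (P.comp_unit x))

theorem unit_compElt {t : C} (y : P.Elt t) :
    compElt (P.unit t) (fun _ => y) = y :=
  (elt_map_eqToHom (concat_one y.1) _).symm.trans
    (congrArg (Sigma.mk y.1) (P.unit_comp y.2))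

theorem unit_compElt_vec {t : C} (y : P.Elt t) :
    compElt (a := pow t 1) (P.unit t) (![y] : Fin 1 → P.Elt t) = y :=
  (congrArg (compElt (P.unit t)) (funext fun i : Fin 1 => by fin_cases i; rfl)).trans
    (unit_compElt y)

/-- Composition with an operation with two inputs of the same color. -/
def mulElt {t s : C} (m : (P.seq t).obj (pow s 2)) (y z : P.Elt s) : P.Elt t :=
  compElt m (![y, z] : Fin 2 → P.Elt s)

theorem elt_comp₁ {t s : C} {b : Profile C} (x : (P.seq t).obj (single s))
    (y : (P.seq s).obj b) :
    (⟨b, P.comp₁ x y⟩ : P.Elt t) = compElt x fun _ => ⟨b, y⟩ :=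
  elt_map_eqToHom (concat_one b) _

theorem elt_comp₂ {t s : C} {b : Fin 2 → Profile C} {d : Profile C} (h : concat b = d)
    (m : (P.seq t).obj (pow s 2)) (x : (P.seq s).obj (b 0)) (y : (P.seq s).obj (b 1)) :
    (⟨d, P.comp₂ h m x y⟩ : P.Elt t) = mulElt m ⟨b 0, x⟩ ⟨b 1, y⟩ := by
  refine (elt_map_eqToHom h _).trans ?_
  refine congrArg (compElt m) (a₁ := fun i : Fin 2 => (⟨b i, match i with
    | 0 => x
    | 1 => y⟩ : P.Elt s)) (funext fun i => ?_)
  fin_cases i <;> rfl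

theorem concatEquiv_zero {b : Fin 2 → Profile C} (j : Fin (b 0).n) :
    (concatEquiv b ⟨0, j⟩ : ℕ) = j := by
  rw [concatEquiv, finSigmaFinEquiv_apply]
  simp

theorem concatEquiv_one {b : Fin 2 → Profile C} (j : Fin (b 1).n) :
    (concatEquiv b ⟨1, j⟩ : ℕ) = (b 0).n + j := by
  rw [concatEquiv, finSigmaFinEquiv_apply]
  simp

theorem compElt_compElt₁ {t s : C} {a : Profile C} (x : (P.seq t).obj (single s))
    (y : (P.seq s).obj a) (z : ∀ i, P.Elt (a.color i)) :
    compElt x (fun _ => compElt y z) = compElt (P.comp₁ x y) z := by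
  refine (compElt_assoc x (fun _ => ⟨a, y⟩) fun _ => z).symm.trans
    (compElt_congr (elt_comp₁ x y).symm fun p i hi => ?_)
  obtain ⟨⟨k, j⟩, rfl⟩ := (concatEquiv fun _ : Fin 1 => a).surjective p
  refine (congrArg (fun q : Σ _ : Fin 1, Fin a.n => (⟨a.color q.2, z q.2⟩ : Σ s, P.Elt s))
    (Equiv.symm_apply_apply _ _)).trans ?_
  have h := finSigmaFinEquiv_one (n := fun _ => a.n) ⟨k, j⟩
  obtain rfl : j = i := Fin.ext (h.symm.trans hi)
  rfl

/-- Associativity in the form in which the relations use it: if `w` is a composite of `m` with `x`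
and `x'`, then arbitrary operations can be substituted into the inputs. It turns identities between
generators into identities between all elements of `P.Elt`. -/
theorem mulElt_compElt {t s r : C} {n n' : ℕ} (m : (P.seq t).obj (pow s 2))
    (x : (P.seq s).obj (pow r n)) (x' : (P.seq s).obj (pow r n'))
    (w : (P.seq t).obj (pow r (n + n')))
    (hw : (⟨_, w⟩ : P.Elt t) = mulElt m ⟨_, x⟩ ⟨_, x'⟩)
    (z : Fin n → P.Elt r) (z' : Fin n' → P.Elt r) :
    mulElt m (compElt x z) (compElt x' z') = compElt w (Fin.append z z') := by
  let y : Fin 2 → P.Elt s := ![⟨_, x⟩, ⟨_, x'⟩]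
  -- The match lets the dependent type reduce on each branch to that of `z` or `z'`.
  let v : ∀ (i : Fin 2) (j : Fin (y i).1.n), P.Elt ((y i).1.color j) := fun i =>
    match i with
    | 0 => z
    | 1 => z'
  have h : mulElt m (compElt x z) (compElt x' z') = compElt m fun i => compElt (y i).2 (v i) :=
    congrArg (compElt m) (funext fun i : Fin 2 => by fin_cases i <;> rfl)
  -- The positions of the two blocks are `j` and `n + j`, which are the two halves of `Fin.append`.
  have key : ∀ (k : Fin 2) (j : Fin (y k).1.n) (i : Fin (n + n')),
      (concatEquiv (fun i => (y i).1) ⟨k, j⟩ : ℕ) = i →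
      (⟨(y k).1.color j, v k j⟩ : Σ s, P.Elt s) = ⟨r, Fin.append z z' i⟩ := by
    refine Fin.forall_fin_two.2 ⟨fun j i hi => ?_, fun j i hi => ?_⟩
    · obtain rfl : i = Fin.castAdd n' j :=
        Fin.ext (hi.symm.trans (concatEquiv_zero (b := fun i => (y i).1) j))
      exact congrArg (Sigma.mk r) (Fin.append_left z z' j).symm
    · obtain rfl : i = Fin.natAdd n j :=
        Fin.ext (hi.symm.trans (concatEquiv_one (b := fun i => (y i).1) j))
      exact congrArg (Sigma.mk r) (Fin.append_right z z' j).symm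
  refine h.trans ((compElt_assoc m y v).symm.trans (compElt_congr hw.symm fun p i hi => ?_))
  obtain ⟨q, rfl⟩ := (concatEquiv fun i => (y i).1).surjective p
  exact (congrArg (fun q : Σ i, Fin (y i).1.n => (⟨_, v q.1 q.2⟩ : Σ s, P.Elt s))
    (Equiv.symm_apply_apply _ _)).trans (key q.1 q.2 i hi)

end Operad

/-- Needed to split off the first morphism of an ordered element in `OpElt.gen_induction`. -/
theorem Profile.concat_cons {n : ℕ} (c : Fin (n + 1) → C) :
    concat (![single (c 0), ⟨n, fun i => c i.succ⟩] : Fin 2 → Profile C) = ⟨n + 1, c⟩ := by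
  refine Profile.concat_eq ((Fin.sum_univ_two _).trans (Nat.add_comm _ _))
    (Fin.forall_fin_two.2 ⟨fun j k hk => ?_, fun j k hk => ?_⟩)
  · rw [Operad.concatEquiv_zero] at hk
    exact congrArg c (Fin.ext (hk.trans (Nat.lt_one_iff.1 j.2)).symm)
  · rw [Operad.concatEquiv_one] at hk
    exact congrArg c (Fin.ext ((Nat.add_comm _ _).trans hk.symm))

end Elt

/-! ### Models of the relations: monoids of operations and push-forward homomorphisms. -/

section Models

variable {C : Type u} [SmallCategory C]

/-- An interpretation of the generators in an operad that satisfies the relations of `O_C`. -/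
structure RelModel (P : Operad C) where
  gen {t : C} {c : Profile C} : Gen C t c → (P.seq t).obj c
  rel {t : C} {c : Profile C} (r : Rel C t c) : Rel.lhs P gen r = Rel.rhs P gen r

namespace RelModel

variable {P : Operad C} (M : RelModel P)

/-- The unit `1_t`. -/
def one (t : C) : P.Elt t := ⟨pow t 0, M.gen (.unit t)⟩

/-- The operation `f` of arity one given by a morphism `f`. -/
def mor {t : C} (f : Σ s : C, (s ⟶ t)) : P.Elt t := ⟨single f.1, M.gen (.mor f.2)⟩

/-- The product `γ(μ_t ⊗ y ⊗ z)`. -/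
def mul {t : C} (y z : P.Elt t) : P.Elt t := mulElt (M.gen (.mul t)) y z

/-- The composition `γ(f ⊗ y)`. -/
def push {s t : C} (f : s ⟶ t) (y : P.Elt s) : P.Elt t :=
  compElt (a := single s) (M.gen (.mor f)) fun _ => y

theorem gen_id (t : C) : M.gen (.mor (𝟙 t)) = P.unit t :=
  (M.rel (.inl (.id t))).symm

theorem mor_id (t : C) : M.mor ⟨t, 𝟙 t⟩ = ⟨single t, P.unit t⟩ :=
  congrArg (Sigma.mk _) (M.gen_id t)

theorem push_mor {s t : C} (f : s ⟶ t) (g : Σ r : C, (r ⟶ s)) :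
    M.push f (M.mor g) = M.mor ⟨g.1, g.2 ≫ f⟩ :=
  (elt_comp₁ _ _).symm.trans (congrArg (Sigma.mk _) (M.rel (.inl (.comp f g.2))))

theorem push_one {s t : C} (f : s ⟶ t) : M.push f (M.one s) = M.one t :=
  (elt_comp₁ _ _).symm.trans ((congrArg (Sigma.mk _) (M.rel (.inr (.inr (.unit f))))).trans
    (elt_map_eqToHom _ _))

theorem one_eq_compElt (t : C) :
    compElt (a := pow t 0) (M.gen (.unit t)) (![] : Fin 0 → P.Elt t) = M.one t :=
  (congrArg (compElt (M.gen (.unit t))) (funext fun i : Fin 0 => i.elim0)).trans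
    (compElt_unit (M.gen (.unit t)))

/-- Substitution of `y` into the left unit relation by `mulElt_compElt`. The profile is written `pow
t (0 + 1)` to show how the inputs are divided between the two factors. -/
theorem one_mul {t : C} (y : P.Elt t) : M.mul (M.one t) y = y := by
  have hw : (⟨pow t (0 + 1), P.unit t⟩ : P.Elt t) =
      mulElt (M.gen (.mul t)) ⟨pow t 0, M.gen (.unit t)⟩ ⟨pow t 1, P.unit t⟩ :=
    (congrArg (Sigma.mk _) (M.rel (.inr (.inl (.left t))))).symm.trans (elt_comp₂ _ _ _ _)
  have h := mulElt_compElt (M.gen (.mul t)) (M.gen (.unit t)) (P.unit t) (P.unit t) hw ![] ![y]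
  rw [M.one_eq_compElt, unit_compElt_vec] at h
  refine h.trans (Eq.trans ?_ (unit_compElt y))
  exact congrArg (compElt (P.unit t)) (funext fun i : Fin 1 => by fin_cases i; rfl)

theorem mul_one {t : C} (y : P.Elt t) : M.mul y (M.one t) = y := by
  have hw : (⟨pow t (1 + 0), P.unit t⟩ : P.Elt t) =
      mulElt (M.gen (.mul t)) ⟨pow t 1, P.unit t⟩ ⟨pow t 0, M.gen (.unit t)⟩ :=
    (congrArg (Sigma.mk _) (M.rel (.inr (.inl (.right t))))).symm.trans (elt_comp₂ _ _ _ _)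
  have h := mulElt_compElt (M.gen (.mul t)) (P.unit t) (M.gen (.unit t)) (P.unit t) hw ![y] ![]
  rw [M.one_eq_compElt, unit_compElt_vec] at h
  refine h.trans (Eq.trans ?_ (unit_compElt y))
  exact congrArg (compElt (P.unit t)) (funext fun i : Fin 1 => by fin_cases i; rfl)

/-- Both bracketings are substitutions into one ternary operation `w`. Its definition divides the
three inputs as `2 + 1`, and the associativity relation allows them to be divided as `1 + 2`. -/
theorem mul_assoc {t : C} (x y z : P.Elt t) : M.mul (M.mul x y) z = M.mul x (M.mul y z) := by
  let w : (P.seq t).obj (pow t 3) := Rel.lhs P M.gen (.inr (.inl (.assoc t)))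
  have hw : (⟨pow t (2 + 1), w⟩ : P.Elt t) =
      mulElt (M.gen (.mul t)) ⟨pow t 2, M.gen (.mul t)⟩ ⟨pow t 1, P.unit t⟩ :=
    elt_comp₂ _ _ _ _
  have hw' : (⟨pow t (1 + 2), w⟩ : P.Elt t) =
      mulElt (M.gen (.mul t)) ⟨pow t 1, P.unit t⟩ ⟨pow t 2, M.gen (.mul t)⟩ :=
    (congrArg (Sigma.mk _) (M.rel (.inr (.inl (.assoc t))))).trans (elt_comp₂ _ _ _ _)
  have h := mulElt_compElt (M.gen (.mul t)) (M.gen (.mul t)) (P.unit t) w hw ![x, y] ![z]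
  have h' := mulElt_compElt (M.gen (.mul t)) (P.unit t) (M.gen (.mul t)) w hw' ![x] ![y, z]
  rw [unit_compElt_vec] at h h'
  refine h.trans (Eq.trans ?_ h'.symm)
  exact congrArg (compElt w) (funext fun i : Fin 3 => by fin_cases i <;> rfl)

/-- Here `w` is `γ(f ⊗ μ)`. The compatibility relation reads it as `γ(μ ⊗ f ⊗ f)`, and substituting
`y` and `z` into the two readings gives the two sides. -/
theorem push_mul {s t : C} (f : s ⟶ t) (y z : P.Elt s) :
    M.push f (M.mul y z) = M.mul (M.push f y) (M.push f z) := by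
  let w : (P.seq t).obj (pow s 2) := Rel.lhs P M.gen (.inr (.inr (.mul f)))
  have hw : (⟨pow s (1 + 1), w⟩ : P.Elt t) =
      mulElt (M.gen (.mul t)) ⟨pow s 1, M.gen (.mor f)⟩ ⟨pow s 1, M.gen (.mor f)⟩ :=
    (congrArg (Sigma.mk _) (M.rel (.inr (.inr (.mul f))))).trans (elt_comp₂ _ _ _ _)
  refine (compElt_compElt₁ (M.gen (.mor f)) (M.gen (.mul s)) _).trans
    (Eq.trans ?_ (mulElt_compElt (M.gen (.mul t)) (M.gen (.mor f)) (M.gen (.mor f)) w hw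
      (fun _ => y) (fun _ => z)).symm)
  exact congrArg (compElt w) (funext fun i : Fin 2 => by fin_cases i <;> rfl)

theorem mul_id {t : C} : M.mul (M.mor ⟨t, 𝟙 t⟩) (M.mor ⟨t, 𝟙 t⟩) =
    ⟨pow t 2, M.gen (.mul t)⟩ := by
  rw [mor_id]
  refine Eq.trans ?_ (compElt_unit (M.gen (.mul t)))
  exact congrArg (compElt (M.gen (.mul t))) (funext fun i : Fin 2 => by fin_cases i <;> rfl)

/-- The product of a list of morphisms with target `t`. -/
def prod {t : C} : List (Σ s : C, (s ⟶ t)) → P.Elt t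
  | [] => M.one t
  | f :: l => M.mul (M.mor f) (prod l)

/-- This lemma and `push_prod` are the whole content of compatibility with composition for the
generators `μ_t` and `f`. -/
theorem prod_append {t : C} (l l' : List (Σ s : C, (s ⟶ t))) :
    M.prod (l ++ l') = M.mul (M.prod l) (M.prod l') := by
  induction l with
  | nil => exact (M.one_mul _).symm
  | cons f l ih => exact (congrArg _ ih).trans (M.mul_assoc _ _ _).symm

theorem push_prod {s t : C} (f : s ⟶ t) (l : List (Σ r : C, (r ⟶ s))) :
    M.push f (M.prod l) = M.prod (l.map fun g => ⟨g.1, g.2 ≫ f⟩) := by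
  induction l with
  | nil => exact M.push_one f
  | cons g l ih => exact (M.push_mul f _ _).trans (congrArg₂ M.mul (M.push_mor f g) ih)

theorem prod_singleton {t : C} (f : Σ s : C, (s ⟶ t)) : M.prod [f] = M.mor f :=
  M.mul_one _

/-- A product in `P.Elt t` hides its profile. It has to be known before the product can serve as a
value at a given profile. -/
theorem prod_fst {t : C} (l : List (Σ s : C, (s ⟶ t))) :
    (M.prod l).1 = ⟨l.length, fun i => (l.get i).1⟩ := by
  induction l with
  | nil => exact congrArg (Profile.mk 0) (funext fun i => i.elim0)
  | cons f l ih =>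
    change concat (fun i : Fin 2 => (![M.mor f, M.prod l] i).1) = _
    refine Profile.concat_eq ?_ (Fin.forall_fin_two.2 ⟨fun j k hk => ?_, fun j k hk => ?_⟩)
    · rw [Fin.sum_univ_two]
      change 1 + (M.prod l).1.n = l.length + 1
      rw [ih, Nat.add_comm]
    · rw [concatEquiv_zero] at hk
      obtain rfl : k = ⟨0, Nat.succ_pos _⟩ := Fin.ext (hk.trans (by
        have : (j : ℕ) < 1 := j.2
        exact Nat.lt_one_iff.1 this))
      rfl
    · rw [concatEquiv_one] at hk
      change (M.prod l).1.color j = _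
      have hk' : (k : ℕ) = 1 + j := hk
      have hj : (j : ℕ) < l.length := j.2.trans_eq (congrArg Profile.n ih)
      obtain rfl : k = ⟨j + 1, Nat.succ_lt_succ hj⟩ := Fin.ext (hk'.trans (Nat.add_comm _ _))
      -- The position type depends on the profile, so the profile is generalized before `ih` is
      -- substituted.
      have h : ∀ (c : Profile C) (h : (M.prod l).1 = c) (i : Fin c.n), (j : ℕ) = i →
          (M.prod l).1.color j = c.color i := by
        rintro _ rfl i hi
        exact congrArg _ (Fin.ext hi)
      exact h _ ih ⟨j, hj⟩ rfl

end RelModel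

/-! ### Ordered elements and normal forms in `O_C`. -/

namespace OpElt

/-- The elements `(e, f)` of `O_C`. -/
def Ordered {t : C} {c : Profile C} (x : OpElt t c) : Prop :=
  ∀ i j, x.perm i < x.perm j ↔ i < j

/-- The list of the morphisms `fᵢ` of `(σ, f)`. -/
def arrows {t : C} {c : Profile C} (x : OpElt t c) : List (Σ s : C, (s ⟶ t)) :=
  List.ofFn x.arrow

theorem Ordered.perm_val {t : C} {c : Profile C} {x : OpElt t c} (h : x.Ordered) (i : Fin c.n) :
    x.perm i = i :=
  Fin.ext (val_eq_of_lt x.perm (Equiv.refl _) h i)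

/-- An ordered element has trivial permutation, so only its list of morphisms is left. Equations
between composites of generators in `O_C` thereby become equations between lists. -/
theorem Ordered.ext {t : C} {c : Profile C} {x y : OpElt t c} (hx : x.Ordered) (hy : y.Ordered)
    (h : x.arrows = y.arrows) : x = y :=
  ext_lt (fun i j => (hx i j).trans (hy i j).symm) (congrFun (List.ofFn_injective h))

theorem Ordered.act_eqToHom {t : C} {c d : Profile C} (h : c = d) {x : OpElt t c}
    (hx : x.Ordered) : (act (eqToHom h) x).Ordered := by
  subst h
  exact (act_id x).symm ▸ hx

theorem arrows_act_eqToHom {t : C} {c d : Profile C} (h : c = d) (x : OpElt t c) :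
    (act (eqToHom h) x).arrows = x.arrows := by
  subst h
  exact congrArg arrows (act_id x)

/-- By `comp_lt` a composite compares entries by block first and within the block second. For
ordered factors this is the lexicographic order that defines the concatenation. -/
theorem Ordered.comp {t : C} {a : Profile C} {b : Fin a.n → Profile C} {x : OpElt t a}
    {y : ∀ i, OpElt (a.color i) (b i)} (hx : x.Ordered) (hy : ∀ i, (y i).Ordered) :
    (comp x y).Ordered := by
  intro p q
  obtain ⟨⟨i, j⟩, rfl⟩ := (concatEquiv b).surjective p
  obtain ⟨⟨i', j'⟩, rfl⟩ := (concatEquiv b).surjective q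
  rw [comp_lt, concat_lt, Sigma.lex_iff, hx]
  refine or_congr Iff.rfl ⟨?_, ?_⟩
  · rintro ⟨rfl, h⟩
    exact ⟨rfl, (hy i _ _).1 h⟩
  · rintro ⟨h, h'⟩
    change i = i' at h
    subst h
    exact ⟨rfl, (hy i _ _).2 h'⟩

theorem arrows_eq_of {t : C} {c : Profile C} {m : ℕ} {b : Fin m → Profile C} (h : concat b = c)
    (x : OpElt t c) (l : List (Σ s : C, (s ⟶ t))) (hl : ∑ i, (b i).n = l.length)
    (hx : ∀ i j, l[(concatEquiv b ⟨i, j⟩ : ℕ)]? =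
      some (x.arrow (Fin.cast (congrArg Profile.n h) (concatEquiv b ⟨i, j⟩)))) :
    x.arrows = l := by
  subst h
  refine List.ext_getElem (List.length_ofFn.trans hl) fun k hk hk' => ?_
  obtain ⟨⟨i, j⟩, hp⟩ := (concatEquiv b).surjective ⟨k, hk.trans_eq List.length_ofFn⟩
  obtain rfl : (concatEquiv b ⟨i, j⟩ : ℕ) = k := congrArg Fin.val hp
  refine (List.getElem_ofFn hk).trans ?_
  exact ((List.getElem_eq_iff hk').2 (hx i j)).symm

/-- Postcomposition of the morphisms in a list. -/
def postcomp {s t : C} (f : s ⟶ t) (l : List (Σ r : C, (r ⟶ s))) : List (Σ r : C, (r ⟶ t)) :=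
  l.map fun g => ⟨g.1, g.2 ≫ f⟩

/-- Outer operations with one or two inputs suffice, because no generator has more than two. -/
theorem arrows_comp₁ {t : C} {s : Fin 1 → C} {b : Fin 1 → Profile C} (x : OpElt t ⟨1, s⟩)
    (y : ∀ i, OpElt (s i) (b i)) :
    (comp (a := ⟨1, s⟩) x y).arrows = postcomp (x.mor 0) (y 0).arrows := by
  refine arrows_eq_of rfl _ _ ?_ fun i j => ?_
  · simp [postcomp, arrows]
  · obtain rfl : i = 0 := Subsingleton.elim _ _
    refine Eq.trans ?_ (congrArg some (comp_arrow (a := ⟨1, s⟩) x y ⟨0, j⟩)).symm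
    have h : (concatEquiv b ⟨0, j⟩ : ℕ) = j := by
      rw [concatEquiv, finSigmaFinEquiv_apply]
      simp
    rw [h, postcomp, arrows, List.getElem?_map, List.getElem?_ofFn]
    simp [arrow]

theorem arrows_comp₂ {t : C} {s : Fin 2 → C} {b : Fin 2 → Profile C} (x : OpElt t ⟨2, s⟩)
    (y : ∀ i, OpElt (s i) (b i)) :
    (comp (a := ⟨2, s⟩) x y).arrows =
      postcomp (x.mor 0) (y 0).arrows ++ postcomp (x.mor 1) (y 1).arrows := by
  refine arrows_eq_of rfl _ _ ?_ fun i j => ?_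
  · simp [postcomp, arrows, Fin.sum_univ_two]
  · refine Eq.trans ?_ (congrArg some (comp_arrow (a := ⟨2, s⟩) x y ⟨i, j⟩)).symm
    revert i
    refine Fin.forall_fin_two.2 ⟨fun j => ?_, fun j => ?_⟩
    · rw [concatEquiv_zero, List.getElem?_append_left (by simp [postcomp, arrows]),
        postcomp, arrows, List.getElem?_map, List.getElem?_ofFn]
      simp [arrow]
    · have h : (postcomp (x.mor 0) (y 0).arrows).length = (b 0).n := by simp [postcomp, arrows]
      rw [concatEquiv_one, List.getElem?_append_right (by omega), h, Nat.add_sub_cancel_left,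
        postcomp, arrows, List.getElem?_map, List.getElem?_ofFn]
      simp [arrow]

/-- The element `(e, f σ⁻¹)` for `(σ, f)`. -/
def sort {t : C} {c : Profile C} (x : OpElt t c) : OpElt t (c.perm x.perm.symm) :=
  act (c.permHom x.perm.symm) x

/-- The permutation `σ` of `(σ, f)` as a morphism of profiles `c σ⁻¹ ⟶ c`. -/
def unsort {t : C} {c : Profile C} (x : OpElt t c) : c.perm x.perm.symm ⟶ c :=
  Profile.Hom.mk x.perm fun i => congrArg c.color (x.perm.symm_apply_apply i).symm

theorem ordered_sort {t : C} {c : Profile C} (x : OpElt t c) : x.sort.Ordered := fun i j =>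
  (act_lt _ _ _ _).trans (iff_of_eq (congrArg₂ (· < ·) (x.perm.apply_symm_apply i)
    (x.perm.apply_symm_apply j)))

theorem permHom_unsort {t : C} {c : Profile C} (x : OpElt t c) :
    c.permHom x.perm.symm ≫ x.unsort = 𝟙 c :=
  Profile.Hom.ext (Equiv.ext fun i => x.perm.symm_apply_apply i)

/-- The normal form: an element is recovered from its ordered version by its own permutation. -/
theorem act_unsort {t : C} {c : Profile C} (x : OpElt t c) : act x.unsort x.sort = x := by
  rw [sort, ← act_act, permHom_unsort, act_id]

end OpElt

/-! ### The relations hold in `O_C`, and the generators generate it. -/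

theorem Operad.comp₂_OC_ordered {t s : C} {b : Fin 2 → Profile C} {d : Profile C}
    (h : concat b = d) {m : OpElt t (pow s 2)} {x : OpElt s (b 0)} {y : OpElt s (b 1)}
    (hm : m.Ordered) (hx : x.Ordered) (hy : y.Ordered) :
    OpElt.Ordered ((OC C).comp₂ h m x y) :=
  OpElt.Ordered.act_eqToHom h (OpElt.Ordered.comp hm (Fin.forall_fin_two.2 ⟨hx, hy⟩))

theorem Operad.comp₂_OC_arrows {t s : C} {b : Fin 2 → Profile C} {d : Profile C}
    (h : concat b = d) (m : OpElt t (pow s 2)) (x : OpElt s (b 0)) (y : OpElt s (b 1)) :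
    OpElt.arrows ((OC C).comp₂ h m x y) =
      OpElt.postcomp (m.mor 0) x.arrows ++ OpElt.postcomp (m.mor 1) y.arrows :=
  (OpElt.arrows_act_eqToHom h _).trans (OpElt.arrows_comp₂ _ _)

theorem Operad.comp₁_OC_ordered {t s : C} {b : Profile C} {m : OpElt t (single s)}
    {x : OpElt s b} (hm : m.Ordered) (hx : x.Ordered) :
    OpElt.Ordered ((OC C).comp₁ m x) :=
  OpElt.Ordered.act_eqToHom (concat_one b) (OpElt.Ordered.comp hm fun _ => hx)

theorem Operad.comp₁_OC_arrows {t s : C} {b : Profile C} (m : OpElt t (single s))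
    (x : OpElt s b) :
    OpElt.arrows ((OC C).comp₁ m x) = OpElt.postcomp (m.mor 0) x.arrows :=
  (OpElt.arrows_act_eqToHom (concat_one b) _).trans (OpElt.arrows_comp₁ _ _)

theorem Gen.toOC_ordered {t : C} {c : Profile C} (x : Gen C t c) : x.toOC.Ordered := by
  cases x <;> exact fun _ _ => Iff.rfl

theorem OpElt.unit_ordered (t : C) : (OpElt.unit t).Ordered := fun _ _ => Iff.rfl

theorem OpElt.postcomp_id {t : C} (l : List (Σ s : C, (s ⟶ t))) : postcomp (𝟙 t) l = l := by
  simp [postcomp]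

theorem OC.funRel {t : C} {c : Profile C} (r : FunRel C t c) :
    r.lhs (OC C) Gen.toOC = r.rhs (OC C) Gen.toOC := by
  cases r with
  | comp f g =>
    exact OpElt.Ordered.ext (comp₁_OC_ordered (Gen.toOC_ordered (.mor f)) (Gen.toOC_ordered (.mor g)))
      (Gen.toOC_ordered (.mor (g ≫ f))) (comp₁_OC_arrows (Gen.mor f).toOC (Gen.mor g).toOC)
  | id t => rfl

theorem OC.monRel {t : C} {c : Profile C} (r : MonRel C t c) :
    r.lhs (OC C) Gen.toOC = r.rhs (OC C) Gen.toOC := by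
  have hm := Gen.toOC_ordered (.mul t)
  have h1 := Gen.toOC_ordered (.unit t)
  have hu := OpElt.unit_ordered t
  cases r with
  | left =>
    refine OpElt.Ordered.ext (comp₂_OC_ordered (b := ![pow t 0, single t]) _ hm h1 hu) hu
      ((comp₂_OC_arrows (b := ![pow t 0, single t]) _ (Gen.mul t).toOC (Gen.unit t).toOC
        (OpElt.unit t)).trans ?_)
    exact (congrArg₂ (· ++ ·) (OpElt.postcomp_id _) (OpElt.postcomp_id _))
  | right =>
    refine OpElt.Ordered.ext (comp₂_OC_ordered (b := ![single t, pow t 0]) _ hm hu h1) hu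
      ((comp₂_OC_arrows (b := ![single t, pow t 0]) _ (Gen.mul t).toOC (OpElt.unit t)
        (Gen.unit t).toOC).trans ?_)
    exact (congrArg₂ (· ++ ·) (OpElt.postcomp_id _) (OpElt.postcomp_id _))
  | assoc =>
    refine OpElt.Ordered.ext (comp₂_OC_ordered (b := ![pow t 2, single t]) _ hm hm hu)
      (comp₂_OC_ordered (b := ![single t, pow t 2]) _ hm hu hm) ?_
    refine (comp₂_OC_arrows (b := ![pow t 2, single t]) _ (Gen.mul t).toOC (Gen.mul t).toOC
      (OpElt.unit t)).trans (Eq.trans ?_ (comp₂_OC_arrows (b := ![single t, pow t 2]) _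
        (Gen.mul t).toOC (OpElt.unit t) (Gen.mul t).toOC).symm)
    exact (congrArg₂ (· ++ ·) (OpElt.postcomp_id _) (OpElt.postcomp_id _)).trans
      (congrArg₂ (· ++ ·) (OpElt.postcomp_id _) (OpElt.postcomp_id _)).symm

theorem OC.fmRel {t : C} {c : Profile C} (r : FMRel C t c) :
    r.lhs (OC C) Gen.toOC = r.rhs (OC C) Gen.toOC := by
  cases r with
  | @unit c _ f =>
    exact OpElt.Ordered.ext
      (comp₁_OC_ordered (Gen.toOC_ordered (.mor f)) (Gen.toOC_ordered (.unit c)))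
      (OpElt.Ordered.act_eqToHom _ (Gen.toOC_ordered (.unit t)))
      ((comp₁_OC_arrows (Gen.mor f).toOC (Gen.unit c).toOC).trans
        (OpElt.arrows_act_eqToHom _ (Gen.unit t).toOC).symm)
  | @mul c _ f =>
    have hf := Gen.toOC_ordered (.mor f)
    refine OpElt.Ordered.ext (comp₁_OC_ordered hf (Gen.toOC_ordered (.mul c)))
      (comp₂_OC_ordered (b := fun _ => single c) _ (Gen.toOC_ordered (.mul t)) hf hf)
      ((comp₁_OC_arrows (Gen.mor f).toOC (Gen.mul c).toOC).trans (Eq.trans ?_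
        (comp₂_OC_arrows (b := fun _ => single c) _ (Gen.mul t).toOC (Gen.mor f).toOC
          (Gen.mor f).toOC).symm))
    -- Each of the two entries is `𝟙 ≫ f` on the left and `f ≫ 𝟙` on the right.
    exact congrArg₂ (fun g h => [(⟨c, g⟩ : Σ s : C, (s ⟶ t)), ⟨c, h⟩])
      ((Category.id_comp f).trans (Category.comp_id f).symm)
      ((Category.id_comp f).trans (Category.comp_id f).symm)

/-- `O_C` satisfies the functoriality, monoid and compatibility relations. -/
def OC.relModel : RelModel (OC C) where
  gen := Gen.toOC
  rel
    | .inl r => OC.funRel r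
    | .inr (.inl r) => OC.monRel r
    | .inr (.inr r) => OC.fmRel r

/-- `O_C` is generated by the elements `(e, *)`, `(e, f)` and `(e, (id, id))`. -/
theorem OpElt.gen_induction {S : ∀ {t : C} {c : Profile C}, OpElt t c → Prop}
    (hgen : ∀ {t : C} {c : Profile C} (x : Gen C t c), S x.toOC)
    (hact : ∀ {t : C} {c d : Profile C} (σ : c ⟶ d) (x : OpElt t c), S x → S (OpElt.act σ x))
    (hcomp : ∀ {t : C} {a : Profile C} {b : Fin a.n → Profile C} (x : OpElt t a)
      (y : ∀ i, OpElt (a.color i) (b i)), S x → (∀ i, S (y i)) → S (OpElt.comp x y))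
    {t : C} {c : Profile C} (x : OpElt t c) : S x := by
  -- Ordered elements are handled by induction on their length; the normal form then gives the rest.
  have h : ∀ (n : ℕ) (c : Fin n → C) (x : OpElt t ⟨n, c⟩), x.Ordered → S x := by
    intro n
    induction n with
    | zero =>
      intro c x _
      obtain rfl : (fun _ => t) = c := Subsingleton.elim _ _
      have : x = (Gen.unit t).toOC := OpElt.ext_lt (fun i => i.elim0) fun i => i.elim0
      rw [this]
      exact hgen _
    | succ n ih =>
      intro c x hx
      -- The element `(e, (f₀, …, fₙ))` is the product of `f₀` and `(e, (f₁, …, fₙ))`.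
      have : x = (OC C).comp₂ (concat_cons c) (Gen.mul t).toOC (Gen.mor (x.mor 0)).toOC
          (⟨Equiv.refl _, fun i => x.mor i.succ⟩ : OpElt t ⟨n, fun i => c i.succ⟩) := by
        refine hx.ext (comp₂_OC_ordered _ (Gen.toOC_ordered _) (Gen.toOC_ordered _)
          fun _ _ => Iff.rfl) (Eq.trans ?_ (comp₂_OC_arrows _ _ _ _).symm)
        refine (List.ofFn_succ).trans ?_
        exact (congrArg₂ (· ++ ·) (postcomp_id [x.arrow 0])
          (postcomp_id (List.ofFn fun i => x.arrow i.succ))).symm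
      rw [this]
      exact hact _ _ (hcomp (a := pow t 2) _ _ (hgen _)
        (Fin.forall_fin_two.2 ⟨hgen _, ih _ _ fun _ _ => Iff.rfl⟩))
  rw [← x.act_unsort]
  exact hact _ _ (h _ _ _ x.ordered_sort)

/-! ### The morphism from `O_C` to an operad that satisfies the relations. -/

namespace RelModel

variable {P : Operad C} (M : RelModel P)

theorem prod_arrows_fst {t : C} {c : Profile C} (x : OpElt t c) : (M.prod x.arrows).1 = c := by
  rw [prod_fst]
  refine eq_of_hom (Profile.Hom.mk (finCongr List.length_ofFn.symm) fun i => ?_) fun _ => rfl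
  exact (congrArg Sigma.fst (List.get_ofFn x.arrow (finCongr List.length_ofFn.symm i))).symm

/-- The value at `(e, f)` of the morphism `O_C ⟶ P`, where `f` is the family of morphisms of `x`. -/
def orderedEval {t : C} {c : Profile C} (x : OpElt t c) : (P.seq t).obj c :=
  (P.seq t).map (eqToHom (M.prod_arrows_fst x)) (M.prod x.arrows).2

theorem elt_orderedEval {t : C} {c : Profile C} (x : OpElt t c) :
    (⟨c, M.orderedEval x⟩ : P.Elt t) = M.prod x.arrows :=
  elt_map_eqToHom _ _

/-- A morphism that fixes all positions forces its two profiles to be equal and is then the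
identity. It occurs in comparisons of sorted forms whose profiles are only propositionally equal. -/
theorem orderedEval_act {t : C} {c d : Profile C} (τ : c ⟶ d) (hτ : ∀ i, (τ.equiv i : ℕ) = i)
    (x : OpElt t c) : M.orderedEval (OpElt.act τ x) = (P.seq t).map τ (M.orderedEval x) := by
  obtain rfl := eq_of_hom τ hτ
  obtain rfl : τ = 𝟙 c := hom_ext hτ
  rw [OpElt.act_id]
  exact (Functor.map_id_apply (P.seq t) c _).symm

/-- The map `O_C ⟶ P` that extends the interpretation of the generators. -/
def eval {t : C} {c : Profile C} (x : OpElt t c) : (P.seq t).obj c :=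
  (P.seq t).map x.unsort (M.orderedEval x.sort)

/-- Sorting undoes `σ`, so `x` and its image under `σ` have the same sorted form up to an equality
of profiles; only the unsorting permutation changes. -/
theorem eval_act {t : C} {c d : Profile C} (σ : c ⟶ d) (x : OpElt t c) :
    M.eval (OpElt.act σ x) = (P.seq t).map σ (M.eval x) := by
  let x' := OpElt.act σ x
  -- From the sorted `x` back to `x`, then along `σ`, then to the sorted image. The underlying
  -- permutation is trivial, because the permutation of `x'` is that of `x` after `σ`.
  let τ : c.perm x.perm.symm ⟶ d.perm x'.perm.symm :=
    x.unsort ≫ σ ≫ d.permHom x'.perm.symm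
  have hx : x'.sort = OpElt.act τ x.sort := by
    rw [OpElt.act_act, OpElt.act_act, OpElt.act_unsort]
    rfl
  have hτ : ∀ i, (τ.equiv i : ℕ) = i := fun i =>
    congrArg Fin.val (x'.perm.apply_symm_apply i)
  have h : τ ≫ x'.unsort = x.unsort ≫ σ := by
    rw [Category.assoc, Category.assoc, OpElt.permHom_unsort, Category.comp_id]
  rw [eval, eval, hx, M.orderedEval_act τ hτ]
  refine (Functor.map_comp_apply (P.seq t) τ x'.unsort _).symm.trans ?_
  rw [h]
  exact Functor.map_comp_apply (P.seq t) _ _ _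

theorem eval_of_ordered {t : C} {c : Profile C} {x : OpElt t c} (hx : x.Ordered) :
    M.eval x = M.orderedEval x := by
  have hv : ∀ i, ((c.permHom x.perm.symm).equiv i : ℕ) = i := fun i =>
    congrArg Fin.val ((Equiv.symm_apply_eq _).2 (hx.perm_val i).symm)
  rw [eval, OpElt.sort, M.orderedEval_act _ hv]
  refine (Functor.map_comp_apply (P.seq t) _ x.unsort _).symm.trans ?_
  rw [OpElt.permHom_unsort]
  exact Functor.map_id_apply (P.seq t) c _

/-- The form used in computations: on ordered elements `eval` is the product in the monoid `P.Elt
t`. -/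
theorem elt_eval {t : C} {c : Profile C} {x : OpElt t c} (hx : x.Ordered) :
    (⟨c, M.eval x⟩ : P.Elt t) = M.prod x.arrows := by
  rw [M.eval_of_ordered hx, elt_orderedEval]

theorem eval_gen {t : C} {c : Profile C} (x : Gen C t c) : M.eval x.toOC = M.gen x := by
  refine elt_ext ((M.elt_eval (Gen.toOC_ordered x)).trans ?_)
  cases x with
  | unit t => rfl
  | mor f => exact M.prod_singleton ⟨_, f⟩
  | mul t => exact (congrArg (M.mul _) (M.prod_singleton _)).trans M.mul_id

/-- In `O_C` the operadic unit is the image of the generator `id_t`, and `P` satisfies the relation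
`𝟙 = id_t`. -/
theorem eval_unit (t : C) : M.eval (OpElt.unit t) = P.unit t :=
  (M.eval_gen (.mor (𝟙 t))).trans (M.gen_id t)

/-- The operations `x` such that `eval` preserves compositions `γ(x ⊗ y₁ ⊗ ⋯ ⊗ yₙ)`. -/
def CompEval {t : C} {a : Profile C} (x : OpElt t a) : Prop :=
  ∀ (b : Fin a.n → Profile C) (y : ∀ i, OpElt (a.color i) (b i)),
    M.eval (OpElt.comp x y) = P.comp (M.eval x) fun i => M.eval (y i)

/-- Each `y i` is a permutation applied to its sorted form. Equivariance in the inner operations, in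
`O_C` and in `P`, moves these permutations outside. -/
theorem compEval_of_ordered {t : C} {a : Profile C} {x : OpElt t a}
    (h : ∀ {b : Fin a.n → Profile C} (y : ∀ i, OpElt (a.color i) (b i)), (∀ i, (y i).Ordered) →
      M.eval (OpElt.comp x y) = P.comp (M.eval x) fun i => M.eval (y i)) : M.CompEval x := by
  intro b y
  have hy : y = fun i => OpElt.act (y i).unsort (y i).sort :=
    funext fun i => (y i).act_unsort.symm
  have h1 : OpElt.comp x y = _ :=
    (congrArg (OpElt.comp x) hy).trans (OpElt.act_comp_map x (fun i => (y i).sort) _)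
  have h2 : (fun i => M.eval (y i)) =
      fun i => (P.seq (a.color i)).map (y i).unsort (M.eval (y i).sort) := funext fun i =>
    (congrArg M.eval (congrFun hy i)).trans (M.eval_act _ _)
  rw [h1, h2, eval_act, h _ fun i => (y i).ordered_sort]
  exact (P.comp_map _ _ _).symm

/-- Equivariance in the outer operation. -/
theorem compEval_act {t : C} {a d : Profile C} (σ : a ⟶ d) {x : OpElt t a} (hx : M.CompEval x) :
    M.CompEval (OpElt.act σ x) := by
  -- The axiom `comp_perm` speaks of `permHom` only. Taking the profiles apart makes `σ` a genuine
  -- permutation and `d` literally the permuted profile.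
  obtain ⟨n, a⟩ := a
  obtain ⟨m, d⟩ := d
  obtain ⟨σ, hσ⟩ := σ
  obtain rfl : m = n := Fin.equiv_iff_eq.1 ⟨σ⟩
  change Equiv.Perm (Fin m) at σ
  obtain rfl : d = fun i => a (σ i) := funext hσ
  intro b y
  -- The inner operations are indexed by the inputs of `d`. The axiom needs them as a family over
  -- the inputs of `a` precomposed with `σ`.
  obtain ⟨b, rfl⟩ : ∃ b', b = fun i => b' (σ i) :=
    ⟨fun i => b (σ.symm i), funext fun i => congrArg b (σ.symm_apply_apply i).symm⟩
  obtain ⟨y, rfl⟩ : ∃ y' : ∀ i, OpElt (a i) (b i), y = fun i => y' (σ i) :=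
    ⟨Equiv.piCongrLeft (fun i => OpElt (a i) (b i)) σ y, funext fun i =>
      (Equiv.piCongrLeft_apply_apply (fun i => OpElt (a i) (b i)) σ y i).symm⟩
  refine (congrArg M.eval (OpElt.act_comp_perm (a := ⟨m, a⟩) x y σ)).trans
    ((M.eval_act _ _).trans ?_)
  rw [hx _ y]
  refine (P.comp_perm (a := ⟨m, a⟩) _ _ σ).symm.trans ?_
  exact congrArg (fun z => P.comp (a := ⟨m, fun i => a (σ i)⟩) z fun i => M.eval (y (σ i)))
    (M.eval_act (Profile.permHom ⟨m, a⟩ σ) x).symm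

/-- Associativity rewrites `γ(γ(x; y); z)` as `γ(x; γ(yᵢ; zᵢ))`, where only `x` and the `yᵢ` are
outer operations. -/
theorem compEval_comp {t : C} {a : Profile C} {b : Fin a.n → Profile C} {x : OpElt t a}
    {y : ∀ i, OpElt (a.color i) (b i)} (hx : M.CompEval x) (hy : ∀ i, M.CompEval (y i)) :
    M.CompEval (OpElt.comp x y) := by
  intro c z
  let e := concatEquiv b
  -- Families over the positions of the concatenation become families over pairs (block, place), as
  -- the associativity axiom requires.
  obtain ⟨c, rfl⟩ : ∃ c' : ∀ i, Fin (b i).n → Profile C,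
      c = fun p => c' (e.symm p).1 (e.symm p).2 :=
    ⟨fun i j => c (e ⟨i, j⟩), funext fun p => congrArg c (e.apply_symm_apply p).symm⟩
  let A : (Σ i, Fin (b i).n) → Type u := fun s => OpElt ((b s.1).color s.2) (c s.1 s.2)
  obtain ⟨z, rfl⟩ : ∃ z' : ∀ i j, OpElt ((b i).color j) (c i j),
      z = fun p => z' (e.symm p).1 (e.symm p).2 :=
    ⟨fun i j => Equiv.piCongrLeft A e.symm z ⟨i, j⟩, funext fun p =>
      (Equiv.piCongrLeft_apply_apply A e.symm z p).symm⟩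
  refine map_eqToHom_injective (concat_concat c) ((M.eval_act _ _).symm.trans ?_)
  refine (congrArg M.eval (OpElt.act_assoc x y z)).trans ((hx _ _).trans ?_)
  rw [hx _ y]
  refine Eq.trans ?_ (P.assoc (M.eval x) (fun i => M.eval (y i)) fun i j => M.eval (z i j)).symm
  exact congrArg (P.comp (M.eval x)) (funext fun i => hy i _ (z i))

/-- With no inputs, the family of inner operations is empty and so agrees with the empty family of
units. The unit axiom applies on both sides. -/
theorem compEval_unit (t : C) : M.CompEval (Gen.unit t).toOC := by
  intro b y
  obtain rfl : (fun i => single ((pow t 0).color i)) = b := funext fun i => i.elim0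
  obtain rfl : (fun i => OpElt.unit ((pow t 0).color i)) = y := funext fun i => i.elim0
  refine map_eqToHom_injective (concat_single (pow t 0).color) ((M.eval_act _ _).symm.trans ?_)
  refine (congrArg M.eval (OpElt.act_comp_unit _)).trans ((P.comp_unit _).symm.trans ?_)
  exact congrArg (fun y => (P.seq t).map _ (P.comp (M.eval (Gen.unit t).toOC) y))
    (funext fun i : Fin 0 => i.elim0)

/-- For ordered inner operations both sides are push-forwards of a product, and `push_prod` compares
them. -/
theorem compEval_mor {s t : C} (f : s ⟶ t) : M.CompEval (Gen.mor f).toOC := by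
  refine M.compEval_of_ordered fun {b} y hy => elt_ext ?_
  change ∀ i : Fin 1, OpElt s (b i) at y
  refine (M.elt_eval (OpElt.Ordered.comp (Gen.toOC_ordered (.mor f)) hy)).trans ?_
  rw [OpElt.arrows_comp₁ (s := fun _ => s) (Gen.mor f).toOC y]
  refine (M.push_prod f _).symm.trans ?_
  rw [← M.elt_eval (hy 0)]
  refine (congrArg (compElt (M.gen (.mor f))) (a₂ := fun i : Fin 1 => ⟨b i, M.eval (y i)⟩)
    (funext fun i : Fin 1 => ?_)).trans ?_
  · rw [Subsingleton.elim i 0]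
  · rw [M.eval_gen]
    rfl

/-- The composite lists the morphisms of `y 0` and then those of `y 1`, so `prod_append` splits its
value. -/
theorem compEval_mul (t : C) : M.CompEval (Gen.mul t).toOC := by
  refine M.compEval_of_ordered fun {b} y hy => elt_ext ?_
  change ∀ i : Fin 2, OpElt t (b i) at y
  refine (M.elt_eval (OpElt.Ordered.comp (Gen.toOC_ordered (.mul t)) hy)).trans ?_
  rw [OpElt.arrows_comp₂ (s := fun _ => t) (Gen.mul t).toOC y]
  refine (congrArg M.prod (congrArg₂ (· ++ ·) (OpElt.postcomp_id (t := t) _)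
    (OpElt.postcomp_id (t := t) _))).trans ((M.prod_append _ _).trans ?_)
  rw [← M.elt_eval (hy 0), ← M.elt_eval (hy 1)]
  refine (congrArg (compElt (M.gen (.mul t))) (a₂ := fun i : Fin 2 => ⟨b i, M.eval (y i)⟩)
    (funext fun i : Fin 2 => ?_)).trans ?_
  · fin_cases i <;> rfl
  · rw [M.eval_gen]
    rfl

/-- The admissible outer operations contain the generators and are closed under permutations and
composition. -/
theorem compEval {t : C} {a : Profile C} (x : OpElt t a) : M.CompEval x := by
  refine OpElt.gen_induction (S := fun x => M.CompEval x) (fun x => ?_)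
    (fun σ x => M.compEval_act σ) (fun x y => M.compEval_comp) x
  cases x with
  | unit => exact M.compEval_unit _
  | mor f => exact M.compEval_mor f
  | mul => exact M.compEval_mul _

/-- The morphism `O_C ⟶ P` that extends the interpretation of the generators. -/
def desc : OC C ⟶ P :=
  Operad.Hom.mk
    (fun _ =>
      { app := fun _ => ↾M.eval
        naturality := fun _ _ σ => ConcreteCategory.hom_ext _ _ fun x => M.eval_act σ x })
    M.eval_unit (fun x y => M.compEval x _ y)

end RelModel

end Models

/-! ### Morphisms of operads over a map of colors. -/

section Transport

variable {C D : Type u} {f : C → D} {P : Operad C} {Q : Operad D} (φ : P ⟶ Q.pullback f)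

/-- The map of operations given by a morphism of operads over a map of colors. -/
def Operad.mapOp {t : C} {c : Profile C} (x : (P.seq t).obj c) : (Q.seq (f t)).obj (c.map f) :=
  (φ.toHom t).app c x

/-- `Operad.mapOp` for operations with arbitrary inputs. -/
def Operad.mapElt {t : C} (x : P.Elt t) : Q.Elt (f t) := ⟨x.1.map f, mapOp φ x.2⟩

theorem Operad.mapElt_compElt {t : C} {a : Profile C} (x : (P.seq t).obj a)
    (y : ∀ i, P.Elt (a.color i)) :
    mapElt φ (compElt x y) = compElt (a := a.map f) (mapOp φ x) fun i => mapElt φ (y i) :=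
  congrArg (Sigma.mk _) (φ.map_comp x fun i => (y i).2)

theorem Operad.mapElt_mulElt {t s : C} (m : (P.seq t).obj (pow s 2)) (y z : P.Elt s) :
    mapElt φ (mulElt m y z) = mulElt (mapOp φ m) (mapElt φ y) (mapElt φ z) :=
  (mapElt_compElt φ m _).trans
    (congrArg (compElt (mapOp φ m)) (funext fun i : Fin 2 => by fin_cases i <;> rfl))

theorem Operad.mapOp_map {t : C} {c d : Profile C} (σ : c ⟶ d) (x : (P.seq t).obj c) :
    mapOp φ ((P.seq t).map σ x) =
      (Q.seq (f t)).map ((Profile.mapFunctor f).map σ) (mapOp φ x) :=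
  ConcreteCategory.congr_hom ((φ.toHom t).naturality σ) x

theorem Operad.mapOp_comp₁ {t s : C} {b : Profile C} (x : (P.seq t).obj (single s))
    (y : (P.seq s).obj b) : mapOp φ (P.comp₁ x y) = Q.comp₁ (mapOp φ x) (mapOp φ y) :=
  elt_ext ((congrArg (mapElt φ) (elt_comp₁ x y)).trans
    ((mapElt_compElt φ x _).trans (elt_comp₁ _ _).symm))

/-- The hypotheses on `x` and `y` are equations in `Elt`, so `b'` may be any family whose two
members fit. This allows it to be the literal vector in the definition of the target relation, which
need not be definitionally the image of `b`. -/
theorem Operad.mapOp_comp₂ {t s : C} {b : Fin 2 → Profile C} {d : Profile C} (h : concat b = d)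
    (m : (P.seq t).obj (pow s 2)) (x : (P.seq s).obj (b 0)) (y : (P.seq s).obj (b 1))
    {b' : Fin 2 → Profile D} (h' : concat b' = d.map f) {m' : (Q.seq (f t)).obj (pow (f s) 2)}
    {x' : (Q.seq (f s)).obj (b' 0)} {y' : (Q.seq (f s)).obj (b' 1)}
    (hm : mapOp φ m = m')
    (hx : mapElt φ ⟨b 0, x⟩ = ⟨b' 0, x'⟩) (hy : mapElt φ ⟨b 1, y⟩ = ⟨b' 1, y'⟩) :
    mapOp φ (P.comp₂ h m x y) = Q.comp₂ h' m' x' y' := by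
  subst hm
  exact elt_ext ((congrArg (mapElt φ) (elt_comp₂ h m x y)).trans
    ((mapElt_mulElt φ m _ _).trans ((congrArg₂ (mulElt (mapOp φ m)) hx hy).trans
      (elt_comp₂ h' _ _ _).symm)))

theorem Operad.mapElt_unit (t : C) :
    mapElt φ ⟨single t, P.unit t⟩ = ⟨single (f t), Q.unit (f t)⟩ :=
  congrArg (Sigma.mk _) (φ.map_unit t)

end Transport

/-! ### Relations are carried to relations. -/

section Relations

variable {C D : Type u} [SmallCategory C] [SmallCategory D] {F : C ⥤ D} {P : Operad C}
  {Q : Operad D} (φ : P ⟶ Q.pullback F.obj)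
  {g : ∀ {t : C} {c : Profile C}, Gen C t c → (P.seq t).obj c}
  {g' : ∀ {t : D} {c : Profile D}, Gen D t c → (Q.seq t).obj c}

/-- A side of a relation is an operadic expression in the generators, and morphisms preserve such
expressions. Arbitrary `P` and `Q` serve two purposes: free operads over a functor for naturality,
and the identity functor for the universal properties. -/
theorem FunRel.mapOp_lhs
    (hg : ∀ {t : C} {c : Profile C} (x : Gen C t c), mapOp φ (g x) = g' (x.map F))
    {t : C} {c : Profile C} (r : FunRel C t c) :
    mapOp φ (r.lhs P g) = (r.map F).lhs Q g' := by
  cases r with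
  | comp f f' => exact (mapOp_comp₁ φ _ _).trans (congrArg₂ Q.comp₁ (hg (.mor f)) (hg (.mor f')))
  | id => exact φ.map_unit _

/-- Among the relations only these right-hand sides contain composites and identities of `C` as
generators, so the functor laws of `F` enter here. -/
theorem FunRel.mapOp_rhs
    (hg : ∀ {t : C} {c : Profile C} (x : Gen C t c), mapOp φ (g x) = g' (x.map F))
    {t : C} {c : Profile C} (r : FunRel C t c) :
    mapOp φ (r.rhs P g) = (r.map F).rhs Q g' := by
  cases r with
  | comp f f' => exact (hg (.mor (f' ≫ f))).trans (congrArg (fun h => g' (.mor h)) (F.map_comp f' f))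
  | id t => exact (hg (.mor (𝟙 t))).trans (congrArg (fun h => g' (.mor h)) (F.map_id t))

theorem MonRel.mapOp_lhs
    (hg : ∀ {t : C} {c : Profile C} (x : Gen C t c), mapOp φ (g x) = g' (x.map F))
    {t : C} {c : Profile C} (r : MonRel C t c) :
    mapOp φ (r.lhs P g) = (r.map F).lhs Q g' := by
  have hu := mapElt_unit φ t
  have h1 : mapElt φ ⟨pow t 0, g (.unit t)⟩ = ⟨pow (F.obj t) 0, g' (.unit (F.obj t))⟩ :=
    congrArg (Sigma.mk _) (hg (.unit t))
  have hm : mapElt φ ⟨pow t 2, g (.mul t)⟩ = ⟨pow (F.obj t) 2, g' (.mul (F.obj t))⟩ :=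
    congrArg (Sigma.mk _) (hg (.mul t))
  cases r with
  | left =>
    exact mapOp_comp₂ φ (b := ![pow t 0, single t]) _ _ _ _
      (b' := ![pow (F.obj t) 0, single (F.obj t)]) _ (hg (.mul t)) h1 hu
  | right =>
    exact mapOp_comp₂ φ (b := ![single t, pow t 0]) _ _ _ _
      (b' := ![single (F.obj t), pow (F.obj t) 0]) _ (hg (.mul t)) hu h1
  | assoc =>
    exact mapOp_comp₂ φ (b := ![pow t 2, single t]) _ _ _ _
      (b' := ![pow (F.obj t) 2, single (F.obj t)]) _ (hg (.mul t)) hm hu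

theorem MonRel.mapOp_rhs
    (hg : ∀ {t : C} {c : Profile C} (x : Gen C t c), mapOp φ (g x) = g' (x.map F))
    {t : C} {c : Profile C} (r : MonRel C t c) :
    mapOp φ (r.rhs P g) = (r.map F).rhs Q g' := by
  have hu := mapElt_unit φ t
  have hm : mapElt φ ⟨pow t 2, g (.mul t)⟩ = ⟨pow (F.obj t) 2, g' (.mul (F.obj t))⟩ :=
    congrArg (Sigma.mk _) (hg (.mul t))
  cases r with
  | left => exact φ.map_unit t
  | right => exact φ.map_unit t
  | assoc =>
    exact mapOp_comp₂ φ (b := ![single t, pow t 2]) _ _ _ _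
      (b' := ![single (F.obj t), pow (F.obj t) 2]) _ (hg (.mul t)) hu hm

theorem FMRel.mapOp_lhs
    (hg : ∀ {t : C} {c : Profile C} (x : Gen C t c), mapOp φ (g x) = g' (x.map F))
    {t : C} {c : Profile C} (r : FMRel C t c) :
    mapOp φ (r.lhs P g) = (r.map F).lhs Q g' := by
  cases r with
  | unit f => exact (mapOp_comp₁ φ _ _).trans (congrArg₂ Q.comp₁ (hg (.mor f)) (hg (.unit _)))
  | mul f => exact (mapOp_comp₁ φ _ _).trans (congrArg₂ Q.comp₁ (hg (.mor f)) (hg (.mul _)))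

theorem FMRel.mapOp_rhs
    (hg : ∀ {t : C} {c : Profile C} (x : Gen C t c), mapOp φ (g x) = g' (x.map F))
    {t : C} {c : Profile C} (r : FMRel C t c) :
    mapOp φ (r.rhs P g) = (r.map F).rhs Q g' := by
  cases r with
  | unit f =>
    -- The empty profiles `pow t 0` and `pow c 0` are identified by a transport, which disappears in
    -- `Elt`.
    refine elt_ext ((congrArg (mapElt φ) (elt_map_eqToHom _ (g (.unit t)))).trans ?_)
    exact (congrArg (Sigma.mk _) (hg (.unit t))).trans (elt_map_eqToHom _ _).symm
  | @mul c _ f =>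
    exact mapOp_comp₂ φ (b := fun _ => single c) _ _ _ _
      (b' := fun _ => single (F.obj c)) _ (hg (.mul t)) (congrArg (Sigma.mk _) (hg (.mor f)))
      (congrArg (Sigma.mk _) (hg (.mor f)))

theorem Rel.mapOp_lhs
    (hg : ∀ {t : C} {c : Profile C} (x : Gen C t c), mapOp φ (g x) = g' (x.map F))
    {t : C} {c : Profile C} (r : Rel C t c) :
    mapOp φ (Rel.lhs P g r) = Rel.lhs Q g' (Rel.map F r) :=
  match r with
  | .inl r => r.mapOp_lhs φ hg
  | .inr (.inl r) => r.mapOp_lhs φ hg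
  | .inr (.inr r) => r.mapOp_lhs φ hg

theorem Rel.mapOp_rhs
    (hg : ∀ {t : C} {c : Profile C} (x : Gen C t c), mapOp φ (g x) = g' (x.map F))
    {t : C} {c : Profile C} (r : Rel C t c) :
    mapOp φ (Rel.rhs P g r) = Rel.rhs Q g' (Rel.map F r) :=
  match r with
  | .inl r => r.mapOp_rhs φ hg
  | .inr (.inl r) => r.mapOp_rhs φ hg
  | .inr (.inr r) => r.mapOp_rhs φ hg

variable {O : Orthogonality C} {O' : Orthogonality D} (hF : Orthogonality.Preserves F O O')

theorem OrthRel.mapOp_lhs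
    (hg : ∀ {t : C} {c : Profile C} (x : Gen C t c), mapOp φ (g x) = g' (x.map F))
    {t : C} {c : Profile C} (r : OrthRel O t c) :
    mapOp φ (r.lhs P g) = (r.map hF).lhs Q g' := by
  obtain ⟨c, f, h⟩ := r
  exact mapOp_comp₂ φ (b := fun i => single (c i)) _ _ _ _
    (b' := fun i => single (F.obj (c i))) _ (hg (.mul t))
    (congrArg (Sigma.mk _) (hg (.mor (f 0)))) (congrArg (Sigma.mk _) (hg (.mor (f 1))))

theorem OrthRel.mapOp_rhs
    (hg : ∀ {t : C} {c : Profile C} (x : Gen C t c), mapOp φ (g x) = g' (x.map F))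
    {t : C} {c : Profile C} (r : OrthRel O t c) :
    mapOp φ (r.rhs P g) = (r.map hF).rhs Q g' := by
  obtain ⟨c, f, h⟩ := r
  refine (mapOp_map φ _ _).trans (congrArg ((Q.seq (F.obj t)).map _) ?_)
  exact mapOp_comp₂ φ (b := fun i => single (c (Equiv.swap 0 1 i))) _ _ _ _
    (b' := fun i => single (F.obj (c (Equiv.swap 0 1 i)))) _ (hg (.mul t))
    (congrArg (Sigma.mk _) (hg (.mor (f 1)))) (congrArg (Sigma.mk _) (hg (.mor (f 0))))

theorem RelPerp.mapOp_lhs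
    (hg : ∀ {t : C} {c : Profile C} (x : Gen C t c), mapOp φ (g x) = g' (x.map F))
    {t : C} {c : Profile C} (r : RelPerp O t c) :
    mapOp φ (RelPerp.lhs P g r) = RelPerp.lhs Q g' (RelPerp.map hF r) :=
  match r with
  | .inl r => Rel.mapOp_lhs φ hg r
  | .inr r => r.mapOp_lhs φ hF hg

theorem RelPerp.mapOp_rhs
    (hg : ∀ {t : C} {c : Profile C} (x : Gen C t c), mapOp φ (g x) = g' (x.map F))
    {t : C} {c : Profile C} (r : RelPerp O t c) :
    mapOp φ (RelPerp.rhs P g r) = RelPerp.rhs Q g' (RelPerp.map hF r) :=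
  match r with
  | .inl r => Rel.mapOp_rhs φ hg r
  | .inr r => r.mapOp_rhs φ hF hg

end Relations

/-! ### Preservation of the relations over a fixed set of colors, as the case of the identity
functor. -/

section Fixed

variable {C : Type u} [SmallCategory C] {P Q : Operad C}

/-- A morphism of operads as a morphism over the identity functor. -/
def Operad.Hom.overId (φ : P ⟶ Q) : P ⟶ Q.pullback (𝟭 C).obj :=
  ((ColoredOperad.fibre C).map φ).toOperad

theorem Gen.map_id {t : C} {c : Profile C} (x : Gen C t c) : x.map (𝟭 C) = x := by
  cases x <;> rfl

theorem Rel.map_id {t : C} {c : Profile C} (x : Rel C t c) : Rel.map (𝟭 C) x = x := by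
  rcases x with x | x | x <;> cases x <;> rfl

theorem RelPerp.map_id {O : Orthogonality C} {t : C} {c : Profile C} (x : RelPerp O t c) :
    RelPerp.map (F := 𝟭 C) (O' := O) (fun _ _ h => h) x = x := by
  rcases x with (x | x | x) | x <;> cases x <;> rfl

variable (φ : P ⟶ Q) {g : ∀ {t : C} {c : Profile C}, Gen C t c → (P.seq t).obj c}
  {g' : ∀ {t : C} {c : Profile C}, Gen C t c → (Q.seq t).obj c}

theorem RelPerp.app_lhs {O : Orthogonality C}
    (hg : ∀ {t : C} {c : Profile C} (x : Gen C t c), (φ.toHom t).app c (g x) = g' x)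
    {t : C} {c : Profile C} (r : RelPerp O t c) :
    (φ.toHom t).app c (RelPerp.lhs P g r) = RelPerp.lhs Q g' r :=
  (RelPerp.mapOp_lhs (F := 𝟭 C) (O' := O) φ.overId (fun _ _ h => h)
    (fun x => (hg x).trans (congrArg g' x.map_id.symm)) r).trans
      (congrArg (RelPerp.lhs Q g') (RelPerp.map_id r))

theorem RelPerp.app_rhs {O : Orthogonality C}
    (hg : ∀ {t : C} {c : Profile C} (x : Gen C t c), (φ.toHom t).app c (g x) = g' x)
    {t : C} {c : Profile C} (r : RelPerp O t c) :
    (φ.toHom t).app c (RelPerp.rhs P g r) = RelPerp.rhs Q g' r :=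
  (RelPerp.mapOp_rhs (F := 𝟭 C) (O' := O) φ.overId (fun _ _ h => h)
    (fun x => (hg x).trans (congrArg g' x.map_id.symm)) r).trans
      (congrArg (RelPerp.rhs Q g') (RelPerp.map_id r))

theorem Rel.app_lhs
    (hg : ∀ {t : C} {c : Profile C} (x : Gen C t c), (φ.toHom t).app c (g x) = g' x)
    {t : C} {c : Profile C} (r : Rel C t c) :
    (φ.toHom t).app c (Rel.lhs P g r) = Rel.lhs Q g' r :=
  (Rel.mapOp_lhs (F := 𝟭 C) φ.overId
    (fun x => (hg x).trans (congrArg g' x.map_id.symm)) r).trans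
      (congrArg (Rel.lhs Q g') (Rel.map_id r))

theorem Rel.app_rhs
    (hg : ∀ {t : C} {c : Profile C} (x : Gen C t c), (φ.toHom t).app c (g x) = g' x)
    {t : C} {c : Profile C} (r : Rel C t c) :
    (φ.toHom t).app c (Rel.rhs P g r) = Rel.rhs Q g' r :=
  (Rel.mapOp_rhs (F := 𝟭 C) φ.overId
    (fun x => (hg x).trans (congrArg g' x.map_id.symm)) r).trans
      (congrArg (Rel.rhs Q g') (Rel.map_id r))

end Fixed

/-! ### The universal property of `q`. -/

section OC

variable {C : Type u} [SmallCategory C] {P : Operad C}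

/-- The elements on which two morphisms agree are closed under permutations and composition, so
agreement on the generators is enough. -/
theorem OC.hom_ext {f f' : OC C ⟶ P}
    (h : ∀ {t : C} {c : Profile C} (x : Gen C t c),
      (f.toHom t).app c x.toOC = (f'.toHom t).app c x.toOC) : f = f' := by
  refine Operad.hom_ext fun t c x => ?_
  refine OpElt.gen_induction
    (S := fun {t c} x => (f.toHom t).app c x = (f'.toHom t).app c x) h ?_ ?_ x
  · intro t c d σ x hx
    exact (ConcreteCategory.congr_hom ((f.toHom t).naturality σ) x).trans
      ((congrArg ((P.seq t).map σ) hx).trans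
        (ConcreteCategory.congr_hom ((f'.toHom t).naturality σ) x).symm)
  · intro t a b x y hx hy
    exact (f.map_comp x y).trans ((congrArg₂ P.comp hx (funext hy)).trans (f'.map_comp x y).symm)

theorem q_ι {t : C} {c : Profile C} (x : Gen C t c) :
    ((q C).toHom t).app c (freeOn.ι x) = x.toOC :=
  freeOn.desc_ι (OC C) Gen.toOC x

/-- The uniqueness half of the universal property: `q` reaches all generators of `O_C`. -/
theorem q_comp_ext {f f' : OC C ⟶ P} (h : q C ≫ f = q C ≫ f') : f = f' := by
  refine OC.hom_ext fun {t c} x => ?_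
  rw [← q_ι]
  exact congrArg (fun k : freeOn (Gen C) ⟶ P => (k.toHom t).app c (freeOn.ι x)) h

theorem q_comp_desc (h : freeOn (Gen C) ⟶ P) (M : RelModel P)
    (hM : ∀ {t : C} {c : Profile C} (x : Gen C t c), M.gen x = (h.toHom t).app c (freeOn.ι x)) :
    q C ≫ M.desc = h := by
  refine freeOn.hom_ext fun t c x => ?_
  refine (congrArg ((M.desc.toHom t).app c) (q_ι x)).trans ((M.eval_gen x).trans (hM x))

theorem r_comp {h : freeOn (Gen C) ⟶ P}
    (w : ∀ {t : C} {c : Profile C} (r : Rel C t c),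
      (h.toHom t).app c (Rel.lhs _ freeOn.ι r) = (h.toHom t).app c (Rel.rhs _ freeOn.ι r)) :
    r₁ C ≫ h = r₂ C ≫ h :=
  freeOn.hom_ext fun t c r =>
    (congrArg ((h.toHom t).app c) (freeOn.desc_ι _ _ r)).trans ((w r).trans
      (congrArg ((h.toHom t).app c) (freeOn.desc_ι _ _ r)).symm)

theorem r_comp_q : r₁ C ≫ q C = r₂ C ≫ q C :=
  r_comp fun r => (Rel.app_lhs (q C) (g' := Gen.toOC) q_ι r).trans ((OC.relModel.rel r).trans
    (Rel.app_rhs (q C) (g' := Gen.toOC) q_ι r).symm)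

/-- A morphism out of `F(G_C^sym)` that identifies both sides of the relations. -/
noncomputable def RelModel.ofHom (h : freeOn (Gen C) ⟶ P) (w : r₁ C ≫ h = r₂ C ≫ h) :
    RelModel P where
  gen {t c} x := (h.toHom t).app c (freeOn.ι x)
  rel {t c} r := by
    refine (Rel.app_lhs h (fun _ => rfl) r).symm.trans
      (Eq.trans ?_ (Rel.app_rhs h (fun _ => rfl) r))
    refine (congrArg ((h.toHom t).app c) (freeOn.desc_ι _ _ r)).symm.trans (Eq.trans ?_
      (congrArg ((h.toHom t).app c) (freeOn.desc_ι _ _ r)))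
    exact congrArg (fun k : freeOn (Rel C) ⟶ P => (k.toHom t).app c (freeOn.ι r)) w

/-- The existence half: a morphism that equalizes `r₁` and `r₂` is the same as a model of the
relations. -/
theorem exists_desc_q (h : freeOn (Gen C) ⟶ P) (w : r₁ C ≫ h = r₂ C ≫ h) :
    ∃ k : OC C ⟶ P, q C ≫ k = h :=
  ⟨(RelModel.ofHom h w).desc, q_comp_desc h _ fun _ => rfl⟩

end OC

/-! ### The universal property of the quotient `O_(C,⊥)`. -/

section Perp

variable {C : Type u} [SmallCategory C] {P : Operad C} (O : Orthogonality C)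

/-- Composition with `(e, (id, …, id))` leaves the morphisms unchanged and keeps the blocks in
order. Hence it assembles any element whose permutation preserves the blocks from its restrictions
to them. -/
theorem OpElt.eq_act_comp {t : C} {c : Profile C} {m : ℕ} {b : Fin m → Profile C}
    (h : concat b = c) (x : OpElt t c) (y : ∀ i, OpElt t (b i))
    (hx : ∀ i j, x.arrow (Fin.cast (congrArg Profile.n h) (concatEquiv b ⟨i, j⟩)) =
      (y i).arrow j)
    (hx' : ∀ i j, x.perm (Fin.cast (congrArg Profile.n h) (concatEquiv b ⟨i, j⟩)) =
      Fin.cast (congrArg Profile.n h) (concatEquiv b ⟨i, (y i).perm j⟩)) :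
    x = act (eqToHom h) (comp (a := pow t m) ⟨Equiv.refl _, fun _ => 𝟙 t⟩ y) := by
  subst h
  refine Eq.trans ?_ (act_id _).symm
  refine comp_ext (fun p p' => ?_) fun p => ?_
  · obtain ⟨i, j⟩ := p
    obtain ⟨i', j'⟩ := p'
    refine (iff_of_eq (congrArg₂ (· < ·) (hx' i j) (hx' i' j'))).trans
      (((concat_lt b _ _).trans Sigma.lex_iff).trans
        (Iff.trans ?_ (comp_lt (a := pow t m) _ y i j i' j').symm))
    refine or_congr Iff.rfl ⟨?_, ?_⟩
    · rintro ⟨h, h'⟩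
      change i = i' at h
      subst h
      exact ⟨rfl, h'⟩
    · rintro ⟨rfl, h'⟩
      exact ⟨rfl, h'⟩
  · refine (hx p.1 p.2).trans (Eq.trans ?_ (comp_arrow (a := pow t m) _ y p).symm)
    exact congrArg (Sigma.mk _) (Category.comp_id _).symm

/-- The profile is cut into the entries before the pair, the pair, and the entries after it. Both
elements are composites of `(e, (id, id, id))` with three blocks. They differ only in the middle
block, where they are `s₁` and `s₂` of the orthogonal pair. -/
theorem app_swap_eq (k : OC C ⟶ P)
    (hk : ∀ {t : C} {c : Profile C} (r : OrthRel O t c),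
      (k.toHom t).app c r.s₁ = (k.toHom t).app c r.s₂)
    {t : C} {c : Profile C} (f : ∀ i, c.color i ⟶ t) {p p' : Fin c.n} (hp : (p : ℕ) + 1 = p')
    (hf : O.rel (f p) (f p')) :
    (k.toHom t).app c (⟨Equiv.refl _, f⟩ : OpElt t c) =
      (k.toHom t).app c (⟨Equiv.swap p p', f⟩ : OpElt t c) := by
  -- Lengths of the three blocks, followed by their starting positions; by `hpn` the subtraction is
  -- exact.
  let N : Fin 3 → ℕ := ![p, 2, c.n - (p + 2)]
  let o : Fin 3 → ℕ := ![0, p, p + 2]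
  have hpn : (p : ℕ) + 2 ≤ c.n := by have := p'.2; omega
  have hN : ∑ i, N i = c.n := by
    rw [Fin.sum_univ_three]
    change (p : ℕ) + 2 + (c.n - (p + 2)) = c.n
    omega
  have hι : ∀ (i : Fin 3) (j : Fin (N i)), o i + j < c.n := by
    intro i j
    have hj := j.2
    revert hj
    generalize (j : ℕ) = k
    match i with
    | 0 =>
      change k < (p : ℕ) → 0 + k < c.n
      omega
    | 1 =>
      change k < 2 → (p : ℕ) + k < c.n
      omega
    | 2 =>
      change k < c.n - (p + 2) → (p : ℕ) + 2 + k < c.n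
      omega
  let ι : ∀ i, Fin (N i) → Fin c.n := fun i j => ⟨o i + j, hι i j⟩
  let b : Fin 3 → Profile C := fun i => ⟨N i, fun j => c.color (ι i j)⟩
  -- The middle block again, with its index type displayed as `Fin 2` so that `0`, `1` and `swap 0
  -- 1` make sense.
  let ι₁ : Fin 2 → Fin c.n := ι 1
  have h0 : ι₁ 0 = p := rfl
  have h1 : ι₁ 1 = p' := Fin.ext hp
  have hb : ∀ i j, (concatEquiv b ⟨i, j⟩ : ℕ) = ι i j := by
    intro i j
    rw [concatEquiv, finSigmaFinEquiv_apply]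
    change _ = o i + j
    congr 1
    fin_cases i
    · rfl
    · exact Fin.sum_univ_one _
    · exact Fin.sum_univ_two _
  have h : concat b = c := Profile.concat_eq hN fun i j k hk' =>
    congrArg c.color (Fin.ext ((hb i j).symm.trans hk'.symm))
  have hcast : ∀ i j, Fin.cast (congrArg Profile.n h) (concatEquiv b ⟨i, j⟩) = ι i j :=
    fun i j => Fin.ext (hb i j)
  -- Only the middle block carries `τ`, which will be the identity or the transposition.
  let y (τ : Equiv.Perm (Fin 2)) : ∀ i, OpElt t (b i) := fun i =>
    ⟨match i with
      | 0 => Equiv.refl _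
      | 1 => τ
      | 2 => Equiv.refl _, fun j => f (ι i j)⟩
  have key : ∀ (π : Equiv.Perm (Fin c.n)) (τ : Equiv.Perm (Fin 2)),
      (∀ j, π (ι 0 j) = ι 0 j) → (∀ j, π (ι₁ j) = ι₁ (τ j)) → (∀ j, π (ι 2 j) = ι 2 j) →
      (⟨π, f⟩ : OpElt t c) = OpElt.act (eqToHom h)
        (OpElt.comp (a := pow t 3) ⟨Equiv.refl _, fun _ => 𝟙 t⟩ (y τ)) := by
    intro π τ e₀ e₁ e₂
    have e : ∀ i j, π (ι i j) = ι i ((y τ i).perm j) := fun i =>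
      match i with
      | 0 => e₀
      | 1 => e₁
      | 2 => e₂
    refine OpElt.eq_act_comp h _ _ (fun i j => ?_) fun i j => ?_
    · rw [hcast]
      rfl
    · exact (congrArg π (hcast i j)).trans ((e i j).trans (hcast _ _).symm)
  have hy : (fun i => (k.toHom t).app (b i) (y (Equiv.refl _) i)) =
      fun i => (k.toHom t).app (b i) (y (Equiv.swap 0 1) i) := by
    funext i
    match i with
    | 0 => rfl
    | 1 =>
      have hf' : O.rel (f (ι₁ 0)) (f (ι₁ 1)) := by
        rw [h0, h1]
        exact hf
      exact hk (OrthRel.mk (fun j => c.color (ι₁ j)) (fun j => f (ι₁ j)) hf')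
    | 2 => rfl
  have hs : ∀ (i : Fin 3) (j : Fin (N i)), i ≠ 1 → Equiv.swap p p' (ι i j) = ι i j := by
    intro i j hi
    have hj := j.2
    have hv : (ι i j : ℕ) ≠ p ∧ (ι i j : ℕ) ≠ p' := by
      change o i + j ≠ p ∧ o i + j ≠ p'
      revert hj
      generalize (j : ℕ) = l
      match i with
      | 0 =>
        change l < (p : ℕ) → 0 + l ≠ (p : ℕ) ∧ 0 + l ≠ (p' : ℕ)
        omega
      | 1 => exact absurd rfl hi
      | 2 =>
        change l < c.n - (p + 2) → (p : ℕ) + 2 + l ≠ (p : ℕ) ∧ (p : ℕ) + 2 + l ≠ (p' : ℕ)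
        omega
    exact Equiv.swap_apply_of_ne_of_ne (fun h => hv.1 (congrArg Fin.val h))
      fun h => hv.2 (congrArg Fin.val h)
  have hs1 : ∀ j : Fin 2, Equiv.swap p p' (ι₁ j) = ι₁ (Equiv.swap 0 1 j) := by
    refine Fin.forall_fin_two.2 ⟨?_, ?_⟩
    · rw [Equiv.swap_apply_left, h0, h1, Equiv.swap_apply_left]
    · rw [Equiv.swap_apply_right, h0, h1, Equiv.swap_apply_right]
  rw [key (Equiv.refl _) (Equiv.refl _) (fun _ => rfl) (fun _ => rfl) fun _ => rfl,
    key (Equiv.swap p p') (Equiv.swap 0 1) (fun j => hs 0 j (by decide)) hs1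
      fun j => hs 2 j (by decide)]
  refine (ConcreteCategory.congr_hom ((k.toHom t).naturality (eqToHom h)) _).trans (Eq.trans ?_
    (ConcreteCategory.congr_hom ((k.toHom t).naturality (eqToHom h)) _).symm)
  refine congrArg ((P.seq t).map (eqToHom h)) ?_
  exact (k.map_comp (a := pow t 3) (b := b) _ _).trans ((congrArg (P.comp _) hy).trans
    (k.map_comp (a := pow t 3) (b := b) _ _).symm)

/-- Equivariance reduces a step at `ρ` to one at the identity: `((ρ π)⁻¹, f)` is a permutation of
`(π⁻¹, f ρ)` that does not depend on `π`. The cases of `π` that matter are the identity and the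
transposition. -/
theorem app_eq_of_adjStep (k : OC C ⟶ P)
    (hk : ∀ {t : C} {c : Profile C} (r : OrthRel O t c),
      (k.toHom t).app c r.s₁ = (k.toHom t).app c r.s₂)
    {t : C} {c : Profile C} {f : ∀ i, c.color i ⟶ t} {ρ ρ' : Equiv.Perm (Fin c.n)}
    (h : OpElt.AdjStep O f ρ ρ') :
    (k.toHom t).app c (⟨ρ⁻¹, f⟩ : OpElt t c) = (k.toHom t).app c (⟨ρ'⁻¹, f⟩ : OpElt t c) := by
  obtain ⟨p, p', hp, ho, rfl⟩ := h
  let x : OpElt t c := ⟨ρ⁻¹, f⟩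
  have hx : ∀ π : Equiv.Perm (Fin c.n), (⟨(ρ * π)⁻¹, f⟩ : OpElt t c) =
      OpElt.act x.unsort (⟨π⁻¹, fun i => f (ρ i)⟩ : OpElt t (c.perm ρ)) := by
    intro π
    refine OpElt.ext_lt (fun i j => ?_) fun i => ?_
    · rw [OpElt.act_lt]
      rw [mul_inv_rev]
      rfl
    · refine Eq.trans ?_ (OpElt.act_arrow x.unsort _ i).symm
      exact congrArg (fun i => (⟨c.color i, f i⟩ : Σ s : C, (s ⟶ t)))
        (ρ.apply_symm_apply i).symm
  have h1 := hx 1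
  rw [mul_one] at h1
  rw [h1, hx]
  refine (ConcreteCategory.congr_hom ((k.toHom t).naturality x.unsort) _).trans (Eq.trans ?_
    (ConcreteCategory.congr_hom ((k.toHom t).naturality x.unsort) _).symm)
  refine congrArg ((P.seq t).map x.unsort) ?_
  rw [Equiv.swap_inv]
  exact app_swap_eq O k hk (c := c.perm ρ) (fun i => f (ρ i)) hp ho

theorem app_eq_of_perpRel (k : OC C ⟶ P)
    (hk : ∀ {t : C} {c : Profile C} (r : OrthRel O t c),
      (k.toHom t).app c r.s₁ = (k.toHom t).app c r.s₂)
    {t : C} {c : Profile C} {x y : OpElt t c} (h : OpElt.PerpRel O x y) :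
    (k.toHom t).app c x = (k.toHom t).app c y := by
  obtain ⟨hm, h⟩ := h
  have key : ∀ ρ, Relation.ReflTransGen (OpElt.AdjStep O x.mor) x.perm⁻¹ ρ →
      (k.toHom t).app c x = (k.toHom t).app c (⟨ρ⁻¹, x.mor⟩ : OpElt t c) := by
    intro ρ hρ
    induction hρ with
    | refl => rw [inv_inv]
    | tail _ hs ih => exact ih.trans (app_eq_of_adjStep O k hk hs)
  have := key _ h
  rw [inv_inv, hm] at this
  exact this

/-- The morphism `O_(C,⊥) ⟶ P` induced by a morphism `O_C ⟶ P` that satisfies the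
`⊥`-commutativity relations. -/
def OCPerp.desc (k : OC C ⟶ P)
    (hk : ∀ {t : C} {c : Profile C} (r : OrthRel O t c),
      (k.toHom t).app c r.s₁ = (k.toHom t).app c r.s₂) : OCPerp O ⟶ P :=
  Operad.Hom.mk
    (fun t =>
      { app := fun c => ↾Quotient.lift (s := perpSetoid O t c) (fun x => (k.toHom t).app c x)
          fun _ _ h => app_eq_of_perpRel O k hk h
        naturality := fun _ _ σ => ConcreteCategory.hom_ext _ _ fun x => by
          obtain ⟨x, rfl⟩ := Quotient.exists_rep x
          exact ConcreteCategory.congr_hom ((k.toHom t).naturality σ) x })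
    k.map_unit
    (fun {t a b} x y => by
      obtain ⟨x, rfl⟩ := Quotient.exists_rep x
      obtain ⟨y, rfl⟩ := exists_rep_family y
      exact (congrArg (Quotient.lift (s := perpSetoid O t (concat b))
        (fun x => (k.toHom t).app (concat b) x) fun _ _ h => app_eq_of_perpRel O k hk h)
          (perpComp_mk O x y)).trans (k.map_comp x y))

theorem projPerp_comp_ext {f f' : OCPerp O ⟶ P} (h : projPerp O ≫ f = projPerp O ≫ f') :
    f = f' := by
  refine Operad.hom_ext fun t c x => ?_
  obtain ⟨x, rfl⟩ := Quotient.exists_rep x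
  exact congrArg (fun k : OC C ⟶ P => (k.toHom t).app c x) h

variable {O}

theorem OrthRel.lhs_toOC {t : C} {c : Profile C} (r : OrthRel O t c) :
    r.lhs (OC C) Gen.toOC = r.s₁ := by
  obtain ⟨c, f, h⟩ := r
  refine OpElt.Ordered.ext (comp₂_OC_ordered (b := fun i => single (c i)) _
    (Gen.toOC_ordered (.mul t)) (Gen.toOC_ordered (.mor (f 0))) (Gen.toOC_ordered (.mor (f 1))))
    (fun _ _ => Iff.rfl) ?_
  refine (comp₂_OC_arrows (b := fun i => single (c i)) _ (Gen.mul t).toOC (Gen.mor (f 0)).toOC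
    (Gen.mor (f 1)).toOC).trans ?_
  exact congrArg₂ (· ++ ·) (OpElt.postcomp_id [⟨c 0, f 0⟩]) (OpElt.postcomp_id [⟨c 1, f 1⟩])

/-- The right-hand side for `(f₁, f₂)` is the transposition applied to the left-hand side for `(f₂,
f₁)`, a pair that is again orthogonal by symmetry. -/
theorem OrthRel.rhs_toOC {t : C} {c : Profile C} (r : OrthRel O t c) :
    r.rhs (OC C) Gen.toOC = r.s₂ := by
  obtain ⟨c, f, h⟩ := r
  have h1 := OrthRel.lhs_toOC (OrthRel.mk (fun i => c (Equiv.swap 0 1 i))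
    (fun i => f (Equiv.swap 0 1 i)) (O.symm h))
  refine (congrArg (OpElt.act (swapHom c)) h1).trans ?_
  refine OpElt.ext_lt (fun i j => Iff.rfl) fun i => ?_
  refine (OpElt.act_arrow (swapHom c) _ i).trans ?_
  exact congrArg (fun i => (⟨c i, f i⟩ : Σ s : C, (s ⟶ t))) (Equiv.swap_apply_self 0 1 i)

theorem perpRel_s {t : C} {c : Profile C} (r : OrthRel O t c) : OpElt.PerpRel O r.s₁ r.s₂ := by
  obtain ⟨c, f, h⟩ := r
  refine ⟨rfl, .single ⟨0, 1, rfl, h, ?_⟩⟩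
  exact (Equiv.swap_inv 0 1).trans (one_mul _).symm

end Perp

/-! ### The three coequalizers. -/

section Coequalizers

variable {C : Type u} [SmallCategory C] {P : Operad C}

theorem sPerp_comp_projPerp (O : Orthogonality C) :
    sPerp₁ O ≫ projPerp O = sPerp₂ O ≫ projPerp O := by
  refine freeOn.hom_ext fun t c r => ?_
  refine (congrArg (((projPerp O).toHom t).app c) (freeOn.desc_ι (OC C) OrthRel.s₁ r)).trans
    (Eq.trans ?_
      (congrArg (((projPerp O).toHom t).app c) (freeOn.desc_ι (OC C) OrthRel.s₂ r)).symm)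
  exact Quotient.sound (s := perpSetoid O t c) (perpRel_s r)

theorem exists_desc_projPerp {O : Orthogonality C} (k : OC C ⟶ P)
    (w : sPerp₁ O ≫ k = sPerp₂ O ≫ k) : ∃ l : OCPerp O ⟶ P, projPerp O ≫ l = k := by
  refine ⟨OCPerp.desc O k fun {t c} r => ?_, Operad.hom_ext fun _ _ _ => rfl⟩
  refine (congrArg ((k.toHom t).app c) (freeOn.desc_ι (OC C) OrthRel.s₁ r)).symm.trans
    (Eq.trans ?_ (congrArg ((k.toHom t).app c) (freeOn.desc_ι (OC C) OrthRel.s₂ r)))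
  exact congrArg (fun h : freeOn (OrthRel O) ⟶ P => (h.toHom t).app c (freeOn.ι r)) w

theorem app_lhs_eq_app_rhs {O : Orthogonality C} {h : freeOn (Gen C) ⟶ P}
    (w : rPerp₁ O ≫ h = rPerp₂ O ≫ h) {t : C} {c : Profile C} (r : RelPerp O t c) :
    (h.toHom t).app c (RelPerp.lhs _ freeOn.ι r) =
      (h.toHom t).app c (RelPerp.rhs _ freeOn.ι r) := by
  refine (congrArg ((h.toHom t).app c) (freeOn.desc_ι _ _ r)).symm.trans (Eq.trans ?_
    (congrArg ((h.toHom t).app c) (freeOn.desc_ι _ _ r)))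
  exact congrArg (fun k : freeOn (RelPerp O) ⟶ P => (k.toHom t).app c (freeOn.ι r)) w

theorem rPerp_comp (O : Orthogonality C) {h : freeOn (Gen C) ⟶ P}
    (w : ∀ {t : C} {c : Profile C} (r : RelPerp O t c),
      (h.toHom t).app c (RelPerp.lhs _ freeOn.ι r) =
        (h.toHom t).app c (RelPerp.rhs _ freeOn.ι r)) :
    rPerp₁ O ≫ h = rPerp₂ O ≫ h :=
  freeOn.hom_ext fun t c r =>
    (congrArg ((h.toHom t).app c) (freeOn.desc_ι _ _ r)).trans ((w r).trans
      (congrArg ((h.toHom t).app c) (freeOn.desc_ι _ _ r)).symm)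

/-- With its companion for the right-hand sides, this shows that `q` carries the `⊥`-relations in
the free operad to the pair `s₁`, `s₂` in `O_C`; it links the two presentations of `O_(C,⊥)`. -/
theorem q_app_orth_lhs {O : Orthogonality C} {t : C} {c : Profile C} (r : OrthRel O t c) :
    ((q C).toHom t).app c (r.lhs _ freeOn.ι) = r.s₁ :=
  (RelPerp.app_lhs (O := O) (q C) (g' := Gen.toOC) q_ι (.inr r)).trans r.lhs_toOC

theorem q_app_orth_rhs {O : Orthogonality C} {t : C} {c : Profile C} (r : OrthRel O t c) :
    ((q C).toHom t).app c (r.rhs _ freeOn.ι) = r.s₂ :=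
  (RelPerp.app_rhs (O := O) (q C) (g' := Gen.toOC) q_ι (.inr r)).trans r.rhs_toOC

theorem rPerp_comp_q (O : Orthogonality C) :
    rPerp₁ O ≫ (q C ≫ projPerp O) = rPerp₂ O ≫ (q C ≫ projPerp O) := by
  refine rPerp_comp O fun {t c} r => ?_
  rcases r with r | r
  · refine congrArg (((projPerp O).toHom t).app c) ?_
    exact (Rel.app_lhs (q C) (g' := Gen.toOC) q_ι r).trans ((OC.relModel.rel r).trans
      (Rel.app_rhs (q C) (g' := Gen.toOC) q_ι r).symm)
  · refine (congrArg (((projPerp O).toHom t).app c) (q_app_orth_lhs r)).trans (Eq.trans ?_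
      (congrArg (((projPerp O).toHom t).app c) (q_app_orth_rhs r)).symm)
    exact Quotient.sound (s := perpSetoid O t c) (perpRel_s r)

/-- Two quotients in succession: the relations of `C` factor `h` as `q C ≫ k`, and the
`⊥`-relations, read through `q`, say that `k` factors through the projection. -/
theorem exists_desc_q_projPerp {O : Orthogonality C} (h : freeOn (Gen C) ⟶ P)
    (w : rPerp₁ O ≫ h = rPerp₂ O ≫ h) : ∃ l : OCPerp O ⟶ P, (q C ≫ projPerp O) ≫ l = h := by
  obtain ⟨k, rfl⟩ := exists_desc_q h (r_comp fun r => app_lhs_eq_app_rhs w (.inl r))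
  obtain ⟨l, rfl⟩ := exists_desc_projPerp (O := O) k (freeOn.hom_ext fun t c r => by
    refine (congrArg ((k.toHom t).app c) (freeOn.desc_ι (OC C) OrthRel.s₁ r)).trans
      (Eq.trans ?_ (congrArg ((k.toHom t).app c) (freeOn.desc_ι (OC C) OrthRel.s₂ r)).symm)
    refine (congrArg ((k.toHom t).app c) (q_app_orth_lhs r)).symm.trans
      ((app_lhs_eq_app_rhs w (.inr r)).trans
        (congrArg ((k.toHom t).app c) (q_app_orth_rhs r))))
  exact ⟨l, Category.assoc _ _ _⟩

theorem nonempty_isColimit_cofork {V : Type*} [Category V] {X Y Z : V} {f g : X ⟶ Y} {p : Y ⟶ Z}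
    (w : f ≫ p = g ≫ p) (hp : ∀ {W : V} (h : Y ⟶ W), f ≫ h = g ≫ h → ∃ k, p ≫ k = h)
    (hp' : ∀ {W : V} {k k' : Z ⟶ W}, p ≫ k = p ≫ k' → k = k') :
    Nonempty (Limits.IsColimit (Limits.Cofork.ofπ p w)) :=
  ⟨Limits.Cofork.IsColimit.mk _ (fun s => (hp s.π s.condition).choose)
    (fun s => (hp s.π s.condition).choose_spec)
    (fun s _ hm => hp' (hm.trans (hp s.π s.condition).choose_spec.symm))⟩

end Coequalizers

/-! ### Naturality of the presentations. -/

section Naturality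

theorem freeMap_toOperad_ι {C D : Type u} (f : C → D) {X : NonSymSeq C} {Y : NonSymSeq D}
    (m : ∀ {t : C} {c : Profile C}, X t c → Y (f t) (c.map f)) {t : C} {c : Profile C} (x : X t c) :
    mapOp (freeMap (X := X) (Y := Y) f m).toOperad (freeOn.ι x) = freeOn.ι (X := Y) (m x) :=
  freeOn.desc_ι ((freeOn Y).pullback f) (fun {_ _} x => freeOn.ι (X := Y) (m x)) x

/-- Morphisms out of a free operad with the same underlying map of colors agree if they agree on
the generators. -/
theorem ColoredOperad.hom_ext_freeOn {C D : Type u} {X : NonSymSeq C} {Q : Operad D}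
    (f : C → D) (φ ψ : freeOn X ⟶ Q.pullback f)
    (h : ∀ {t : C} {c : Profile C} (x : X t c), mapOp φ (freeOn.ι x) = mapOp ψ (freeOn.ι x)) :
    ColoredOperad.Hom.mk (P := ⟨C, freeOn X⟩) (Q := ⟨D, Q⟩) f φ = ColoredOperad.Hom.mk f ψ :=
  congrArg (ColoredOperad.Hom.mk (P := ⟨C, freeOn X⟩) (Q := ⟨D, Q⟩) f)
    (freeOn.hom_ext fun _ _ => h)

variable {C D : Type u} [SmallCategory C] [SmallCategory D] (F : C ⥤ D)

theorem freeMap_gen_ι {t : C} {c : Profile C} (x : Gen C t c) :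
    mapOp (freeMap (X := Gen C) (Y := Gen D) F.obj (Gen.map F)).toOperad (freeOn.ι x) =
      freeOn.ι (x.map F) :=
  freeMap_toOperad_ι F.obj (Gen.map F) x

/-- At a relation `r`, one composite gives the left-hand side of the image of `r`, the other the
image of its left-hand side; `Rel.mapOp_lhs` identifies them. -/
theorem r₁_natural :
    freeMap (X := Rel C) (Y := Rel D) F.obj (Rel.map F) ≫ (ColoredOperad.fibre D).map (r₁ D) =
      (ColoredOperad.fibre C).map (r₁ C) ≫ freeMap (X := Gen C) (Y := Gen D) F.obj (Gen.map F) := by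
  refine ColoredOperad.hom_ext_freeOn F.obj _ _ fun {t c} r => ?_
  refine (congrArg (((r₁ D).toHom _).app _) (freeMap_toOperad_ι F.obj (Rel.map F) r)).trans
    ((freeOn.desc_ι _ _ _).trans (Eq.trans ?_ (congrArg (mapOp
      (freeMap (X := Gen C) (Y := Gen D) F.obj (Gen.map F)).toOperad) (freeOn.desc_ι _ _ r)).symm))
  exact (Rel.mapOp_lhs _ (freeMap_gen_ι F) r).symm

theorem r₂_natural :
    freeMap (X := Rel C) (Y := Rel D) F.obj (Rel.map F) ≫ (ColoredOperad.fibre D).map (r₂ D) =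
      (ColoredOperad.fibre C).map (r₂ C) ≫ freeMap (X := Gen C) (Y := Gen D) F.obj (Gen.map F) := by
  refine ColoredOperad.hom_ext_freeOn F.obj _ _ fun {t c} r => ?_
  refine (congrArg (((r₂ D).toHom _).app _) (freeMap_toOperad_ι F.obj (Rel.map F) r)).trans
    ((freeOn.desc_ι _ _ _).trans (Eq.trans ?_ (congrArg (mapOp
      (freeMap (X := Gen C) (Y := Gen D) F.obj (Gen.map F)).toOperad) (freeOn.desc_ι _ _ r)).symm))
  exact (Rel.mapOp_rhs _ (freeMap_gen_ι F) r).symm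

theorem Gen.toOC_map {t : C} {c : Profile C} (x : Gen C t c) :
    (x.map F).toOC = OpElt.map F x.toOC := by
  cases x with
  | unit => exact OpElt.ext rfl (funext fun i => i.elim0)
  | mor f => rfl
  | mul => exact OpElt.ext rfl (funext fun _ => (F.map_id _).symm)

theorem q_natural :
    freeMap (X := Gen C) (Y := Gen D) F.obj (Gen.map F) ≫ (ColoredOperad.fibre D).map (q D) =
      (ColoredOperad.fibre C).map (q C) ≫
        (ColoredOperad.Hom.mk F.obj (OC.map F) :
          ColoredOperad.mk C (OC C) ⟶ ColoredOperad.mk D (OC D)) := by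
  refine ColoredOperad.hom_ext_freeOn F.obj _ _ fun {t c} x => ?_
  refine (congrArg (((q D).toHom _).app _) (freeMap_gen_ι F x)).trans
    ((q_ι _).trans ((x.toOC_map F).trans ?_))
  exact (congrArg (OpElt.map F) (q_ι x)).symm

variable {F} {O : Orthogonality C} {O' : Orthogonality D} (hF : Orthogonality.Preserves F O O')

theorem rPerp₁_natural :
    freeMap (X := RelPerp O) (Y := RelPerp O') F.obj (RelPerp.map hF) ≫
        (ColoredOperad.fibre D).map (rPerp₁ O') =
      (ColoredOperad.fibre C).map (rPerp₁ O) ≫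
        freeMap (X := Gen C) (Y := Gen D) F.obj (Gen.map F) := by
  refine ColoredOperad.hom_ext_freeOn F.obj _ _ fun {t c} r => ?_
  refine (congrArg (((rPerp₁ O').toHom _).app _)
    (freeMap_toOperad_ι F.obj (RelPerp.map hF) r)).trans
    ((freeOn.desc_ι _ _ _).trans (Eq.trans ?_ (congrArg (mapOp
      (freeMap (X := Gen C) (Y := Gen D) F.obj (Gen.map F)).toOperad) (freeOn.desc_ι _ _ r)).symm))
  exact (RelPerp.mapOp_lhs _ hF (freeMap_gen_ι F) r).symm

theorem rPerp₂_natural :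
    freeMap (X := RelPerp O) (Y := RelPerp O') F.obj (RelPerp.map hF) ≫
        (ColoredOperad.fibre D).map (rPerp₂ O') =
      (ColoredOperad.fibre C).map (rPerp₂ O) ≫
        freeMap (X := Gen C) (Y := Gen D) F.obj (Gen.map F) := by
  refine ColoredOperad.hom_ext_freeOn F.obj _ _ fun {t c} r => ?_
  refine (congrArg (((rPerp₂ O').toHom _).app _)
    (freeMap_toOperad_ι F.obj (RelPerp.map hF) r)).trans
    ((freeOn.desc_ι _ _ _).trans (Eq.trans ?_ (congrArg (mapOp
      (freeMap (X := Gen C) (Y := Gen D) F.obj (Gen.map F)).toOperad) (freeOn.desc_ι _ _ r)).symm))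
  exact (RelPerp.mapOp_rhs _ hF (freeMap_gen_ι F) r).symm

theorem q_projPerp_natural :
    freeMap (X := Gen C) (Y := Gen D) F.obj (Gen.map F) ≫
        (ColoredOperad.fibre D).map (q D ≫ projPerp O') =
      (ColoredOperad.fibre C).map (q C ≫ projPerp O) ≫
        (ColoredOperad.Hom.mk F.obj (OCPerp.map hF) :
          ColoredOperad.mk C (OCPerp O) ⟶ ColoredOperad.mk D (OCPerp O')) := by
  refine ColoredOperad.hom_ext_freeOn F.obj _ _ fun {t c} x => ?_
  -- The square for `q` is evaluated before the quotient; taking classes then yields the square for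
  -- the projection.
  have h : ((q D).toHom (F.obj t)).app (c.map F.obj) (mapOp (freeMap (X := Gen C) (Y := Gen D)
      F.obj (Gen.map F)).toOperad (freeOn.ι x)) =
      OpElt.map F (((q C).toHom t).app c (freeOn.ι x)) :=
    (congrArg (((q D).toHom _).app _) (freeMap_gen_ι F x)).trans
      ((q_ι _).trans ((x.toOC_map F).trans (congrArg (OpElt.map F) (q_ι x)).symm))
  exact congrArg (Quotient.mk (perpSetoid O' (F.obj t) (c.map F.obj))) h

end Naturality

end ColOp

/-! ### Assembly of the coequalizers and their naturality. -/

theorem corollary4p12 :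
    -- `O_C` is presented by the generators and the functoriality, monoid and compatibility relations
    (∀ (C : Type u) [SmallCategory C],
      ∃ w : r₁ C ≫ q C = r₂ C ≫ q C, Nonempty (Limits.IsColimit (Limits.Cofork.ofπ (q C) w))) ∧
    -- `O_(C,⊥)` is presented by the same generators with the `⊥`-commutativity relations added
    (∀ (C : Type u) [SmallCategory C] (O : Orthogonality C),
      ∃ w : rPerp₁ O ≫ (q C ≫ projPerp O) = rPerp₂ O ≫ (q C ≫ projPerp O),
        Nonempty (Limits.IsColimit (Limits.Cofork.ofπ (q C ≫ projPerp O) w))) ∧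
    -- `O_(C,⊥)` is the quotient of `O_C` by the `⊥`-commutativity relations
    (∀ (C : Type u) [SmallCategory C] (O : Orthogonality C),
      ∃ w : sPerp₁ O ≫ projPerp O = sPerp₂ O ≫ projPerp O,
        Nonempty (Limits.IsColimit (Limits.Cofork.ofπ (projPerp O) w))) ∧
    -- the first coequalizer is natural in `C`
    (∃ (ρ₁ ρ₂ : relFunctor.{u} ⟶ genFunctor.{u}) (κ : genFunctor.{u} ⟶ opFunctor.{u}),
      ∀ C : Cat.{u, u},
        ρ₁.app C = (ColoredOperad.fibre C).map (r₁ C) ∧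
        ρ₂.app C = (ColoredOperad.fibre C).map (r₂ C) ∧
        κ.app C = (ColoredOperad.fibre C).map (q C)) ∧
    -- the second coequalizer is natural in `(C, ⊥)`
    (∃ (ρ₁ ρ₂ : relPerpFunctor.{u} ⟶ OrthCat.forget.{u} ⋙ genFunctor.{u})
        (κ : OrthCat.forget.{u} ⋙ genFunctor.{u} ⟶ opPerpFunctor.{u}),
      ∀ X : OrthCat.{u},
        ρ₁.app X = (ColoredOperad.fibre X.cat).map (rPerp₁ X.orth) ∧
        ρ₂.app X = (ColoredOperad.fibre X.cat).map (rPerp₂ X.orth) ∧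
        κ.app X = (ColoredOperad.fibre X.cat).map (q X.cat ≫ projPerp X.orth)) := by
  refine ⟨fun C _ => ⟨r_comp_q, nonempty_isColimit_cofork _ exists_desc_q q_comp_ext⟩,
    fun C _ O => ⟨rPerp_comp_q O, nonempty_isColimit_cofork _ exists_desc_q_projPerp fun h => ?_⟩,
    fun C _ O => ⟨sPerp_comp_projPerp O,
      nonempty_isColimit_cofork _ exists_desc_projPerp (projPerp_comp_ext O)⟩,
    ⟨{ app := fun C => (ColoredOperad.fibre C).map (r₁ C)
       naturality := fun _ _ F => r₁_natural F.toFunctor },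
     { app := fun C => (ColoredOperad.fibre C).map (r₂ C)
       naturality := fun _ _ F => r₂_natural F.toFunctor },
     { app := fun C => (ColoredOperad.fibre C).map (q C)
       naturality := fun _ _ F => q_natural F.toFunctor },
     fun _ => ⟨rfl, rfl, rfl⟩⟩,
    ⟨{ app := fun X => (ColoredOperad.fibre X.cat).map (rPerp₁ X.orth)
       naturality := fun _ _ F => rPerp₁_natural F.preserves },
     { app := fun X => (ColoredOperad.fibre X.cat).map (rPerp₂ X.orth)
       naturality := fun _ _ F => rPerp₂_natural F.preserves },
     { app := fun X => (ColoredOperad.fibre X.cat).map (q X.cat ≫ projPerp X.orth)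
       naturality := fun _ _ F => q_projPerp_natural F.preserves },
     fun _ => ⟨rfl, rfl, rfl⟩⟩⟩
  -- Uniqueness for the composite presentation: `q` is cancelled, then the projection.
  rw [Category.assoc, Category.assoc] at h
  exact projPerp_comp_ext O (q_comp_ext h)
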